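/- **Setting.** There are $T\ge 1$ rounds and a policy set $\Pi$. In round $t$ the learner plays a policy $\pi_t\in\Pi$, possibly at random, and receives feedback that contains a reward $R_t\in[0,1]$; given $\pi_t$, the feedback is drawn independently of the past from a distribution that depends only on $t$ and $\pi_t$ and is fixed in advance (feedback $=\mathrm{env}_t(\pi_t,z_t)$ with i.i.d. noise $z_t$). Let $f_t(\pi)\in[0,1]$ be the expected reward of $\pi$ in round $t$, $f_t^\star=\sup_{\pi\in\Pi}f_t(\pi)$, and $\textsc{D-Reg}=\sum_{t=1}^T(f_t^\star-R_t)$. A non-stationarity measure is a function $\Delta(\cdot)$ with $\Delta(t)\ge\sup_{\pi}|f_t(\pi)-f_{t+1}(\pi)|$ for $1\le t<T$; put $\Delta_{[s,e]}=\sum_{\tau=s}^{e-1}\Delta(\tau)$, $\Delta=\Delta_{[1,T]}$ and $L=1+|\{1\le t<T:\Delta(t)\ne0\}|$. Fix $\delta\in(0,1)$. **Assumption 1** (base algorithm). $\mathsf{ALG}$ outputs at the beginning of each round a number $\widetilde f\in[0,1]$, and there are a non-stationarity measure $\Delta(\cdot)$ and a non-increasing $\rho$ on $\{1,\dots,T\}$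 with $\rho(t)\ge 1/\sqrt t$ and $C(t)=t\rho(t)$ non-decreasing such that the following holds. Whenever $\mathsf{ALG}$ is run alone, from scratch, on rounds $\tau_1<\dots<\tau_t$ of $\{1,\dots,T\}$ (for instance $\tau_i=i$) with $\Delta_{[\tau_1,\tau_t]}\le\rho(t)$, then with probability at least $1-\delta/T$ $$\widetilde f_{t}\ \ge\ \min_{i\le t}f^\star_{\tau_i}-\Delta_{[\tau_1,\tau_t]}\qquad\text{and}\qquad \frac1t\sum_{i=1}^t\bigl(\widetilde f_{i}-R_{\tau_i}\bigr)\ \le\ \rho(t)+\Delta_{[\tau_1,\tau_t]},$$ where $\widetilde f_i$ is the output in the $i$-th round of the run. **MASTER.** Let $\bar\rho(t)=\min\{C(t),t\}/t$ and $\widehat\rho(t)=6(\log_2T+1)\log(T/\delta)\,\bar\rho(t)$. MASTER runs blocks of planned lengths $2^0,2^1,2^2,\dots$. In the block of order $n$ that starts at round $t_n$, for each $m\le n$ and each multiple $\tau<2^n$ of $2^m$, independently with probability $\bar\rho(2^n)/\bar\rho(2^m)$, a new instance of $\mathsf{ALG}$ (of order $m$) is scheduled for the rounds $t_n+\tau,\dots,t_n+\tau+2^m-1$.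 In every round the shortest scheduled instance covering it is executed and updated, all others being paused; let $\widetilde g_t$ be its output $\widetilde f$. After each round $t$, with $U_t=\min_{t_n\le\tau\le t}\widetilde g_\tau$, MASTER restarts with a block of order $0$ if for some scheduled order-$m$ instance that ends at $t$ and started at $s$ one has $2^{-m}\sum_{\tau=s}^tR_\tau\ge U_t+9\widehat\rho(2^m)$, or if $\frac1{t-t_n+1}\sum_{\tau=t_n}^t(\widetilde g_\tau-R_\tau)\ge3\widehat\rho(t-t_n+1)$. MASTER does not use $L$ or $\Delta$. **Theorem.** There are universal constants $K>0$ and $k\in\mathbb N$ such that the following holds. Suppose that $\mathsf{ALG}$ satisfies Assumption 1 with $C(t)=c_1t^p+c_2$, where $p\in[\frac12,1)$ and $c_1,c_2>0$. Put $\Lambda=K(1+\log(T/\delta))^k$. If $p=\frac12$, then with probability at least $1-\delta$ MASTER has $$\textsc{D-Reg}\le \Lambda\,\min\Bigl\{\bigl(c_1+\tfrac{c_2}{c_1}\bigr)\sqrt{LT},\ \bigl(c_1^{2/3}+c_2c_1^{-4/3}\bigr)\Delta^{1/3}T^{2/3}+\bigl(c_1+\tfrac{c_2}{c_1}\bigr)\sqrt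 T\Bigr\},$$ and if $p>\frac12$, then with probability at least $1-\delta$ $$\textsc{D-Reg}\le \Lambda\,\min\Bigl\{c_1L^{1-p}T^p+\tfrac{c_2}{c_1}L^pT^{1-p},\ \bigl(c_1\Delta^{1-p}T\bigr)^{\frac1{2-p}}+c_1T^p+\tfrac{c_2}{c_1}\Bigl[\bigl(c_1^{-p}\Delta^{p}T^{2-2p}\bigr)^{\frac1{2-p}}+T^{1-p}\Bigr]\Bigr\}.$$ Here the terms with the factor $c_2/c_1$ in the second bound are of lower order in $T$ for sublinear $L$ and $\Delta$; without them the bound reads $\widetilde{\mathcal O}\bigl(\min\{c_1L^{1-p}T^p,\ (c_1\Delta^{1-p}T)^{1/(2-p)}+c_1T^p\}\bigr)$. -/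

import Mathlib

open MeasureTheory

noncomputable section

/-- A randomized sequential learner with internal states `S`. At the start of a round it receives a
fresh random seed in `U` and outputs a policy together with an auxiliary number; after the feedback
of the round it moves to its next state. The seeds of different rounds are independent, so all the
randomization of the learner (including that of its start) is carried by them. -/
structure Learner (S U Pol O : Type*) where
  init : S
  policy : S → U → Pol
  est : S → U → ℝ
  update : S → U → O → S

namespace Learner

variable {S U Pol O Z : Type*}

/-- Measurability of a learner in all its arguments. -/
structure IsMeasurable [MeasurableSpace S] [MeasurableSpace U] [MeasurableSpace Pol]
    [MeasurableSpace O] (A : Learner S U Pol O) : Prop where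
  policy : Measurable fun x : S × U => A.policy x.1 x.2
  est : Measurable fun x : S × U => A.est x.1 x.2
  update : Measurable fun x : S × U × O => A.update x.1 x.2.1 x.2.2

/-- The state of the learner before its `i`-th round (`i = 0, 1, …`). In its `i`-th round it faces
the response map `env i`, the environment noise is `(ω i).1` and the seed is `(ω i).2`. -/
def state (A : Learner S U Pol O) (env : ℕ → Pol → Z → O) (ω : ℕ → Z × U) : ℕ → S
  | 0 => A.init
  | i + 1 =>
      A.update (A.state env ω i) (ω i).2
        (env i (A.policy (A.state env ω i) (ω i).2) (ω i).1)

/-- The feedback received in the `i`-th round. -/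
def feedback (A : Learner S U Pol O) (env : ℕ → Pol → Z → O) (ω : ℕ → Z × U) (i : ℕ) : O :=
  env i (A.policy (A.state env ω i) (ω i).2) (ω i).1

/-- The auxiliary number output at the start of the `i`-th round. -/
def output (A : Learner S U Pol O) (env : ℕ → Pol → Z → O) (ω : ℕ → Z × U) (i : ℕ) : ℝ :=
  A.est (A.state env ω i) (ω i).2

end Learner

/-- The law of the noise and of the seeds of an interaction: all rounds are independent, and in each
round the noise of the environment (law `νZ`) and the seed of the learner (law `νU`) are
independent. -/
def interactionLaw {Z U : Type*} [MeasurableSpace Z] [MeasurableSpace U]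
    (νZ : Measure Z) [IsProbabilityMeasure νZ] (νU : Measure U) [IsProbabilityMeasure νU] :
    Measure (ℕ → Z × U) :=
  Measure.infinitePi fun _ => νZ.prod νU

section Environment

variable {Pol O Z : Type*} [MeasurableSpace Z]

/-- An environment (rounds `0, 1, …`): in round `t`, playing policy `π` yields the feedback
`env t π z`, with `z` drawn afresh. The feedback contains a reward in `[0, 1]`. -/
structure IsEnvironment [MeasurableSpace Pol] [MeasurableSpace O]
    (env : ℕ → Pol → Z → O) (rew : O → ℝ) : Prop where
  measurable_env : ∀ t, Measurable fun x : Pol × Z => env t x.1 x.2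
  measurable_rew : Measurable rew
  rew_mem : ∀ o, rew o ∈ Set.Icc (0 : ℝ) 1

/-- The expected reward `f_t(π)`. -/
def meanReward (νZ : Measure Z) (env : ℕ → Pol → Z → O) (rew : O → ℝ) (t : ℕ) (π : Pol) : ℝ :=
  ∫ z, rew (env t π z) ∂νZ

/-- The optimal expected reward `f_t^⋆`. -/
def optReward (νZ : Measure Z) (env : ℕ → Pol → Z → O) (rew : O → ℝ) (t : ℕ) : ℝ :=
  ⨆ π, meanReward νZ env rew t π

/-- `Δ` is a non-stationarity measure for the rounds `0, …, T - 1`. -/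
def IsNonstationarity (νZ : Measure Z) (env : ℕ → Pol → Z → O) (rew : O → ℝ) (T : ℕ)
    (Δ : ℕ → ℝ) : Prop :=
  ∀ t, t + 1 < T → ∀ π, |meanReward νZ env rew t π - meanReward νZ env rew (t + 1) π| ≤ Δ t

end Environment

/-- The total drift `Δ_{[s,e]}`. -/
def drift (Δ : ℕ → ℝ) (s e : ℕ) : ℝ := ∑ t ∈ Finset.Ico s e, Δ t

open Classical in
/-- The number `L` of stationary pieces of the rounds `0, …, T - 1`. -/
def pieces (Δ : ℕ → ℝ) (T : ℕ) : ℕ :=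
  1 + ((Finset.range (T - 1)).filter fun t => Δ t ≠ 0).card

/-- The requirement on the base algorithm `A`: run alone from its initial state on any rounds
`τ 0 < τ 1 < ⋯ < τ j` of the environment (the case `τ i = i` is a run from the first round), as long
as the drift over these rounds is at most `ρ (j + 1)`, with probability at least `1 - δ / T` its
estimate is optimistic and its average regret against the estimates is small, both up to that
drift. -/
structure BaseGuarantee {S U Pol O Z : Type*} [MeasurableSpace Z] [MeasurableSpace U]
    (νZ : Measure Z) [IsProbabilityMeasure νZ] (νU : Measure U) [IsProbabilityMeasure νU]
    (env : ℕ → Pol → Z → O) (rew : O → ℝ) (A : Learner S U Pol O)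
    (T : ℕ) (δ : ℝ) (Δ ρ : ℕ → ℝ) : Prop where
  est_mem : ∀ s u, A.est s u ∈ Set.Icc (0 : ℝ) 1
  antitone : AntitoneOn ρ (Set.Icc 1 T)
  lower : ∀ t ∈ Set.Icc 1 T, 1 / Real.sqrt t ≤ ρ t
  monotone : MonotoneOn (fun t : ℕ => (t : ℝ) * ρ t) (Set.Icc 1 T)
  guarantee : ∀ τ : ℕ → ℕ, StrictMono τ → ∀ j, τ j < T →
    drift Δ (τ 0) (τ j) ≤ ρ (j + 1) →
    1 - δ / T ≤ (interactionLaw νZ νU).real {ω |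
      (Finset.range (j + 1)).inf' Finset.nonempty_range_add_one
          (fun i => optReward νZ env rew (τ i)) - drift Δ (τ 0) (τ j)
        ≤ A.output (fun i => env (τ i)) ω j ∧
      (1 / ((j : ℝ) + 1)) * ∑ i ∈ Finset.range (j + 1),
          (A.output (fun i => env (τ i)) ω i - rew (A.feedback (fun i => env (τ i)) ω i))
        ≤ ρ (j + 1) + drift Δ (τ 0) (τ j)}

/-- The memory of the meta-algorithm. -/
structure MasterState (S : Type*) where
  /-- the order of the current block, whose planned length is `2 ^ n` -/
  n : ℕ
  /-- the number of completed rounds of the current block -/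
  pos : ℕ
  /-- whether an instance of order `m` covers the latest round -/
  on : ℕ → Prop
  /-- the (possibly frozen) state of the latest instance of order `m` -/
  inst : ℕ → S
  /-- the auxiliary numbers output in the rounds of the current block -/
  g : ℕ → ℝ
  /-- the rewards received in the rounds of the current block -/
  R : ℕ → ℝ

namespace MasterState

variable {S U Pol O : Type*}

/-- The start of a block of order `n`. -/
def fresh (A : Learner S U Pol O) (n : ℕ) : MasterState S where
  n := n
  pos := 0
  on := fun _ => False
  inst := fun _ => A.init
  g := fun _ => 0
  R := fun _ => 0

open Classical in
/-- Scheduling at the start of a round: for each order `m ≤ n` whose length `2 ^ m` divides the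
offset in the block, a new instance of order `m`, in the initial state, starts with probability
`ρ (2 ^ n) / ρ (2 ^ m)`, independently (`v m` is uniform on `[0, 1]`). Tossing the coins for an
offset when it is reached, not all of them at the start of the block, does not change the law. -/
def schedule (A : Learner S U Pol O) (ρ : ℕ → ℝ) (σ : MasterState S) (v : ℕ → unitInterval) :
    MasterState S :=
  { σ with
    on := fun m =>
      if 2 ^ m ∣ σ.pos then m ≤ σ.n ∧ (v m : ℝ) ≤ ρ (2 ^ σ.n) / ρ (2 ^ m) else σ.on m
    inst := fun m => if 2 ^ m ∣ σ.pos then A.init else σ.inst m }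

/-- The order of the active instance: the shortest one that covers the current round. -/
def active (σ : MasterState S) : ℕ := sInf {m | σ.on m}

/-- Execution of a round by the active instance, all others being paused. -/
def exec (A : Learner S U Pol O) (rew : O → ℝ) (σ : MasterState S) (u : U) (o : O) :
    MasterState S :=
  { σ with
    pos := σ.pos + 1
    inst := Function.update σ.inst σ.active (A.update (σ.inst σ.active) u o)
    g := Function.update σ.g σ.pos (A.est (σ.inst σ.active) u)
    R := Function.update σ.R σ.pos (rew o) }

/-- The inflated average regret `6 (log₂ T + 1) log (T / δ) ρ(t)`. -/
def rhoHat (ρ : ℕ → ℝ) (T : ℕ) (δ : ℝ) (t : ℕ) : ℝ :=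
  6 * (Real.logb 2 T + 1) * Real.log (T / δ) * ρ t

/-- Test 1 fails (after a round): an instance of order `m` ends with this round, and the average
reward over its interval exceeds `min g` over the block by at least `9 rhoHat (2 ^ m)`. -/
def test1Fails (ρ : ℕ → ℝ) (T : ℕ) (δ : ℝ) (σ : MasterState S) : Prop :=
  ∃ m, σ.on m ∧ 2 ^ m ∣ σ.pos ∧
    (⨅ i : Fin σ.pos, σ.g i) + 9 * rhoHat ρ T δ (2 ^ m) ≤
      (1 / 2 ^ m) * ∑ i ∈ Finset.Ico (σ.pos - 2 ^ m) σ.pos, σ.R i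

/-- Test 2 fails (after a round): the average of `g - R` over the block is at least
`3 rhoHat`. -/
def test2Fails (ρ : ℕ → ℝ) (T : ℕ) (δ : ℝ) (σ : MasterState S) : Prop :=
  3 * rhoHat ρ T δ σ.pos ≤ (1 / (σ.pos : ℝ)) * ∑ i ∈ Finset.range σ.pos, (σ.g i - σ.R i)

open Classical in
/-- Restart with a block of order `0` if a test fails; otherwise go on to the next block if the
current one is complete. -/
def next (A : Learner S U Pol O) (ρ : ℕ → ℝ) (T : ℕ) (δ : ℝ) (σ : MasterState S) :
    MasterState S :=
  if σ.test1Fails ρ T δ ∨ σ.test2Fails ρ T δ then fresh A 0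
  else if σ.pos = 2 ^ σ.n then fresh A (σ.n + 1)
  else σ

end MasterState

/-- The meta-algorithm MASTER on top of the base algorithm `A`, with average regret function `ρ`,
horizon `T` and confidence `δ`. Its seed in a round is a seed for the active instance and
a sequence of uniform numbers for the scheduling. -/
def master {S U Pol O : Type*} (A : Learner S U Pol O) (rew : O → ℝ) (ρ : ℕ → ℝ) (T : ℕ) (δ : ℝ) :
    Learner (MasterState S) (U × (ℕ → unitInterval)) Pol O where
  init := MasterState.fresh A 0
  policy := fun σ x =>
    let σ' := σ.schedule A ρ x.2
    A.policy (σ'.inst σ'.active) x.1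
  est := fun σ x =>
    let σ' := σ.schedule A ρ x.2
    A.est (σ'.inst σ'.active) x.1
  update := fun σ x o => (((σ.schedule A ρ x.2).exec A rew x.1 o).next A ρ T δ)

/-- The law of the seeds of MASTER. -/
def masterSeed {U : Type*} [MeasurableSpace U] (νU : Measure U) :
    Measure (U × (ℕ → unitInterval)) :=
  νU.prod (Measure.infinitePi fun _ : ℕ => (volume : Measure unitInterval))

instance {U : Type*} [MeasurableSpace U] (νU : Measure U) [IsProbabilityMeasure νU] :
    IsProbabilityMeasure (masterSeed νU) := by
  unfold masterSeed
  infer_instance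

/-- The dynamic regret of a learner over the rounds `0, …, T - 1`. -/
def dynamicRegret {S U Pol O Z : Type*} [MeasurableSpace Z] (νZ : Measure Z)
    (env : ℕ → Pol → Z → O) (rew : O → ℝ) (A : Learner S U Pol O) (T : ℕ) (ω : ℕ → Z × U) : ℝ :=
  ∑ t ∈ Finset.range T, (optReward νZ env rew t - rew (A.feedback env ω t))

end

/-! The proof separates a deterministic regret bound for well-behaved runs from the probability that
a run is well-behaved.

Divide the rounds into pieces on which the optimal reward `f` varies by at most `d`, with `d` at
most the rate of every window inside the piece. Write `f - R = (g - R) + (f - g)`, where `g` is the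
estimate of the active instance. Test 2 bounds the sum of `g - R` over every block. For `f - g`,
compare the value of `f` at the start of the piece with the running minimum `U`: a round is bad for
order `m` if this gap is at least `12 rhat (2 ^ m)`. If the gap is already present when an instance
of order `m` may start, and its window stays inside the piece, then such an instance, once
scheduled, collects so much reward that test 1 fails at its end (`restart_of_cand`, which rests on
the window estimate `sum_window_le`). So each block contains at most one scheduled instance of this
kind. Its coin succeeds with probability `ρ (2 ^ n) / ρ (2 ^ m)`, hence only about `ρ (2 ^ m) / ρ (2
^ n)` times (number of blocks plus a logarithm) such slots exist, each costing about `2 ^ m * rhat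
(2 ^ m)`. For `p ≥ 1 / 2` the resulting quantity `2 ^ m * ρ (2 ^ m) ^ 2 / ρ (2 ^ n)` is of the order
of the regret of a block of `2 ^ n` rounds (`mul_cappedRate_mul_le`). Orders increase between
restarts, and a block inside one piece restarts only if a base guarantee fails, so there are few
blocks; concavity of powers then sums up the costs (`regret_le`, `regret_le_piecesBound`).

A base guarantee holds with probability `1 - δ / T` for a fixed set of rounds, whereas the rounds of
an instance depend on earlier feedback through the restarts. Between restarts, however, the schedule
is a function of the coins alone. Given the past before round `r` and all coins, on the event of no
restart since `r`, the active instance is a run of the base algorithm on fixed rounds with fresh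
noise (`measure_violates_le`). A union over the last restart `r` bounds the failure probability in a
round by `δ / T` times one plus the expected number of restarts in its piece (`measure_viol_le`).
Conversely, in a typical run the restarts in a piece number at most one plus the failures there
(`card_restart_le`). For a piece with at most `3T / 4` rounds these two inequalities bound the
expected number of failures by `12 δ / T` per round. Markov's inequality leaves at most 23 failures
outside probability `δ / 2`, and these cost only constants (`measure_not_typical_or_viol_le`).

The two terms of the minimum come from two divisions: the stationary pieces (`exists_lab_pieces`),
and pieces short in time and small in drift, balanced against the rate (`exists_lab_drift`). The
algorithm uses neither, so each bound may be proved separately. -/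

open scoped ENNReal

/-! ### Resampling of i.i.d. sequences and exponential tail bounds. -/

section Resampling

variable {X : Type*} [MeasurableSpace X] (ν : Measure X) [IsProbabilityMeasure ν]

/-- Two independent copies of an i.i.d. sequence, combined coordinatewise by maps which preserve
the law of a coordinate, form again such a sequence. -/
theorem map_zipWith_infinitePi (ψ : ℕ → X × X → X) (hψ : ∀ i, Measurable (ψ i))
    (hν : ∀ i, (ν.prod ν).map (ψ i) = ν) :
    ((Measure.infinitePi fun _ : ℕ => ν).prod (Measure.infinitePi fun _ : ℕ => ν)).map
      (fun x i => ψ i (x.1 i, x.2 i)) = Measure.infinitePi fun _ : ℕ => ν := by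
  -- A pair of sequences and a sequence of pairs are the same i.i.d. family over `Bool × ℕ`, curried
  -- in the two possible orders.
  have h1 : (Measure.infinitePi fun _ : Bool × ℕ => ν).map
      (fun ω => ((fun i => ω (false, i)), fun i => ω (true, i)))
      = (Measure.infinitePi fun _ : ℕ => ν).prod (Measure.infinitePi fun _ : ℕ => ν) := by
    have e := Measure.infinitePi_map_curry (fun (_ : Bool) (_ : ℕ) => ν)
    have e2 := Measure.infinitePi_map_eval_prod
      (P := fun _ : Bool => Measure.infinitePi fun _ : ℕ => ν) (i := false) (j := true) (by simp)
    rw [← e2, ← e, Measure.map_map (by fun_prop) (by fun_prop)]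
    rfl
  have h2 : (Measure.infinitePi fun _ : Bool × ℕ => ν).map
      (fun ω => fun i => (ω (false, i), ω (true, i)))
      = Measure.infinitePi fun _ : ℕ => ν.prod ν := by
    have e := Measure.infinitePi_map_curry (fun (_ : ℕ) (_ : Bool) => ν)
    have e2 := Measure.infinitePi_map_eval_prod
      (P := fun _ : Bool => ν) (i := false) (j := true) (by simp)
    have e3 := Measure.map_infinitePi_infinitePi_of_inj (P := fun _ : Bool × ℕ => ν)
      (f := fun x : ℕ × Bool => (x.2, x.1)) (by intro a b h; simp_all [Prod.ext_iff])
    rw [← e3] at e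
    have e4 := Measure.infinitePi_map_pi (μ := fun _ : ℕ => Measure.infinitePi fun _ : Bool => ν)
      (f := fun _ w => (w false, w true)) (fun _ => by fun_prop)
    simp only [e2] at e4
    rw [← e4, ← e, Measure.map_map (by fun_prop) (by fun_prop),
      Measure.map_map (by fun_prop) (by fun_prop)]
    rfl
  rw [← h1, Measure.map_map (by fun_prop) (by fun_prop)]
  have h3 := Measure.infinitePi_map_pi (μ := fun _ : ℕ => ν.prod ν) (f := ψ) hψ
  simp only [hν] at h3
  rw [← h3, ← h2, Measure.map_map (by fun_prop) (by fun_prop)]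
  rfl

/-- Taking coordinate `n` from an independent copy and all others from the original leaves the law
unchanged. This replaces conditioning on the other coordinates in the supermartingale argument
below. -/
theorem lintegral_update_infinitePi (n : ℕ) {f : (ℕ → X) → ℝ≥0∞} (hf : Measurable f) :
    ∫⁻ ω, ∫⁻ x, f (Function.update ω n x) ∂ν ∂(Measure.infinitePi fun _ : ℕ => ν)
      = ∫⁻ ω, f ω ∂(Measure.infinitePi fun _ : ℕ => ν) := by
  have h := map_zipWith_infinitePi ν (fun i x => if i = n then x.2 else x.1)
    (fun i => by by_cases h : i = n <;> simp only [h, if_true, if_false] <;> fun_prop)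
    (fun i => by
      by_cases h : i = n <;> simp only [h, if_true, if_false]
      · exact (measurePreserving_snd (μ := ν) (ν := ν)).map_eq
      · exact (measurePreserving_fst (μ := ν) (ν := ν)).map_eq)
  have hm : Measurable fun (x : (ℕ → X) × (ℕ → X)) i => if i = n then x.2 i else x.1 i := by
    refine measurable_pi_iff.2 fun i => ?_
    by_cases h : i = n <;> simp only [h, if_true, if_false] <;> fun_prop
  have h2 := lintegral_prod (μ := Measure.infinitePi fun _ : ℕ => ν)
    (ν := Measure.infinitePi fun _ : ℕ => ν) _ (hf.comp hm).aemeasurable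
  simp only [Function.comp_def] at h2
  conv_rhs => rw [← h, lintegral_map hf hm, h2]
  refine lintegral_congr fun ω => ?_
  have h3 := lintegral_map (μ := Measure.infinitePi fun _ : ℕ => ν) (g := fun x : ℕ → X => x n)
    (f := fun x => f (Function.update ω n x)) (hf.comp (measurable_update ω)) (by fun_prop)
  rw [Measure.infinitePi_map_eval (fun _ : ℕ => ν) n] at h3
  rw [h3]
  refine lintegral_congr fun ω' => ?_
  congr 1
  ext i
  by_cases h : i = n
  · subst h; simp
  · simp [h]

/-- The product of nonnegative adapted factors with conditional mean at most `1` has mean at most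
`1`. -/
theorem lintegral_prod_range_le_one {h : ℕ → (ℕ → X) → ℝ≥0∞} (hm : ∀ t, Measurable (h t))
    (hd : ∀ t ω ω', (∀ u ≤ t, ω u = ω' u) → h t ω = h t ω')
    (hi : ∀ t ω, ∫⁻ x, h t (Function.update ω t x) ∂ν ≤ 1) (n : ℕ) :
    ∫⁻ ω, ∏ t ∈ Finset.range n, h t ω ∂(Measure.infinitePi fun _ : ℕ => ν) ≤ 1 := by
  induction n with
  | zero => simp
  | succ n ih =>
    rw [← lintegral_update_infinitePi ν n (by fun_prop)]
    refine le_trans (lintegral_mono fun ω => ?_) ih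
    -- The earlier factors do not see coordinate `n`, so the inner integral only meets the last
    -- factor.
    have e : ∀ x, ∏ t ∈ Finset.range n, h t (Function.update ω n x)
        = ∏ t ∈ Finset.range n, h t ω := by
      intro x
      refine Finset.prod_congr rfl fun t ht => hd t _ _ fun u hu => ?_
      rw [Function.update_of_ne]
      have := Finset.mem_range.1 ht
      omega
    simp only [Finset.prod_range_succ, e]
    have hu : Measurable fun x => h n (Function.update ω n x) := (hm n).comp (measurable_update ω)
    rw [lintegral_const_mul _ hu]
    exact mul_le_of_le_one_right' (hi n ω)

/-- Exponential tail bound for adapted increments with conditional exponential moment at most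
`1`. -/
theorem measure_le_sum_le_exp_neg {h : ℕ → (ℕ → X) → ℝ} (hm : ∀ t, Measurable (h t))
    (hd : ∀ t ω ω', (∀ u ≤ t, ω u = ω' u) → h t ω = h t ω')
    (hi : ∀ t ω, ∫⁻ x, ENNReal.ofReal (Real.exp (h t (Function.update ω t x))) ∂ν ≤ 1)
    (n : ℕ) (x : ℝ) :
    (Measure.infinitePi fun _ : ℕ => ν) {ω | x < ∑ t ∈ Finset.range n, h t ω}
      ≤ ENNReal.ofReal (Real.exp (-x)) := by
  have h1 := lintegral_prod_range_le_one ν (h := fun t ω => ENNReal.ofReal (Real.exp (h t ω)))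
    (fun t => (Real.measurable_exp.comp (hm t)).ennreal_ofReal)
    (fun t ω ω' hh => by simp only [hd t ω ω' hh]) hi n
  have h2 : ∀ ω, ∏ t ∈ Finset.range n, ENNReal.ofReal (Real.exp (h t ω))
      = ENNReal.ofReal (Real.exp (∑ t ∈ Finset.range n, h t ω)) := by
    intro ω
    rw [Real.exp_sum, ENNReal.ofReal_prod_of_nonneg fun i _ => (Real.exp_pos _).le]
  simp only [h2] at h1
  have h3 := mul_meas_ge_le_lintegral₀ (μ := Measure.infinitePi fun _ : ℕ => ν)
    (f := fun ω => ENNReal.ofReal (Real.exp (∑ t ∈ Finset.range n, h t ω)))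
    (by fun_prop) (ENNReal.ofReal (Real.exp x))
  have h4 := h3.trans h1
  have h5 : (Measure.infinitePi fun _ : ℕ => ν) {ω | x < ∑ t ∈ Finset.range n, h t ω}
      ≤ (Measure.infinitePi fun _ : ℕ => ν) {ω | ENNReal.ofReal (Real.exp x)
        ≤ ENNReal.ofReal (Real.exp (∑ t ∈ Finset.range n, h t ω))} := by
    refine measure_mono fun ω hω => ?_
    exact ENNReal.ofReal_le_ofReal (Real.exp_le_exp.2 (le_of_lt hω))
  refine h5.trans ?_
  rw [Real.exp_neg, ENNReal.ofReal_inv_of_pos (Real.exp_pos x), ENNReal.le_inv_iff_mul_le, mul_comm]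
  exact h4

end Resampling

/-! ### Measurability of the meta-algorithm. -/

theorem measurable_apply_index {α β : Type*} [MeasurableSpace α] [MeasurableSpace β]
    {f : α → ℕ → β} {k : α → ℕ} (hf : Measurable f) (hk : Measurable k) :
    Measurable fun a => f a (k a) := by
  have h : Measurable fun x : (ℕ → β) × ℕ => x.1 x.2 :=
    measurable_from_prod_countable_left fun n => by fun_prop
  exact h.comp (hf.prodMk hk)

theorem measurable_update_index {α β : Type*} [MeasurableSpace α] [MeasurableSpace β]
    {f : α → ℕ → β} {k : α → ℕ} {b : α → β} (hf : Measurable f) (hk : Measurable k)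
    (hb : Measurable b) : Measurable fun a => Function.update (f a) (k a) (b a) := by
  refine measurable_pi_iff.2 fun i => ?_
  simp only [Function.update_apply]
  exact Measurable.ite (measurableSet_eq_fun measurable_const hk) hb (by fun_prop)

theorem measurable_iInf_fin : Measurable fun x : (ℕ → ℝ) × ℕ => ⨅ i : Fin x.2, x.1 i := by
  refine measurable_from_prod_countable_left fun n => ?_
  change Measurable fun x : ℕ → ℝ => ⨅ i : Fin n, x i
  exact Measurable.iInf fun i : Fin n => measurable_pi_apply (i : ℕ)

theorem measurable_sum_Ico_sub (k : ℕ) :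
    Measurable fun x : (ℕ → ℝ) × ℕ => ∑ i ∈ Finset.Ico (x.2 - k) x.2, x.1 i := by
  refine measurable_from_prod_countable_left fun n => ?_
  exact Finset.measurable_sum (Finset.Ico (n - k) n) fun i _ => measurable_pi_apply i

namespace MasterState

variable {S U Pol O : Type*}

/-- The components of a state as a tuple. -/
def components (σ : MasterState S) :
    ℕ × ℕ × (ℕ → Prop) × (ℕ → S) × (ℕ → ℝ) × (ℕ → ℝ) :=
  (σ.n, σ.pos, σ.on, σ.inst, σ.g, σ.R)

/-- Pulling back the product structure makes a map into the states measurable exactly when its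
components are; the flags `on` take values in the discrete space `Prop`. -/
instance instMeasurableSpace [MeasurableSpace S] : MeasurableSpace (MasterState S) :=
  MeasurableSpace.comap components inferInstance

variable [MeasurableSpace S] {α : Type*} [MeasurableSpace α]

theorem measurable_components : Measurable (components (S := S)) :=
  comap_measurable _

theorem measurable_iff_components {f : α → MasterState S} :
    Measurable f ↔ Measurable fun a => (f a).components :=
  measurable_comap_iff

theorem measurable_n : Measurable (MasterState.n (S := S)) :=
  measurable_fst.comp measurable_components

theorem measurable_pos : Measurable (MasterState.pos (S := S)) :=
  (measurable_fst.comp measurable_snd).comp measurable_components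

theorem measurable_on : Measurable (MasterState.on (S := S)) :=
  (measurable_fst.comp (measurable_snd.comp measurable_snd)).comp measurable_components

theorem measurable_inst : Measurable (MasterState.inst (S := S)) :=
  (measurable_fst.comp (measurable_snd.comp (measurable_snd.comp measurable_snd))).comp
    measurable_components

theorem measurable_g : Measurable (MasterState.g (S := S)) :=
  (measurable_fst.comp (measurable_snd.comp (measurable_snd.comp
    (measurable_snd.comp measurable_snd)))).comp measurable_components

theorem measurable_R : Measurable (MasterState.R (S := S)) :=
  (measurable_snd.comp (measurable_snd.comp (measurable_snd.comp
    (measurable_snd.comp measurable_snd)))).comp measurable_components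

theorem measurable_active : Measurable (MasterState.active (S := S)) := by
  have h1 : Measurable fun p : ℕ → Prop => sInf {m | p m} := by
    refine measurable_to_countable' fun k => ?_
    -- The second alternative accounts for the default value `sInf ∅ = 0`.
    have h2 : (fun p : ℕ → Prop => sInf {m | p m}) ⁻¹' {k}
        = {p | (p k ∧ ∀ j, j < k → ¬ p j) ∨ (k = 0 ∧ ∀ j, ¬ p j)} := by
      ext p
      simp only [Set.mem_preimage, Set.mem_singleton_iff, Set.mem_ofPred_eq]
      constructor
      · rintro rfl
        by_cases h : ∃ j, p j
        · exact Or.inl ⟨Nat.sInf_mem (s := {m | p m}) h,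
            fun j hj => Nat.notMem_of_lt_sInf (s := {m | p m}) hj⟩
        · push Not at h
          refine Or.inr ⟨?_, h⟩
          simp [h]
      · rintro (⟨h, h'⟩ | ⟨rfl, h⟩)
        · exact le_antisymm (Nat.sInf_le h)
            (le_csInf ⟨k, h⟩ fun j hj => not_lt.1 fun hjk => h' j hjk hj)
        · simp [h]
    rw [h2]
    have : ∀ j, Measurable fun p : ℕ → Prop => p j := fun j => measurable_pi_apply j
    apply Measurable.setOf
    fun_prop
  exact h1.comp measurable_on

attribute [fun_prop] measurable_n measurable_pos measurable_on measurable_inst measurable_g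
  measurable_R measurable_active

theorem measurable_mk {f : α → MasterState S} (h1 : Measurable fun a => (f a).n)
    (h2 : Measurable fun a => (f a).pos) (h3 : ∀ m, Measurable fun a => (f a).on m)
    (h4 : Measurable fun a => (f a).inst) (h5 : Measurable fun a => (f a).g)
    (h6 : Measurable fun a => (f a).R) : Measurable f :=
  measurable_iff_components.2 (h1.prodMk (h2.prodMk ((measurable_pi_iff.2 h3).prodMk
    (h4.prodMk (h5.prodMk h6)))))

theorem measurable_schedule (A : Learner S U Pol O) (ρ : ℕ → ℝ) :
    Measurable fun x : MasterState S × (ℕ → unitInterval) => x.1.schedule A ρ x.2 := by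
  have hpos : ∀ m : ℕ, MeasurableSet {x : MasterState S × (ℕ → unitInterval) | 2 ^ m ∣ x.1.pos} :=
    fun m => (measurable_pos.comp measurable_fst) (MeasurableSet.of_discrete (s := {k | 2 ^ m ∣ k}))
  refine measurable_mk (by simp only [schedule]; fun_prop) (by simp only [schedule]; fun_prop)
    ?_ ?_ (by simp only [schedule]; fun_prop) (by simp only [schedule]; fun_prop)
  · intro m
    refine Measurable.ite (hpos m) ?_ ((measurable_pi_apply m).comp (by fun_prop))
    have h1 : Measurable fun x : MasterState S × (ℕ → unitInterval) => m ≤ x.1.n :=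
      (measurable_of_countable fun k : ℕ => m ≤ k).comp (measurable_n.comp measurable_fst)
    refine h1.and (measurableSet_setOfPred.1 (measurableSet_le ?_ ?_))
    · exact measurable_subtype_coe.comp ((measurable_pi_apply m).comp measurable_snd)
    · exact (measurable_of_countable fun k : ℕ => ρ (2 ^ k) / ρ (2 ^ m)).comp
        (measurable_n.comp measurable_fst)
  · refine measurable_pi_iff.2 fun m => ?_
    exact Measurable.ite (hpos m) measurable_const ((measurable_pi_apply m).comp (by fun_prop))

theorem measurable_test1 (ρ : ℕ → ℝ) (T : ℕ) (δ : ℝ) :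
    Measurable fun σ : MasterState S => σ.test1Fails ρ T δ := by
  have h3 : ∀ m : ℕ, Measurable fun σ : MasterState S => σ.on m := fun m =>
    (measurable_pi_apply m).comp measurable_on
  have h4 : ∀ m : ℕ, Measurable fun σ : MasterState S => 2 ^ m ∣ σ.pos := fun m =>
    (measurable_of_countable fun k : ℕ => 2 ^ m ∣ k).comp measurable_pos
  have h5 : ∀ m : ℕ, MeasurableSet {σ : MasterState S |
      (⨅ i : Fin σ.pos, σ.g i) + 9 * rhoHat ρ T δ (2 ^ m) ≤
        (1 / 2 ^ m) * ∑ i ∈ Finset.Ico (σ.pos - 2 ^ m) σ.pos, σ.R i} := fun m =>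
    measurableSet_le ((measurable_iInf_fin.comp (measurable_g.prodMk measurable_pos)).add measurable_const)
      (((measurable_sum_Ico_sub (2 ^ m)).comp (measurable_R.prodMk measurable_pos)).const_mul _)
  unfold test1Fails
  exact Measurable.exists fun m => (h3 m).and ((h4 m).and (measurableSet_setOfPred.1 (h5 m)))

theorem measurable_test2 (ρ : ℕ → ℝ) (T : ℕ) (δ : ℝ) :
    Measurable fun σ : MasterState S => σ.test2Fails ρ T δ := by
  refine measurableSet_setOfPred.1 (measurableSet_le ?_ ?_)
  · exact (measurable_of_countable fun k : ℕ => 3 * rhoHat ρ T δ k).comp measurable_pos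
  · have h : Measurable fun x : ((ℕ → ℝ) × (ℕ → ℝ)) × ℕ =>
        1 / (x.2 : ℝ) * ∑ i ∈ Finset.range x.2, (x.1.1 i - x.1.2 i) :=
      measurable_from_prod_countable_left fun n => by dsimp only; fun_prop
    exact h.comp ((measurable_g.prodMk measurable_R).prodMk measurable_pos)

theorem measurable_next (A : Learner S U Pol O) (ρ : ℕ → ℝ) (T : ℕ) (δ : ℝ) :
    Measurable fun σ : MasterState S => σ.next A ρ T δ := by
  have hfresh : Measurable fun n : ℕ => fresh A n := measurable_of_countable _
  refine Measurable.ite (measurableSet_setOfPred.2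
    ((measurable_test1 ρ T δ).or (measurable_test2 ρ T δ))) measurable_const
    (Measurable.ite ?_ (hfresh.comp (by fun_prop)) measurable_id)
  exact measurableSet_eq_fun measurable_pos
    ((measurable_of_countable fun k : ℕ => 2 ^ k).comp measurable_n)

variable [MeasurableSpace U] [MeasurableSpace Pol] [MeasurableSpace O]

theorem measurable_exec {A : Learner S U Pol O} (hA : A.IsMeasurable) {rew : O → ℝ}
    (hr : Measurable rew) :
    Measurable fun x : MasterState S × U × O => x.1.exec A rew x.2.1 x.2.2 := by
  have hi : Measurable fun x : MasterState S × U × O => x.1.inst x.1.active :=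
    measurable_apply_index (by fun_prop) (by fun_prop)
  refine measurable_mk (by simp only [exec]; fun_prop) (by simp only [exec]; fun_prop)
    (fun m => ?_) ?_ ?_ ?_
  · simp only [exec]
    exact (measurable_pi_apply m).comp (measurable_on.comp measurable_fst)
  · exact measurable_update_index (by fun_prop) (by fun_prop)
      (hA.update.comp (hi.prodMk measurable_snd))
  · exact measurable_update_index (by fun_prop) (by fun_prop)
      (hA.est.comp (hi.prodMk (by fun_prop)))
  · exact measurable_update_index (by fun_prop) (by fun_prop) (by fun_prop)

end MasterState

namespace Learner

variable {S U Pol O Z : Type*}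

theorem state_congr (A : Learner S U Pol O) (env : ℕ → Pol → Z → O) {ω ω' : ℕ → Z × U} {t : ℕ}
    (h : ∀ u < t, ω u = ω' u) : A.state env ω t = A.state env ω' t := by
  induction t with
  | zero => rfl
  | succ t ih => simp only [state, ih fun u hu => h u (by omega), h t (by omega)]

variable [MeasurableSpace S] [MeasurableSpace U] [MeasurableSpace Pol] [MeasurableSpace O]
  [MeasurableSpace Z]

theorem measurable_state {A : Learner S U Pol O} (hA : A.IsMeasurable) {env : ℕ → Pol → Z → O}
    (he : ∀ t, Measurable fun x : Pol × Z => env t x.1 x.2) (t : ℕ) :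
    Measurable fun ω : ℕ → Z × U => A.state env ω t := by
  induction t with
  | zero => exact measurable_const
  | succ t ih =>
    have h1 : Measurable fun ω : ℕ → Z × U => (ω t).2 := by fun_prop
    have h2 := hA.policy.comp (ih.prodMk h1)
    exact hA.update.comp (ih.prodMk (h1.prodMk ((he t).comp (h2.prodMk (by fun_prop)))))

theorem measurable_policy {A : Learner S U Pol O} (hA : A.IsMeasurable) {env : ℕ → Pol → Z → O}
    (he : ∀ t, Measurable fun x : Pol × Z => env t x.1 x.2) (t : ℕ) :
    Measurable fun ω : ℕ → Z × U => A.policy (A.state env ω t) (ω t).2 :=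
  hA.policy.comp ((measurable_state hA he t).prodMk (by fun_prop))

theorem measurable_feedback {A : Learner S U Pol O} (hA : A.IsMeasurable) {env : ℕ → Pol → Z → O}
    (he : ∀ t, Measurable fun x : Pol × Z => env t x.1 x.2) (t : ℕ) :
    Measurable fun ω : ℕ → Z × U => A.feedback env ω t :=
  (he t).comp ((measurable_policy hA he t).prodMk (by fun_prop))

theorem measurable_output {A : Learner S U Pol O} (hA : A.IsMeasurable) {env : ℕ → Pol → Z → O}
    (he : ∀ t, Measurable fun x : Pol × Z => env t x.1 x.2) (t : ℕ) :
    Measurable fun ω : ℕ → Z × U => A.output env ω t :=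
  hA.est.comp ((measurable_state hA he t).prodMk (by fun_prop))

end Learner

theorem master_isMeasurable {S U Pol O : Type*} [MeasurableSpace S] [MeasurableSpace U]
    [MeasurableSpace Pol] [MeasurableSpace O] {A : Learner S U Pol O} (hA : A.IsMeasurable)
    {rew : O → ℝ} (hr : Measurable rew) (ρ : ℕ → ℝ) (T : ℕ) (δ : ℝ) :
    (master A rew ρ T δ).IsMeasurable := by
  have hs : Measurable fun x : MasterState S × (U × (ℕ → unitInterval)) =>
      x.1.schedule A ρ x.2.2 :=
    (MasterState.measurable_schedule A ρ).comp
      (measurable_fst.prodMk (measurable_snd.comp measurable_snd))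
  have hi : Measurable fun x : MasterState S × (U × (ℕ → unitInterval)) =>
      (x.1.schedule A ρ x.2.2).inst (x.1.schedule A ρ x.2.2).active :=
    measurable_apply_index (MasterState.measurable_inst.comp hs)
      (MasterState.measurable_active.comp hs)
  refine ⟨hA.policy.comp (hi.prodMk (by fun_prop)), hA.est.comp (hi.prodMk (by fun_prop)), ?_⟩
  have h1 : Measurable fun x : MasterState S × (U × (ℕ → unitInterval)) × O =>
      (x.1.schedule A ρ x.2.1.2, x.2.1.1, x.2.2) :=
    (hs.comp (measurable_fst.prodMk (measurable_fst.comp measurable_snd))).prodMk (by fun_prop)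
  exact (MasterState.measurable_next A ρ T δ).comp ((MasterState.measurable_exec hA hr).comp h1)

/-! ### The combinatorics of a schedule. -/

/-- A realization of the schedule of the meta-algorithm, of the estimates `g` and of the rewards
`R`: in round `t`, `n t` is the order of the block, `pos t` the offset in the block, `act t` the
order of the active instance, `coin t m` says that the coin for an instance of order `m` succeeds,
`U t` is the minimum of `g` over the block so far, and `restart t` says that a test fails after the
round. -/
structure Run (rhat : ℕ → ℝ) where
  n : ℕ → ℕ
  pos : ℕ → ℕ
  act : ℕ → ℕ
  coin : ℕ → ℕ → Prop
  g : ℕ → ℝ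
  R : ℕ → ℝ
  U : ℕ → ℝ
  restart : ℕ → Prop
  n_zero : n 0 = 0
  pos_zero : pos 0 = 0
  of_restart : ∀ t, restart t → n (t + 1) = 0 ∧ pos (t + 1) = 0
  of_complete : ∀ t, ¬ restart t → pos t + 1 = 2 ^ n t → n (t + 1) = n t + 1 ∧ pos (t + 1) = 0
  of_continue : ∀ t, ¬ restart t → pos t + 1 ≠ 2 ^ n t →
    n (t + 1) = n t ∧ pos (t + 1) = pos t + 1
  act_on : ∀ t, act t ≤ n t ∧ coin (t - pos t % 2 ^ act t) (act t)
  act_le : ∀ t m, m ≤ n t → coin (t - pos t % 2 ^ m) m → act t ≤ m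
  U_le : ∀ t u, t - pos t ≤ u → u ≤ t → U t ≤ g u
  exists_U : ∀ t, ∃ u, t - pos t ≤ u ∧ u ≤ t ∧ U t = g u
  restart_iff : ∀ t, restart t ↔
    (∃ m, m ≤ n t ∧ coin (t - pos t % 2 ^ m) m ∧ 2 ^ m ∣ pos t + 1 ∧
      U t + 9 * rhat (2 ^ m) ≤ (1 / 2 ^ m) * ∑ u ∈ Finset.Ico (t + 1 - 2 ^ m) (t + 1), R u) ∨
    3 * rhat (pos t + 1) ≤
      (1 / ((pos t + 1 : ℕ) : ℝ)) * ∑ u ∈ Finset.Ico (t - pos t) (t + 1), (g u - R u)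

namespace Run

variable {rhat : ℕ → ℝ} (X : Run rhat)

theorem pos_lt (t : ℕ) : X.pos t < 2 ^ X.n t := by
  induction t with
  | zero => simp [X.pos_zero]
  | succ t ih =>
    by_cases h : X.restart t
    · simp [(X.of_restart t h).2]
    by_cases h' : X.pos t + 1 = 2 ^ X.n t
    · simp [(X.of_complete t h h').2]
    · rw [(X.of_continue t h h').1, (X.of_continue t h h').2]; omega

/-- A block of order `n` is preceded by completed blocks of orders `0, …, n - 1`, which take `2 ^ n
- 1` rounds. Hence the orders within the horizon are at most logarithmic. -/
theorem two_pow_add_pos_le (t : ℕ) : 2 ^ X.n t + X.pos t ≤ t + 1 := by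
  induction t with
  | zero => simp [X.pos_zero, X.n_zero]
  | succ t ih =>
    by_cases h : X.restart t
    · simp [X.of_restart t h]
    by_cases h' : X.pos t + 1 = 2 ^ X.n t
    · simp only [X.of_complete t h h', pow_succ]; omega
    · simp only [X.of_continue t h h']; omega

theorem pos_le (t : ℕ) : X.pos t ≤ t := by
  have := X.two_pow_add_pos_le t
  have := Nat.one_le_two_pow (n := X.n t)
  omega

theorem two_pow_le {t T : ℕ} (h : t < T) : 2 ^ X.n t ≤ T := by
  have := X.two_pow_add_pos_le t
  omega

theorem of_pos_succ {t : ℕ} (h : X.pos (t + 1) ≠ 0) :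
    ¬ X.restart t ∧ X.n (t + 1) = X.n t ∧ X.pos (t + 1) = X.pos t + 1 := by
  have h1 : ¬ X.restart t := fun h' => h (X.of_restart t h').2
  have h2 : X.pos t + 1 ≠ 2 ^ X.n t := fun h' => h (X.of_complete t h1 h').2
  exact ⟨h1, X.of_continue t h1 h2⟩

/-- A positive offset can only arise by continuing the block, so going back from `t` one stays in
the same block, without restarts, until the offset is exhausted. -/
theorem of_mem_block_sub {t : ℕ} : ∀ {i : ℕ}, i ≤ X.pos t →
    X.pos (t - i) = X.pos t - i ∧ X.n (t - i) = X.n t ∧ (i ≠ 0 → ¬ X.restart (t - i)) := by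
  intro i
  induction i with
  | zero => simp
  | succ i ih =>
    intro hi
    obtain ⟨h1, h2, -⟩ := ih (by omega)
    have := X.pos_le t
    have e : t - i = t - (i + 1) + 1 := by omega
    rw [e] at h1 h2
    have h3 := X.of_pos_succ (t := t - (i + 1)) (by omega)
    exact ⟨by omega, by omega, fun _ => h3.1⟩

theorem pos_of_mem_block {t u : ℕ} (h : t - X.pos t ≤ u) (h' : u ≤ t) :
    X.pos u + (t - X.pos t) = u := by
  have := X.of_mem_block_sub (t := t) (i := t - u) (by omega)
  rw [Nat.sub_sub_self h'] at this
  have := X.pos_le t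
  omega

theorem n_of_mem_block {t u : ℕ} (h : t - X.pos t ≤ u) (h' : u ≤ t) : X.n u = X.n t := by
  have := X.of_mem_block_sub (t := t) (i := t - u) (by omega)
  rw [Nat.sub_sub_self h'] at this
  exact this.2.1

theorem not_restart_of_mem_block {t u : ℕ} (h : t - X.pos t ≤ u) (h' : u < t) :
    ¬ X.restart u := by
  have := X.of_mem_block_sub (t := t) (i := t - u) (by omega)
  rw [Nat.sub_sub_self h'.le] at this
  exact this.2.2 (by omega)

theorem start_of_mem_block {t u : ℕ} (h : t - X.pos t ≤ u) (h' : u ≤ t) :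
    u - X.pos u = t - X.pos t := by
  have := X.pos_of_mem_block h h'
  omega

theorem restart_succ_le_start {s t : ℕ} (h : s < t) (hr : X.restart s) :
    s + 1 ≤ t - X.pos t := by
  by_contra h'
  exact X.not_restart_of_mem_block (t := t) (u := s) (by omega) h hr

end Run

/-! ### From the states of the meta-algorithm to a schedule. -/

namespace MasterState

variable {S U Pol O Z : Type*}

section
variable (A : Learner S U Pol O) (env : ℕ → Pol → Z → O) (rew : O → ℝ) (ρ : ℕ → ℝ) (T : ℕ)
  (δ : ℝ) (ω : ℕ → Z × (U × (ℕ → unitInterval)))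

/-- The state before round `t`. -/
noncomputable abbrev before (t : ℕ) : MasterState S := (master A rew ρ T δ).state env ω t

/-- The state in round `t` after scheduling. -/
noncomputable def scheduled (t : ℕ) : MasterState S := (before A env rew ρ T δ ω t).schedule A ρ (ω t).2.2

/-- The state in round `t` after execution and before the tests. -/
noncomputable def executed (t : ℕ) : MasterState S :=
  (scheduled A env rew ρ T δ ω t).exec A rew (ω t).2.1
    ((master A rew ρ T δ).feedback env ω t)

theorem before_succ (t : ℕ) :
    before A env rew ρ T δ ω (t + 1) = (executed A env rew ρ T δ ω t).next A ρ T δ := rfl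

/-- A test fails after round `t`. -/
def Restarts (t : ℕ) : Prop :=
  (executed A env rew ρ T δ ω t).test1Fails ρ T δ ∨ (executed A env rew ρ T δ ω t).test2Fails ρ T δ

variable {A env rew ρ T δ ω}

theorem before_succ_of_restarts {t : ℕ} (h : Restarts A env rew ρ T δ ω t) :
    before A env rew ρ T δ ω (t + 1) = fresh A 0 := by
  rw [before_succ, next]
  exact if_pos h

theorem before_succ_of_complete {t : ℕ} (h : ¬ Restarts A env rew ρ T δ ω t)
    (h' : (before A env rew ρ T δ ω t).pos + 1 = 2 ^ (before A env rew ρ T δ ω t).n) :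
    before A env rew ρ T δ ω (t + 1) = fresh A ((before A env rew ρ T δ ω t).n + 1) := by
  rw [before_succ, next]
  exact (if_neg h).trans (if_pos h')

theorem before_succ_of_continue {t : ℕ} (h : ¬ Restarts A env rew ρ T δ ω t)
    (h' : (before A env rew ρ T δ ω t).pos + 1 ≠ 2 ^ (before A env rew ρ T δ ω t).n) :
    before A env rew ρ T δ ω (t + 1) = executed A env rew ρ T δ ω t := by
  rw [before_succ, next]
  exact (if_neg h).trans (if_neg h')

theorem before_succ_of_pos {t : ℕ} (h : (before A env rew ρ T δ ω (t + 1)).pos ≠ 0) :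
    before A env rew ρ T δ ω (t + 1) = executed A env rew ρ T δ ω t := by
  by_cases h1 : Restarts A env rew ρ T δ ω t
  · rw [before_succ_of_restarts h1] at h; exact absurd rfl h
  by_cases h2 : (before A env rew ρ T δ ω t).pos + 1 = 2 ^ (before A env rew ρ T δ ω t).n
  · rw [before_succ_of_complete h1 h2] at h; exact absurd rfl h
  · exact before_succ_of_continue h1 h2

theorem pos_before_le (t : ℕ) : (before A env rew ρ T δ ω t).pos ≤ t := by
  induction t with
  | zero => exact le_rfl
  | succ t ih =>
    by_cases h : (before A env rew ρ T δ ω (t + 1)).pos = 0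
    · omega
    · rw [before_succ_of_pos h]
      exact Nat.succ_le_succ ih

variable (A env rew ρ T δ ω) in
/-- The coin of round `t` for an instance of order `m`. -/
def Coin (t m : ℕ) : Prop :=
  ((ω t).2.2 m : ℝ) ≤ ρ (2 ^ (before A env rew ρ T δ ω t).n) / ρ (2 ^ m)

/-- The flag of order `m` is set at offsets divisible by `2 ^ m` and copied in between, and `t - pos
% 2 ^ m` is the latest such round. From here on coins replace flags. -/
theorem scheduled_on (t m : ℕ) : (scheduled A env rew ρ T δ ω t).on m ↔
    m ≤ (before A env rew ρ T δ ω t).n ∧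
      Coin A env rew ρ T δ ω (t - (before A env rew ρ T δ ω t).pos % 2 ^ m) m := by
  induction t with
  | zero =>
    simp only [scheduled, schedule]
    rw [if_pos (show 2 ^ m ∣ (before A env rew ρ T δ ω 0).pos from dvd_zero _)]
    rfl
  | succ t ih =>
    by_cases h : 2 ^ m ∣ (before A env rew ρ T δ ω (t + 1)).pos
    · simp only [scheduled, schedule]
      rw [if_pos h, Nat.mod_eq_zero_of_dvd h]
      rfl
    · have h0 : (before A env rew ρ T δ ω (t + 1)).pos ≠ 0 := fun h0 => h (by simp [h0])
      have e := before_succ_of_pos h0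
      simp only [scheduled, schedule]
      rw [if_neg h, e]
      rw [e] at h
      change (scheduled A env rew ρ T δ ω t).on m ↔ m ≤ (before A env rew ρ T δ ω t).n ∧
        Coin A env rew ρ T δ ω (t + 1 - ((before A env rew ρ T δ ω t).pos + 1) % 2 ^ m) m
      change ¬ 2 ^ m ∣ (before A env rew ρ T δ ω t).pos + 1 at h
      rw [ih]
      have h1 : ((before A env rew ρ T δ ω t).pos + 1) % 2 ^ m
          = (before A env rew ρ T δ ω t).pos % 2 ^ m + 1 := by
        have h2 := Nat.mod_lt (before A env rew ρ T δ ω t).pos (Nat.two_pow_pos m)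
        rcases Nat.lt_or_ge ((before A env rew ρ T δ ω t).pos % 2 ^ m + 1) (2 ^ m) with h3 | h3
        · rw [Nat.add_mod, Nat.mod_eq_of_lt (a := 1) (by omega), Nat.mod_eq_of_lt h3]
        · refine absurd ?_ h
          rw [Nat.dvd_iff_mod_eq_zero, ← Nat.mod_add_mod,
            show (before A env rew ρ T δ ω t).pos % 2 ^ m + 1 = 2 ^ m by omega, Nat.mod_self]
      rw [h1, Nat.add_sub_add_right]

/-- The coin for the order of the block has success probability `ρ / ρ = 1`. Some instance therefore
always covers the round, and the infimum defining the active order is attained. -/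
theorem scheduled_on_top (hρ : ∀ m, 0 < ρ (2 ^ m)) (t : ℕ) :
    (scheduled A env rew ρ T δ ω t).on (before A env rew ρ T δ ω t).n := by
  have h1 : ∀ t, 2 ^ (before A env rew ρ T δ ω t).n ∣ (before A env rew ρ T δ ω t).pos →
      (scheduled A env rew ρ T δ ω t).on (before A env rew ρ T δ ω t).n := by
    intro t h
    simp only [scheduled, schedule]
    rw [if_pos h, div_self (hρ _).ne']
    exact ⟨le_rfl, ((ω t).2.2 _).2.2⟩
  induction t with
  | zero => exact h1 0 (dvd_zero _)
  | succ t ih =>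
    by_cases h : 2 ^ (before A env rew ρ T δ ω (t + 1)).n ∣ (before A env rew ρ T δ ω (t + 1)).pos
    · exact h1 _ h
    · have h0 : (before A env rew ρ T δ ω (t + 1)).pos ≠ 0 := fun h0 => h (by simp [h0])
      have e := before_succ_of_pos h0
      simp only [scheduled, schedule]
      rw [if_neg h, e]
      exact ih

theorem before_records (t : ℕ) : ∀ i < (before A env rew ρ T δ ω t).pos,
    (before A env rew ρ T δ ω t).g i
      = (master A rew ρ T δ).output env ω (t - (before A env rew ρ T δ ω t).pos + i) ∧
    (before A env rew ρ T δ ω t).R i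
      = rew ((master A rew ρ T δ).feedback env ω (t - (before A env rew ρ T δ ω t).pos + i)) := by
  induction t with
  | zero => intro i hi; exact absurd hi (Nat.not_lt_zero i)
  | succ t ih =>
    intro i hi
    have e := before_succ_of_pos (A := A) (env := env) (rew := rew) (ρ := ρ) (T := T) (δ := δ)
      (ω := ω) (t := t) (by omega)
    rw [e] at hi ⊢
    change i < (before A env rew ρ T δ ω t).pos + 1 at hi
    have hp := pos_before_le (A := A) (env := env) (rew := rew) (ρ := ρ) (T := T) (δ := δ)
      (ω := ω) t
    change Function.update (before A env rew ρ T δ ω t).g (before A env rew ρ T δ ω t).pos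
        ((master A rew ρ T δ).output env ω t) i = (master A rew ρ T δ).output env ω
          (t + 1 - ((before A env rew ρ T δ ω t).pos + 1) + i) ∧
      Function.update (before A env rew ρ T δ ω t).R (before A env rew ρ T δ ω t).pos
        (rew ((master A rew ρ T δ).feedback env ω t)) i = rew ((master A rew ρ T δ).feedback env ω
          (t + 1 - ((before A env rew ρ T δ ω t).pos + 1) + i))
    rw [Nat.add_sub_add_right]
    rcases Nat.lt_succ_iff_lt_or_eq.1 hi with hi | hi
    · rw [Function.update_of_ne hi.ne, Function.update_of_ne hi.ne]
      exact ih i hi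
    · subst hi
      rw [Function.update_self, Function.update_self, Nat.sub_add_cancel hp]
      exact ⟨rfl, rfl⟩

theorem executed_records (t : ℕ) : ∀ i < (before A env rew ρ T δ ω t).pos + 1,
    (executed A env rew ρ T δ ω t).g i
      = (master A rew ρ T δ).output env ω (t - (before A env rew ρ T δ ω t).pos + i) ∧
    (executed A env rew ρ T δ ω t).R i
      = rew ((master A rew ρ T δ).feedback env ω (t - (before A env rew ρ T δ ω t).pos + i)) := by
  intro i hi
  have hp := pos_before_le (A := A) (env := env) (rew := rew) (ρ := ρ) (T := T) (δ := δ)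
    (ω := ω) t
  change Function.update (before A env rew ρ T δ ω t).g (before A env rew ρ T δ ω t).pos
      ((master A rew ρ T δ).output env ω t) i = _ ∧
    Function.update (before A env rew ρ T δ ω t).R (before A env rew ρ T δ ω t).pos
      (rew ((master A rew ρ T δ).feedback env ω t)) i = _
  rcases Nat.lt_succ_iff_lt_or_eq.1 hi with hi | hi
  · rw [Function.update_of_ne hi.ne, Function.update_of_ne hi.ne]
    exact before_records t i hi
  · subst hi
    rw [Function.update_self, Function.update_self, Nat.sub_add_cancel hp]
    exact ⟨rfl, rfl⟩

end

variable (A : Learner S U Pol O) (env : ℕ → Pol → Z → O) (rew : O → ℝ) (ρ : ℕ → ℝ) (T : ℕ)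
  (δ : ℝ)

/-- The realization of the schedule of the meta-algorithm. -/
noncomputable def toRun (hρ : ∀ m, 0 < ρ (2 ^ m)) (ω : ℕ → Z × (U × (ℕ → unitInterval))) :
    Run (rhoHat ρ T δ) where
  n t := (before A env rew ρ T δ ω t).n
  pos t := (before A env rew ρ T δ ω t).pos
  act t := (scheduled A env rew ρ T δ ω t).active
  coin := Coin A env rew ρ T δ ω
  g t := (master A rew ρ T δ).output env ω t
  R t := rew ((master A rew ρ T δ).feedback env ω t)
  U t := ⨅ i : Fin ((before A env rew ρ T δ ω t).pos + 1), (executed A env rew ρ T δ ω t).g i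
  restart := Restarts A env rew ρ T δ ω
  n_zero := rfl
  pos_zero := rfl
  of_restart t h := by rw [before_succ_of_restarts h]; exact ⟨rfl, rfl⟩
  of_complete t h h' := by rw [before_succ_of_complete h h']; exact ⟨rfl, rfl⟩
  of_continue t h h' := by rw [before_succ_of_continue h h']; exact ⟨rfl, rfl⟩
  act_on t := by
    refine (scheduled_on t _).1 (Nat.sInf_mem (s := {m | (scheduled A env rew ρ T δ ω t).on m}) ?_)
    exact ⟨_, scheduled_on_top hρ t⟩
  act_le t m h h' := Nat.sInf_le ((scheduled_on t m).2 ⟨h, h'⟩)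
  U_le t u h h' := by
    have hp := pos_before_le (A := A) (env := env) (rew := rew) (ρ := ρ) (T := T) (δ := δ)
      (ω := ω) t
    have h1 := executed_records (A := A) (env := env) (rew := rew) (ρ := ρ) (T := T) (δ := δ)
      (ω := ω) t (u - (t - (before A env rew ρ T δ ω t).pos)) (by omega)
    rw [show t - (before A env rew ρ T δ ω t).pos + (u - (t - (before A env rew ρ T δ ω t).pos))
      = u by omega] at h1
    rw [← h1.1]
    exact ciInf_le (Set.finite_range _).bddBelow
      (⟨u - (t - (before A env rew ρ T δ ω t).pos), by omega⟩ :
        Fin ((before A env rew ρ T δ ω t).pos + 1))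
  exists_U t := by
    have hp := pos_before_le (A := A) (env := env) (rew := rew) (ρ := ρ) (T := T) (δ := δ)
      (ω := ω) t
    obtain ⟨i, hi⟩ := exists_eq_ciInf_of_finite
      (f := fun i : Fin ((before A env rew ρ T δ ω t).pos + 1) => (executed A env rew ρ T δ ω t).g i)
    have hi' := i.2
    refine ⟨t - (before A env rew ρ T δ ω t).pos + i, by omega, by omega, ?_⟩
    rw [← hi, (executed_records t i i.2).1]
  restart_iff t := by
    have hp := pos_before_le (A := A) (env := env) (rew := rew) (ρ := ρ) (T := T) (δ := δ)
      (ω := ω) t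
    have hr := executed_records (A := A) (env := env) (rew := rew) (ρ := ρ) (T := T) (δ := δ)
      (ω := ω) t
    refine or_congr ?_ ?_
    · rw [test1Fails]
      refine exists_congr fun m => ?_
      rw [← and_assoc (a := m ≤ _), ← scheduled_on t m]
      refine and_congr_right fun _ => and_congr_right fun hm => ?_
      have hm' : 2 ^ m ≤ (before A env rew ρ T δ ω t).pos + 1 := Nat.le_of_dvd (by omega) hm
      have e : ∑ i ∈ Finset.Ico ((executed A env rew ρ T δ ω t).pos - 2 ^ m)
            (executed A env rew ρ T δ ω t).pos, (executed A env rew ρ T δ ω t).R i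
          = ∑ u ∈ Finset.Ico (t + 1 - 2 ^ m) (t + 1),
            rew ((master A rew ρ T δ).feedback env ω u) := by
        change ∑ i ∈ Finset.Ico ((before A env rew ρ T δ ω t).pos + 1 - 2 ^ m)
            ((before A env rew ρ T δ ω t).pos + 1), _ = _
        have h1 := Finset.sum_Ico_add (fun u => rew ((master A rew ρ T δ).feedback env ω u))
          ((before A env rew ρ T δ ω t).pos + 1 - 2 ^ m) ((before A env rew ρ T δ ω t).pos + 1)
          (t - (before A env rew ρ T δ ω t).pos)
        rw [show (before A env rew ρ T δ ω t).pos + 1 - 2 ^ m + (t - (before A env rew ρ T δ ω t).pos)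
          = t + 1 - 2 ^ m by omega, show (before A env rew ρ T δ ω t).pos + 1 +
          (t - (before A env rew ρ T δ ω t).pos) = t + 1 by omega] at h1
        rw [← h1]
        exact Finset.sum_congr rfl fun i hi => (hr i (Finset.mem_Ico.1 hi).2).2
      rw [e]
      rfl
    · rw [test2Fails]
      have e : ∑ i ∈ Finset.range (executed A env rew ρ T δ ω t).pos,
            ((executed A env rew ρ T δ ω t).g i - (executed A env rew ρ T δ ω t).R i)
          = ∑ u ∈ Finset.Ico (t - (before A env rew ρ T δ ω t).pos) (t + 1),
            ((master A rew ρ T δ).output env ω u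
              - rew ((master A rew ρ T δ).feedback env ω u)) := by
        rw [Finset.sum_Ico_eq_sum_range, show t + 1 - (t - (before A env rew ρ T δ ω t).pos)
          = (before A env rew ρ T δ ω t).pos + 1 by omega]
        exact Finset.sum_congr rfl fun i hi => by
          rw [(hr i (Finset.mem_range.1 hi)).1, (hr i (Finset.mem_range.1 hi)).2]
      rw [e]
      rfl

end MasterState

/-! ### The active instance as a solitary run of the base algorithm. -/

section Count

open Classical in
theorem sum_range_count_nth {M : Type*} [AddCommMonoid M] {p : ℕ → Prop} (F : ℕ → M) (k : ℕ) :
    ∑ i ∈ Finset.range (Nat.count p k), F (Nat.nth p i)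
      = ∑ u ∈ (Finset.range k).filter p, F u := by
  induction k with
  | zero => simp
  | succ k ih =>
    rw [Nat.count_succ, Finset.range_add_one, Finset.filter_insert]
    by_cases h : p k
    · rw [if_pos h, if_pos h, Finset.sum_range_succ, ih, Nat.nth_count h,
        Finset.sum_insert (by simp), add_comm]
    · rw [if_neg h, if_neg h, add_zero, ih]

end Count

namespace Run

variable {rhat : ℕ → ℝ} (X : Run rhat)

/-- The round in which the active instance of round `t` started. -/
def instStart (t : ℕ) : ℕ := t - X.pos t % 2 ^ X.act t

/-- The rounds up to `t` in which the active instance of round `t` was executed. -/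
def instRounds (t : ℕ) : Finset ℕ :=
  (Finset.Icc (X.instStart t) t).filter fun u => X.act u = X.act t

/-- In round `t` the estimate falls below `F`, or the regret of the active instance against its
estimates exceeds the bound `B`, given as a function of the number of its rounds. -/
def Violates (F : ℝ) (B : ℕ → ℝ) (t : ℕ) : Prop :=
  ¬ (F ≤ X.g t ∧ ∑ u ∈ X.instRounds t, (X.g u - X.R u) ≤ B (X.instRounds t).card)

theorem start_le_instStart (t : ℕ) : t - X.pos t ≤ X.instStart t :=
  Nat.sub_le_sub_left (Nat.mod_le _ _) t

theorem instStart_le (t : ℕ) : X.instStart t ≤ t := Nat.sub_le _ _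

theorem pos_instStart (t : ℕ) : X.pos (X.instStart t) = X.pos t - X.pos t % 2 ^ X.act t := by
  have h1 := X.pos_of_mem_block (X.start_le_instStart t) (X.instStart_le t)
  have := X.pos_le t
  have := Nat.mod_le (X.pos t) (2 ^ X.act t)
  unfold instStart at *
  omega

theorem dvd_pos_instStart (t : ℕ) : 2 ^ X.act t ∣ X.pos (X.instStart t) := by
  rw [pos_instStart]
  exact Nat.dvd_sub_mod _

theorem lt_instStart_add (t : ℕ) : t < X.instStart t + 2 ^ X.act t := by
  have := Nat.mod_lt (X.pos t) (Nat.two_pow_pos (X.act t))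
  have := X.pos_le t
  have := Nat.mod_le (X.pos t) (2 ^ X.act t)
  unfold instStart
  omega

end Run

/-- A base guarantee fails with probability at most `δ / T`. -/
theorem BaseGuarantee.measure_compl_le {S U Pol O Z : Type*} [MeasurableSpace S]
    [MeasurableSpace U] [MeasurableSpace Pol] [MeasurableSpace O] [MeasurableSpace Z]
    {νZ : Measure Z} [IsProbabilityMeasure νZ] {νU : Measure U} [IsProbabilityMeasure νU]
    {env : ℕ → Pol → Z → O} {rew : O → ℝ} {A : Learner S U Pol O} {T : ℕ} {δ : ℝ} {Δ ρ : ℕ → ℝ}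
    (hb : BaseGuarantee νZ νU env rew A T δ Δ ρ) (he : IsEnvironment env rew)
    (hA : A.IsMeasurable) {τ : ℕ → ℕ} (hτ : StrictMono τ) {j : ℕ} (hj : τ j < T)
    (hd : drift Δ (τ 0) (τ j) ≤ ρ (j + 1)) :
    MeasurableSet {ω |
      (Finset.range (j + 1)).inf' Finset.nonempty_range_add_one
          (fun i => optReward νZ env rew (τ i)) - drift Δ (τ 0) (τ j)
        ≤ A.output (fun i => env (τ i)) ω j ∧
      (1 / ((j : ℝ) + 1)) * ∑ i ∈ Finset.range (j + 1),
          (A.output (fun i => env (τ i)) ω i - rew (A.feedback (fun i => env (τ i)) ω i))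
        ≤ ρ (j + 1) + drift Δ (τ 0) (τ j)} ∧
    (interactionLaw νZ νU) {ω |
      (Finset.range (j + 1)).inf' Finset.nonempty_range_add_one
          (fun i => optReward νZ env rew (τ i)) - drift Δ (τ 0) (τ j)
        ≤ A.output (fun i => env (τ i)) ω j ∧
      (1 / ((j : ℝ) + 1)) * ∑ i ∈ Finset.range (j + 1),
          (A.output (fun i => env (τ i)) ω i - rew (A.feedback (fun i => env (τ i)) ω i))
        ≤ ρ (j + 1) + drift Δ (τ 0) (τ j)}ᶜ ≤ ENNReal.ofReal (δ / T) := by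
  have hm : MeasurableSet {ω |
      (Finset.range (j + 1)).inf' Finset.nonempty_range_add_one
          (fun i => optReward νZ env rew (τ i)) - drift Δ (τ 0) (τ j)
        ≤ A.output (fun i => env (τ i)) ω j ∧
      (1 / ((j : ℝ) + 1)) * ∑ i ∈ Finset.range (j + 1),
          (A.output (fun i => env (τ i)) ω i - rew (A.feedback (fun i => env (τ i)) ω i))
        ≤ ρ (j + 1) + drift Δ (τ 0) (τ j)} := by
    have ho : ∀ i, Measurable fun ω => A.output (fun i => env (τ i)) ω i :=
      Learner.measurable_output hA fun t => he.measurable_env (τ t)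
    have hf : ∀ i, Measurable fun ω => A.feedback (fun i => env (τ i)) ω i :=
      Learner.measurable_feedback hA fun t => he.measurable_env (τ t)
    exact measurableSet_setOfPred.2 ((measurableSet_setOfPred.1
      (measurableSet_le measurable_const (ho j))).and (measurableSet_setOfPred.1
      (measurableSet_le ((Finset.measurable_sum (Finset.range (j + 1)) fun i _ =>
        (ho i).sub (he.measurable_rew.comp (hf i))).const_mul (1 / ((j : ℝ) + 1)))
        measurable_const)))
  have : IsProbabilityMeasure (interactionLaw νZ νU) := by unfold interactionLaw; infer_instance
  refine ⟨hm, ?_⟩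
  have h1 := hb.guarantee τ hτ j hj hd
  rw [← ofReal_measureReal, probReal_compl_eq_one_sub hm]
  exact ENNReal.ofReal_le_ofReal (by linarith)

namespace MasterState

variable {S U Pol O Z : Type*} {A : Learner S U Pol O} {env : ℕ → Pol → Z → O} {rew : O → ℝ}
  {ρ : ℕ → ℝ} {T : ℕ} {δ : ℝ}

open Classical in
/-- During its rounds the active instance evolves as the base algorithm run alone on them. -/
theorem inst_eq_state (hρ : ∀ m, 0 < ρ (2 ^ m)) (ω : ℕ → Z × (U × (ℕ → unitInterval))) {t : ℕ}
    {p : ℕ → Prop} (hp : ∀ u ≤ t, p u ↔ (toRun A env rew ρ T δ hρ ω).instStart t ≤ u ∧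
      (toRun A env rew ρ T δ hρ ω).act u = (toRun A env rew ρ T δ hρ ω).act t) {u : ℕ}
    (hu : (toRun A env rew ρ T δ hρ ω).instStart t ≤ u) (hut : u ≤ t) :
    (scheduled A env rew ρ T δ ω u).inst ((toRun A env rew ρ T δ hρ ω).act t)
      = A.state (fun i => env (Nat.nth p i))
          (fun i => ((ω (Nat.nth p i)).1, (ω (Nat.nth p i)).2.1)) (Nat.count p u) := by
  set X := toRun A env rew ρ T δ hρ ω with hX
  have hd := X.dvd_pos_instStart t
  have hlt := X.lt_instStart_add t
  have hsb := X.start_le_instStart t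
  induction u, hu using Nat.le_induction with
  | base =>
    have h0 : Nat.count p (X.instStart t) = 0 := by
      rw [Nat.count_iff_forall_not]
      intro v hv hpv
      exact absurd ((hp v (by omega)).1 hpv).1 (by omega)
    rw [h0]
    simp only [scheduled, schedule]
    exact if_pos hd
  | succ u hu ih =>
    have ih := ih (by omega)
    have hpu := X.pos_of_mem_block (t := t) (u := u + 1) (by omega) hut
    have hps := X.pos_of_mem_block (t := t) (u := X.instStart t) hsb (by omega)
    -- Less than `2 ^ m` rounds have passed since the aligned start, so no later offset up to `t` is
    -- aligned and the instance is not reinitialized.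
    have hnd : ¬ 2 ^ X.act t ∣ X.pos (u + 1) := by
      rintro ⟨k, hk⟩
      obtain ⟨l, hl⟩ := hd
      have h1 : 2 ^ X.act t * l < 2 ^ X.act t * k := by omega
      have h2 : l < k := lt_of_mul_lt_mul_left' h1
      have h3 : 2 ^ X.act t * (l + 1) ≤ 2 ^ X.act t * k := Nat.mul_le_mul_left _ h2
      rw [mul_add, mul_one] at h3
      omega
    have e := before_succ_of_pos (A := A) (env := env) (rew := rew) (ρ := ρ) (T := T) (δ := δ)
      (ω := ω) (t := u) (show X.pos (u + 1) ≠ 0 by omega)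
    have e2 : (scheduled A env rew ρ T δ ω (u + 1)).inst (X.act t)
        = (executed A env rew ρ T δ ω u).inst (X.act t) := by
      rw [← e]
      simp only [scheduled, schedule]
      exact if_neg hnd
    rw [e2, Nat.count_succ]
    change Function.update (scheduled A env rew ρ T δ ω u).inst (X.act u) (A.update
      ((scheduled A env rew ρ T δ ω u).inst (X.act u)) (ω u).2.1
      (env u (A.policy ((scheduled A env rew ρ T δ ω u).inst (X.act u)) (ω u).2.1) (ω u).1))
      (X.act t) = _
    by_cases h : p u
    · have h' := ((hp u (by omega)).1 h).2
      rw [h', Function.update_self, if_pos h, Learner.state, ih, Nat.nth_count h]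
    · have h' : X.act u ≠ X.act t := fun h' => h ((hp u (by omega)).2 ⟨hu, h'⟩)
      rw [Function.update_of_ne h'.symm, if_neg h, add_zero, ih]

open Classical in
theorem output_eq_output (hρ : ∀ m, 0 < ρ (2 ^ m)) (ω : ℕ → Z × (U × (ℕ → unitInterval))) {t : ℕ}
    {p : ℕ → Prop} (hp : ∀ u ≤ t, p u ↔ (toRun A env rew ρ T δ hρ ω).instStart t ≤ u ∧
      (toRun A env rew ρ T δ hρ ω).act u = (toRun A env rew ρ T δ hρ ω).act t) {u : ℕ}
    (hut : u ≤ t) (hpu : p u) :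
    (toRun A env rew ρ T δ hρ ω).g u = A.output (fun i => env (Nat.nth p i))
      (fun i => ((ω (Nat.nth p i)).1, (ω (Nat.nth p i)).2.1)) (Nat.count p u) ∧
    (toRun A env rew ρ T δ hρ ω).R u = rew (A.feedback (fun i => env (Nat.nth p i))
      (fun i => ((ω (Nat.nth p i)).1, (ω (Nat.nth p i)).2.1)) (Nat.count p u)) := by
  obtain ⟨h1, h2⟩ := (hp u hut).1 hpu
  have e := inst_eq_state hρ ω hp h1 hut
  rw [← h2] at e
  rw [Learner.output, Learner.feedback, ← e, Nat.nth_count hpu]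
  exact ⟨rfl, rfl⟩

/-- Without restarts, the schedule from a round on is determined by the state before this round and
by the coins. -/
theorem skeleton_congr {ω ω' : ℕ → Z × (U × (ℕ → unitInterval))} {r t : ℕ}
    (h1 : ∀ u < r, ω u = ω' u) (h2 : ∀ u, r ≤ u → (ω u).2.2 = (ω' u).2.2)
    (h3 : ∀ u, r ≤ u → u < t → ¬ Restarts A env rew ρ T δ ω u)
    (h4 : ∀ u, r ≤ u → u < t → ¬ Restarts A env rew ρ T δ ω' u) {u : ℕ} (hu : r ≤ u)
    (hut : u ≤ t) :
    (before A env rew ρ T δ ω u).n = (before A env rew ρ T δ ω' u).n ∧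
    (before A env rew ρ T δ ω u).pos = (before A env rew ρ T δ ω' u).pos ∧
    (scheduled A env rew ρ T δ ω u).on = (scheduled A env rew ρ T δ ω' u).on := by
  induction u, hu using Nat.le_induction with
  | base =>
    have e : before A env rew ρ T δ ω r = before A env rew ρ T δ ω' r := Learner.state_congr _ _ h1
    simp only [scheduled, e, h2 r le_rfl, true_and]
  | succ u hu ih =>
    obtain ⟨hn, hpos, hon⟩ := ih (by omega)
    have key : (before A env rew ρ T δ ω (u + 1)).n = (before A env rew ρ T δ ω' (u + 1)).n ∧
        (before A env rew ρ T δ ω (u + 1)).pos = (before A env rew ρ T δ ω' (u + 1)).pos ∧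
        (before A env rew ρ T δ ω (u + 1)).on = (before A env rew ρ T δ ω' (u + 1)).on := by
      by_cases hc : (before A env rew ρ T δ ω u).pos + 1 = 2 ^ (before A env rew ρ T δ ω u).n
      · rw [before_succ_of_complete (h3 u hu (by omega)) hc,
          before_succ_of_complete (h4 u hu (by omega)) (by rw [← hn, ← hpos, hc]), hn]
        exact ⟨rfl, rfl, rfl⟩
      · rw [before_succ_of_continue (h3 u hu (by omega)) hc,
          before_succ_of_continue (h4 u hu (by omega)) (by rw [← hn, ← hpos]; exact hc)]
        exact ⟨hn, congrArg (· + 1) hpos, hon⟩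
    obtain ⟨k1, k2, k3⟩ := key
    refine ⟨k1, k2, ?_⟩
    funext m
    simp only [scheduled, schedule, k1, k2, k3, h2 (u + 1) (by omega)]

end MasterState

theorem measurable_sum_finset {α : Type*} [MeasurableSpace α] {s : α → Finset ℕ} {N : ℕ}
    (hN : ∀ a, s a ⊆ Finset.range N) (hs : ∀ u, Measurable fun a => u ∈ s a) {f : ℕ → α → ℝ}
    (hf : ∀ u, Measurable (f u)) : Measurable fun a => ∑ u ∈ s a, f u a := by
  classical
  have e : (fun a => ∑ u ∈ s a, f u a)
      = fun a => ∑ u ∈ Finset.range N, if u ∈ s a then f u a else 0 := by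
    funext a
    rw [← Finset.sum_filter]
    refine Finset.sum_congr ?_ fun _ _ => rfl
    ext u
    simpa using fun h => Finset.mem_range.1 (hN a h)
  rw [e]
  exact Finset.measurable_sum _ fun u _ =>
    Measurable.ite (measurableSet_setOfPred.2 (hs u)) (hf u) measurable_const

theorem measurable_card_finset {α : Type*} [MeasurableSpace α] {s : α → Finset ℕ} {N : ℕ}
    (hN : ∀ a, s a ⊆ Finset.range N) (hs : ∀ u, Measurable fun a => u ∈ s a) :
    Measurable fun a => (s a).card := by
  have h := measurable_sum_finset hN hs (f := fun _ _ => (1 : ℝ)) fun _ => measurable_const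
  have e : (fun a => (s a).card) = fun a => Nat.floor (∑ u ∈ s a, (1 : ℝ)) := by
    funext a; simp
  rw [e]
  exact Nat.measurable_floor.comp h

namespace MasterState

variable {S U Pol O Z : Type*} [MeasurableSpace S] [MeasurableSpace U] [MeasurableSpace Pol]
  [MeasurableSpace O] [MeasurableSpace Z] {A : Learner S U Pol O} {env : ℕ → Pol → Z → O}
  {rew : O → ℝ} {ρ : ℕ → ℝ} {T : ℕ} {δ : ℝ}

section
variable (hA : A.IsMeasurable) (he : IsEnvironment env rew) (ρ T δ)
include hA he

theorem measurable_before (t : ℕ) :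
    Measurable fun ω : ℕ → Z × (U × (ℕ → unitInterval)) => before A env rew ρ T δ ω t :=
  Learner.measurable_state (master_isMeasurable hA he.measurable_rew ρ T δ) he.measurable_env t

theorem measurable_scheduled (t : ℕ) :
    Measurable fun ω : ℕ → Z × (U × (ℕ → unitInterval)) => scheduled A env rew ρ T δ ω t :=
  (measurable_schedule A ρ).comp ((measurable_before ρ T δ hA he t).prodMk (by fun_prop))

theorem measurable_executed (t : ℕ) :
    Measurable fun ω : ℕ → Z × (U × (ℕ → unitInterval)) => executed A env rew ρ T δ ω t :=
  (measurable_exec hA he.measurable_rew).comp ((measurable_scheduled ρ T δ hA he t).prodMk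
    (Measurable.prodMk (by fun_prop) (Learner.measurable_feedback
      (master_isMeasurable hA he.measurable_rew ρ T δ) he.measurable_env t)))

theorem measurable_restarts (t : ℕ) :
    Measurable fun ω : ℕ → Z × (U × (ℕ → unitInterval)) => Restarts A env rew ρ T δ ω t :=
  ((measurable_test1 ρ T δ).comp (measurable_executed ρ T δ hA he t)).or
    ((measurable_test2 ρ T δ).comp (measurable_executed ρ T δ hA he t))

variable (hρ : ∀ m, 0 < ρ (2 ^ m))

theorem measurable_run_n (t : ℕ) : Measurable fun ω => (toRun A env rew ρ T δ hρ ω).n t :=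
  measurable_n.comp (measurable_before ρ T δ hA he t)

theorem measurable_run_pos (t : ℕ) : Measurable fun ω => (toRun A env rew ρ T δ hρ ω).pos t :=
  measurable_pos.comp (measurable_before ρ T δ hA he t)

theorem measurable_run_act (t : ℕ) : Measurable fun ω => (toRun A env rew ρ T δ hρ ω).act t :=
  measurable_active.comp (measurable_scheduled ρ T δ hA he t)

theorem measurable_run_g (t : ℕ) : Measurable fun ω => (toRun A env rew ρ T δ hρ ω).g t :=
  Learner.measurable_output (master_isMeasurable hA he.measurable_rew ρ T δ) he.measurable_env t

theorem measurable_run_R (t : ℕ) : Measurable fun ω => (toRun A env rew ρ T δ hρ ω).R t :=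
  he.measurable_rew.comp (Learner.measurable_feedback
    (master_isMeasurable hA he.measurable_rew ρ T δ) he.measurable_env t)

theorem measurable_run_U (t : ℕ) : Measurable fun ω => (toRun A env rew ρ T δ hρ ω).U t :=
  measurable_iInf_fin.comp ((measurable_g.comp (measurable_executed ρ T δ hA he t)).prodMk
    ((measurable_of_countable (· + 1)).comp (measurable_run_pos ρ T δ hA he hρ t)))

theorem measurable_run_coin (t m : ℕ) :
    Measurable fun ω => (toRun A env rew ρ T δ hρ ω).coin t m := by
  refine measurableSet_setOfPred.1 (measurableSet_le ?_ ?_)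
  · exact measurable_subtype_coe.comp ((measurable_pi_apply m).comp (by fun_prop))
  · exact (measurable_of_countable fun k : ℕ => ρ (2 ^ k) / ρ (2 ^ m)).comp
      (measurable_run_n ρ T δ hA he hρ t)

theorem measurable_run_instStart (t : ℕ) :
    Measurable fun ω => (toRun A env rew ρ T δ hρ ω).instStart t :=
  (measurable_of_countable fun x : ℕ × ℕ => t - x.1 % 2 ^ x.2).comp
    ((measurable_run_pos ρ T δ hA he hρ t).prodMk (measurable_run_act ρ T δ hA he hρ t))

theorem measurable_violates (F : ℝ) (B : ℕ → ℝ) (t : ℕ) :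
    Measurable fun ω => (toRun A env rew ρ T δ hρ ω).Violates F B t := by
  have hg := measurable_run_g ρ T δ hA he hρ
  have hR := measurable_run_R ρ T δ hA he hρ
  have hN : ∀ ω, (toRun A env rew ρ T δ hρ ω).instRounds t ⊆ Finset.range (t + 1) := by
    intro ω u hu
    have := (Finset.mem_Icc.1 (Finset.mem_filter.1 hu).1).2
    exact Finset.mem_range.2 (by omega)
  have hs : ∀ u, Measurable fun ω => u ∈ (toRun A env rew ρ T δ hρ ω).instRounds t := by
    intro u
    simp only [Run.instRounds, Finset.mem_filter, Finset.mem_Icc]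
    refine Measurable.and (Measurable.and ?_ measurable_const) ?_
    · exact (measurable_of_countable (· ≤ u)).comp (measurable_run_instStart ρ T δ hA he hρ t)
    · exact measurableSet_setOfPred.1 (measurableSet_eq_fun (measurable_run_act ρ T δ hA he hρ u)
        (measurable_run_act ρ T δ hA he hρ t))
  refine Measurable.not (Measurable.and ?_ ?_)
  · exact measurableSet_setOfPred.1 (measurableSet_le measurable_const (hg t))
  · exact measurableSet_setOfPred.1 (measurableSet_le
      (measurable_sum_finset hN hs fun u => (hg u).sub (hR u))
      ((measurable_of_countable B).comp (measurable_card_finset hN hs)))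

end

end MasterState

/-! ### Failure of a guarantee, given the past and the coins. -/

section Resample

variable {Z U C : Type*}

/-- The noise and the seeds of the rounds from `r` on are replaced by those of `ω'`, but the coins
are kept. -/
def resample (r : ℕ) (ω ω' : ℕ → Z × (U × C)) : ℕ → Z × (U × C) := fun i =>
  if i < r then ω i else ((ω' i).1, ((ω' i).2.1, (ω i).2.2))

variable [MeasurableSpace Z] [MeasurableSpace U] [MeasurableSpace C] (νZ : Measure Z)
  [IsProbabilityMeasure νZ] (νU : Measure U) [IsProbabilityMeasure νU] (νC : Measure C)
  [IsProbabilityMeasure νC]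

theorem measurable_resample (r : ℕ) :
    Measurable fun x : (ℕ → Z × (U × C)) × (ℕ → Z × (U × C)) => resample r x.1 x.2 := by
  refine measurable_pi_iff.2 fun i => ?_
  by_cases h : i < r <;> simp only [resample, h, if_true, if_false] <;> fun_prop

/-- In each round from `r` on, the coins of one copy and the noise and seed of another are
independent with the right laws, so the combination is again a legitimate sequence. -/
theorem map_resample (r : ℕ) :
    ((interactionLaw νZ (νU.prod νC)).prod (interactionLaw νZ (νU.prod νC))).map
      (fun x => resample r x.1 x.2) = interactionLaw νZ (νU.prod νC) := by
  have h0 : MeasurePreserving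
      (fun x : (Z × (U × C)) × (Z × (U × C)) => (x.2.1, (x.2.2.1, x.1.2.2)))
      ((νZ.prod (νU.prod νC)).prod (νZ.prod (νU.prod νC))) (νZ.prod (νU.prod νC)) := by
    have h1 : MeasurePreserving (fun x : Z × (U × C) => x.2.2) (νZ.prod (νU.prod νC)) νC :=
      measurePreserving_snd.comp measurePreserving_snd
    have h2 : MeasurePreserving (fun x : Z × (U × C) => (x.1, x.2.1)) (νZ.prod (νU.prod νC))
        (νZ.prod νU) :=
      (MeasurePreserving.id νZ).prod measurePreserving_fst
    have h3 := (h1.prod h2)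
    have h4 := (Measure.measurePreserving_swap (μ := νC) (ν := νZ.prod νU)).comp h3
    have h5 := (measurePreserving_prodAssoc νZ νU νC).comp h4
    exact h5
  have h := map_zipWith_infinitePi (νZ.prod (νU.prod νC))
    (fun i x => if i < r then x.1 else (x.2.1, (x.2.2.1, x.1.2.2)))
    (fun i => by by_cases h : i < r <;> simp only [h, if_true, if_false] <;> fun_prop)
    (fun i => by
      by_cases h : i < r <;> simp only [h, if_true, if_false]
      · exact measurePreserving_fst.map_eq
      · exact h0.map_eq)
  exact h

/-- Along distinct rounds the noise and the seeds are again i.i.d., which is why an instance, seen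
only in its own rounds, is a run from scratch. -/
theorem map_project_interactionLaw {τ : ℕ → ℕ} (hτ : Function.Injective τ) :
    (interactionLaw νZ (νU.prod νC)).map (fun ω i => ((ω (τ i)).1, (ω (τ i)).2.1))
      = interactionLaw νZ νU := by
  have h2 : MeasurePreserving (fun x : Z × (U × C) => (x.1, x.2.1)) (νZ.prod (νU.prod νC))
      (νZ.prod νU) := (MeasurePreserving.id νZ).prod measurePreserving_fst
  have h3 := Measure.map_infinitePi_infinitePi_of_inj
    (P := fun _ : ℕ => νZ.prod (νU.prod νC)) hτ
  have h4 := Measure.infinitePi_map_pi (μ := fun _ : ℕ => νZ.prod (νU.prod νC))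
    (f := fun _ x => (x.1, x.2.1)) fun _ => by fun_prop
  simp only [h2.map_eq] at h4
  rw [interactionLaw, interactionLaw, ← h4]
  conv_rhs => rw [← h3]
  rw [Measure.map_map (by fun_prop) (by fun_prop)]
  rfl

instance : IsProbabilityMeasure (interactionLaw νZ νU) := by
  unfold interactionLaw; infer_instance

/-- For fixed `ω` the inner probability plays the role of a conditional probability given the past
before `r` and all coins. Fubini integrates it over `E`; outside `E` the inner event is empty. -/
theorem measure_le_of_resample {r : ℕ} {V E : Set (ℕ → Z × (U × C))} (hV : MeasurableSet V)
    (hE : MeasurableSet E) {c : ℝ≥0∞}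
    (h : ∀ ω ∈ E, interactionLaw νZ (νU.prod νC) {ω' | resample r ω ω' ∈ V} ≤ c)
    (h0 : ∀ ω ω', resample r ω ω' ∈ V → ω ∈ E) :
    interactionLaw νZ (νU.prod νC) V ≤ c * interactionLaw νZ (νU.prod νC) E := by
  conv_lhs => rw [← map_resample νZ νU νC r]
  rw [Measure.map_apply (measurable_resample r) hV,
    Measure.prod_apply (measurable_resample r hV), ← lintegral_indicator_const hE]
  refine lintegral_mono fun ω => ?_
  by_cases hω : ω ∈ E
  · rw [Set.indicator_of_mem hω]
    exact h ω hω
  · rw [Set.indicator_of_notMem hω]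
    refine le_of_eq ?_
    have : (Prod.mk ω ⁻¹' ((fun x : (ℕ → Z × (U × C)) × (ℕ → Z × (U × C)) =>
        resample r x.1 x.2) ⁻¹' V)) = ∅ := by
      ext ω'
      simpa using fun h' => hω (h0 ω ω' h')
    rw [this, measure_empty]

end Resample

theorem drift_mono {Δ : ℕ → ℝ} {T : ℕ} (hΔ : ∀ u, u + 1 < T → 0 ≤ Δ u) {s s' t' t : ℕ}
    (h1 : s ≤ s') (h2 : t' ≤ t) (ht : t < T) : drift Δ s' t' ≤ drift Δ s t := by
  refine Finset.sum_le_sum_of_subset_of_nonneg (Finset.Ico_subset_Ico h1 h2) fun u hu _ => ?_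
  have := (Finset.mem_Ico.1 hu).2
  exact hΔ u (by omega)

namespace MasterState

variable {S U Pol O Z : Type*} [MeasurableSpace S] [MeasurableSpace U] [MeasurableSpace Pol]
  [MeasurableSpace O] [MeasurableSpace Z] {A : Learner S U Pol O} {env : ℕ → Pol → Z → O}
  {rew : O → ℝ} {ρ : ℕ → ℝ} {T : ℕ} {δ : ℝ} {νZ : Measure Z} [IsProbabilityMeasure νZ]
  {νU : Measure U} [IsProbabilityMeasure νU] {Δ ρ₀ : ℕ → ℝ}

/-- Given the past up to round `r`, without restarts from then on, the guarantee of the instance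
active in round `t` fails with probability at most `δ / T`, if this instance started in round `r`
or later and the environment is nearly stationary. -/
theorem measure_violates_le (hb : BaseGuarantee νZ νU env rew A T δ Δ ρ₀)
    (he : IsEnvironment env rew) (hA : A.IsMeasurable) (hΔ : ∀ u, u + 1 < T → 0 ≤ Δ u)
    (hρ : ∀ m, 0 < ρ (2 ^ m)) {r t : ℕ} (hrt : r ≤ t) (htT : t < T) {F : ℝ} {B : ℕ → ℝ}
    (hF : F ≤ 0 ∨ ∀ u, r ≤ u → u ≤ t → F ≤ optReward νZ env rew u - drift Δ r t)
    (hB : ∀ j : ℕ, 1 ≤ j → j ≤ t + 1 - r → min (j : ℝ) (j * (ρ₀ j + drift Δ r t)) ≤ B j)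
    (hnear : ∀ j, 1 ≤ j → j ≤ t + 1 - r → drift Δ r t ≤ ρ₀ j)
    {E : Set (ℕ → Z × (U × (ℕ → unitInterval)))} (hE : MeasurableSet E)
    (hEd : ∀ ω ω', (∀ u < r, ω u = ω' u) → ω ∈ E → ω' ∈ E) :
    interactionLaw νZ (masterSeed νU) {ω | ω ∈ E ∧
        (∀ u, r ≤ u → u < t → ¬ Restarts A env rew ρ T δ ω u) ∧
        r ≤ (toRun A env rew ρ T δ hρ ω).instStart t ∧
        (toRun A env rew ρ T δ hρ ω).Violates F B t}
      ≤ ENNReal.ofReal (δ / T) * interactionLaw νZ (masterSeed νU) E := by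
  classical
  refine measure_le_of_resample (r := r) νZ νU _ ?_ hE ?_ ?_
  · refine measurableSet_setOfPred.2 (Measurable.and (measurableSet_setOfPred.1 hE)
      (Measurable.and ?_ (Measurable.and ?_ (measurable_violates ρ T δ hA he hρ F B t))))
    · exact Measurable.forall fun u => Measurable.forall fun _ => Measurable.forall fun _ =>
        (measurable_restarts ρ T δ hA he u).not
    · exact (measurable_of_countable (r ≤ ·)).comp (measurable_run_instStart ρ T δ hA he hρ t)
  · intro ω hω
    -- One continuation `ω₀` without restarts fixes the schedule for all of them; if there is none,
    -- the event is empty.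
    by_cases hne : ∃ ω₀, resample r ω ω₀ ∈ {ω | ω ∈ E ∧
        (∀ u, r ≤ u → u < t → ¬ Restarts A env rew ρ T δ ω u) ∧
        r ≤ (toRun A env rew ρ T δ hρ ω).instStart t ∧
        (toRun A env rew ρ T δ hρ ω).Violates F B t}
    swap
    · push Not at hne
      refine le_of_eq_of_le (measure_mono_null (t := ∅) (fun ω' h' => hne ω' h') ?_) zero_le
      exact measure_empty
    obtain ⟨ω₀, -, h1, h2, -⟩ := hne
    set X₀ := toRun A env rew ρ T δ hρ (resample r ω ω₀) with hX₀
    -- The rounds after `t` are added only to make the set infinite: the base guarantee wants a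
    -- strictly increasing sequence on all of `ℕ`.
    obtain ⟨p, hp⟩ : ∃ p : ℕ → Prop, ∀ u, p u ↔
      t < u ∨ (X₀.instStart t ≤ u ∧ X₀.act u = X₀.act t) := ⟨_, fun _ => Iff.rfl⟩
    have hpinf : (Set.ofPred p).Infinite := by
      refine Set.infinite_of_not_bddAbove ?_
      rintro ⟨b, hb'⟩
      have := @hb' (b + t + 1) ((hp _).2 (Or.inl (by omega)))
      omega
    have hpt : p t := (hp t).2 (Or.inr ⟨X₀.instStart_le t, rfl⟩)
    have hτ : StrictMono (Nat.nth p) := Nat.nth_strictMono hpinf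
    have hj : Nat.nth p (Nat.count p t) = t := Nat.nth_count hpt
    have hr : ∀ u, p u → r ≤ u := by
      intro u hu
      rcases (hp u).1 hu with h | h
      · omega
      · exact h2.trans h.1
    have hr0 : ∀ i, r ≤ Nat.nth p i := fun i => hr _ (Nat.nth_mem_of_infinite hpinf i)
    have hdle : ∀ i, Nat.nth p i ≤ t → drift Δ (Nat.nth p 0) t ≤ drift Δ r t := fun i _ =>
      drift_mono hΔ (hr0 0) le_rfl htT
    have hcard : Nat.count p t + 1 ≤ t + 1 - r := by
      have e : Nat.count p t + 1 = Nat.count p (t + 1) := by rw [Nat.count_succ, if_pos hpt]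
      rw [e, Nat.count_eq_card_filter_range, ← Nat.card_Ico]
      refine Finset.card_le_card fun u hu => ?_
      rw [Finset.mem_filter, Finset.mem_range] at hu
      exact Finset.mem_Ico.2 ⟨hr u hu.2, hu.1⟩
    obtain ⟨hm, hle⟩ := hb.measure_compl_le he hA hτ (j := Nat.count p t) (by rw [hj]; exact htT)
      (by
        rw [hj]
        exact (hdle _ hj.le).trans (hnear _ (by omega) hcard))
    refine le_trans ?_ hle
    rw [← map_project_interactionLaw νZ νU (Measure.infinitePi fun _ : ℕ =>
      (volume : Measure unitInterval)) hτ.injective, Measure.map_apply (by fun_prop) hm.compl]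
    refine measure_mono fun ω' hω' => ?_
    obtain ⟨-, h3, h4, h5⟩ := hω'
    set X := toRun A env rew ρ T δ hρ (resample r ω ω') with hX
    have hskel : ∀ u, r ≤ u → u ≤ t → X₀.n u = X.n u ∧ X₀.pos u = X.pos u ∧
        (scheduled A env rew ρ T δ (resample r ω ω₀) u).on
          = (scheduled A env rew ρ T δ (resample r ω ω') u).on := fun u hu hut =>
      skeleton_congr (r := r) (t := t) (fun u hu => by simp only [resample, if_pos hu])
        (fun u hu => by simp only [resample, if_neg (not_lt.2 hu)]) h1 h3 hu hut
    have hact : ∀ u, r ≤ u → u ≤ t → X₀.act u = X.act u := fun u hu hut => by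
      change sInf {m | (scheduled A env rew ρ T δ (resample r ω ω₀) u).on m} =
        sInf {m | (scheduled A env rew ρ T δ (resample r ω ω') u).on m}
      rw [(hskel u hu hut).2.2]
    have hst : X₀.instStart t = X.instStart t := by
      unfold Run.instStart
      rw [hact t hrt le_rfl, (hskel t hrt le_rfl).2.1]
    have hp' : ∀ u ≤ t, p u ↔ X.instStart t ≤ u ∧ X.act u = X.act t := by
      intro u hut
      have : p u ↔ X₀.instStart t ≤ u ∧ X₀.act u = X₀.act t := by
        rw [hp, or_iff_right (not_lt.2 hut)]
      rw [this, hst]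
      refine and_congr_right fun h => ?_
      rw [hact u (h4.trans h) hut, hact t hrt le_rfl]
    -- All rounds of the instance are at least `r`, so noise and seeds come from `ω'`, while `p`
    -- depends on `ω` and `ω₀` only.
    have hzu : (fun i => ((resample r ω ω' (Nat.nth p i)).1, (resample r ω ω' (Nat.nth p i)).2.1))
        = fun i => ((ω' (Nat.nth p i)).1, (ω' (Nat.nth p i)).2.1) := by
      funext i
      simp only [resample, if_neg (not_lt.2 (hr0 i))]
    have hout : ∀ u ≤ t, p u → _ := fun u hut hpu => output_eq_output hρ (resample r ω ω') hp' hut hpu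
    rw [hzu] at hout
    rintro ⟨g1, g2⟩
    rw [hj] at g1 g2
    refine h5 ⟨?_, ?_⟩
    · rw [(hout t le_rfl hpt).1]
      rcases hF with hF | hF
      · exact hF.trans (hb.est_mem _ _).1
      refine le_trans ?_ g1
      rw [le_sub_iff_add_le, Finset.le_inf'_iff]
      intro i hi
      have hi' : Nat.nth p i ≤ t := by
        rw [← hj]
        have := Finset.mem_range.1 hi
        exact hτ.monotone (by omega)
      have := hF _ (hr0 i) hi'
      have := hdle i hi'
      linarith
    · have hrounds : X.instRounds t = (Finset.range (t + 1)).filter p := by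
        ext u
        simp only [Run.instRounds, Finset.mem_filter, Finset.mem_Icc, Finset.mem_range]
        constructor
        · rintro ⟨⟨a1, a2⟩, a3⟩
          exact ⟨by omega, (hp' u a2).2 ⟨a1, a3⟩⟩
        · rintro ⟨a1, a2⟩
          have := (hp' u (by omega)).1 a2
          exact ⟨⟨this.1, by omega⟩, this.2⟩
      have hc : (X.instRounds t).card = Nat.count p t + 1 := by
        rw [hrounds, ← Nat.count_eq_card_filter_range, Nat.count_succ, if_pos hpt]
      have hsum : ∑ u ∈ X.instRounds t, (X.g u - X.R u) = ∑ i ∈ Finset.range (Nat.count p t + 1),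
          (A.output (fun i => env (Nat.nth p i))
            (fun i => ((ω' (Nat.nth p i)).1, (ω' (Nat.nth p i)).2.1)) i
          - rew (A.feedback (fun i => env (Nat.nth p i))
            (fun i => ((ω' (Nat.nth p i)).1, (ω' (Nat.nth p i)).2.1)) i)) := by
        have e := sum_range_count_nth (p := p) (fun u => X.g u - X.R u) (t + 1)
        rw [hrounds, ← e, Nat.count_succ, if_pos hpt]
        refine Finset.sum_congr rfl fun i hi => ?_
        have hi' : Nat.nth p i ≤ t := by
          rw [← hj]
          have := Finset.mem_range.1 hi
          exact hτ.monotone (by omega)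
        have h6 := hout _ hi' (Nat.nth_mem_of_infinite hpinf i)
        rw [Nat.count_nth_of_infinite hpinf] at h6
        rw [h6.1, h6.2]
      -- The trivial bound by the number of rounds supplies the first entry of the minimum in `hB`;
      -- it is what permits the rate to be capped at `1`.
      have h7 : ∑ u ∈ X.instRounds t, (X.g u - X.R u) ≤ (X.instRounds t).card := by
        rw [Finset.card_eq_sum_ones, Nat.cast_sum]
        refine Finset.sum_le_sum fun u _ => ?_
        have h8 : X.g u ≤ 1 := (hb.est_mem _ _).2
        have h9 : 0 ≤ X.R u := (he.rew_mem _).1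
        push_cast
        linarith
      refine le_trans (le_min h7 ?_) (hB _ (by omega) (by omega))
      rw [hsum, hc]
      have h10 : (0 : ℝ) < (Nat.count p t : ℝ) + 1 := by positivity
      rw [one_div, inv_mul_le_iff₀ h10] at g2
      push_cast
      refine g2.trans (mul_le_mul_of_nonneg_left ?_ h10.le)
      have := hdle _ hj.le
      linarith
  · intro ω ω' h
    refine hEd _ _ (fun u hu => ?_) h.1
    simp only [resample, if_pos hu]

end MasterState

/-! ### Concentration of the coins and of the rewards. -/

/-- The exponential moment of a Bernoulli variable is `1 + (exp a - 1) q`, at most the exponential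
of its second summand. Positive `a` gives upper and negative `a` lower deviations. -/
theorem exp_coin_le_one {a q : ℝ} (h0 : 0 ≤ q) (h1 : q ≤ 1) :
    ∫⁻ v : unitInterval, ENNReal.ofReal
      (Real.exp (a * (if (v : ℝ) ≤ q then 1 else 0) - (Real.exp a - 1) * q)) ≤ 1 := by
  set c := (Real.exp a - 1) * q with hc
  have hm : MeasurableSet {v : unitInterval | (v : ℝ) ≤ q} :=
    measurableSet_le measurable_subtype_coe measurable_const
  have hvol : (volume : Measure unitInterval) {v : unitInterval | (v : ℝ) ≤ q}
      = ENNReal.ofReal q := by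
    have : {v : unitInterval | (v : ℝ) ≤ q} = Set.Iic ⟨q, h0, h1⟩ := by
      ext v; exact Iff.rfl
    rw [this, unitInterval.volume_Iic]
  have hvol' : (volume : Measure unitInterval) {v : unitInterval | (v : ℝ) ≤ q}ᶜ
      = ENNReal.ofReal (1 - q) := by
    rw [prob_compl_eq_one_sub hm, hvol, ENNReal.ofReal_sub _ h0, ENNReal.ofReal_one]
  have e1 : ∫⁻ v in {v : unitInterval | (v : ℝ) ≤ q}, ENNReal.ofReal
      (Real.exp (a * (if (v : ℝ) ≤ q then 1 else 0) - c))
      = ENNReal.ofReal (Real.exp (a - c)) * ENNReal.ofReal q := by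
    rw [setLIntegral_congr_fun (g := fun _ => ENNReal.ofReal (Real.exp (a - c))) hm
      (fun v hv => by rw [if_pos (show (v : ℝ) ≤ q from hv), mul_one]), setLIntegral_const, hvol]
  have e2 : ∫⁻ v in {v : unitInterval | (v : ℝ) ≤ q}ᶜ, ENNReal.ofReal
      (Real.exp (a * (if (v : ℝ) ≤ q then 1 else 0) - c))
      = ENNReal.ofReal (Real.exp (-c)) * ENNReal.ofReal (1 - q) := by
    rw [setLIntegral_congr_fun (g := fun _ => ENNReal.ofReal (Real.exp (-c))) hm.compl
      (fun v hv => by rw [if_neg (show ¬ (v : ℝ) ≤ q from hv), mul_zero, zero_sub]),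
      setLIntegral_const, hvol']
  rw [← lintegral_add_compl _ hm, e1, e2, ← ENNReal.ofReal_mul (Real.exp_pos _).le,
    ← ENNReal.ofReal_mul (Real.exp_pos _).le, ← ENNReal.ofReal_add
      (mul_nonneg (Real.exp_pos _).le h0) (mul_nonneg (Real.exp_pos _).le (by linarith)),
    ← ENNReal.ofReal_one]
  refine ENNReal.ofReal_le_ofReal ?_
  have h2 : Real.exp (a - c) * q + Real.exp (-c) * (1 - q) = Real.exp (-c) * (1 + c) := by
    rw [sub_eq_add_neg, Real.exp_add, hc]; ring
  rw [h2]
  have h3 : 1 + c ≤ Real.exp c := by linarith [Real.add_one_le_exp c]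
  calc Real.exp (-c) * (1 + c) ≤ Real.exp (-c) * Real.exp c :=
        mul_le_mul_of_nonneg_left h3 (Real.exp_pos _).le
    _ = 1 := by rw [← Real.exp_add]; simp

/-- Hoeffding's lemma for a variable with range of length `1`, normalized so that the factors can be
multiplied. -/
theorem exp_reward_le_one {Z : Type*} [MeasurableSpace Z] (ν : Measure Z) [IsProbabilityMeasure ν]
    {f : Z → ℝ} (hf : Measurable f) (h01 : ∀ z, f z ∈ Set.Icc (0 : ℝ) 1) (θ : ℝ) :
    ∫⁻ z, ENNReal.ofReal (Real.exp (θ * (f z - ∫ z, f z ∂ν) - θ ^ 2 / 8)) ∂ν ≤ 1 := by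
  have h := ProbabilityTheory.hasSubgaussianMGF_of_mem_Icc (μ := ν) (X := f) (a := 0) (b := 1)
    hf.aemeasurable (Filter.Eventually.of_forall h01)
  have h1 := h.mgf_le θ
  have h2 := h.integrable_exp_mul θ
  simp only [ProbabilityTheory.mgf] at h1
  have e : ∀ z, Real.exp (θ * (f z - ∫ z, f z ∂ν) - θ ^ 2 / 8)
      = Real.exp (-(θ ^ 2 / 8)) * Real.exp (θ * (f z - ∫ z, f z ∂ν)) := by
    intro z; rw [← Real.exp_add]; congr 1; ring
  simp only [e]
  rw [← ofReal_integral_eq_lintegral_ofReal (h2.const_mul _)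
    (Filter.Eventually.of_forall fun z => by positivity), integral_const_mul,
    ← ENNReal.ofReal_one]
  refine ENNReal.ofReal_le_ofReal ?_
  calc _ ≤ Real.exp (-(θ ^ 2 / 8)) * Real.exp (θ ^ 2 / 8) := by
        refine mul_le_mul_of_nonneg_left (h1.trans_eq ?_) (Real.exp_pos _).le
        congr 1
        norm_num
        ring
    _ = 1 := by rw [← Real.exp_add]; simp

theorem measurable_meanReward {Pol O Z : Type*} [MeasurableSpace Pol] [MeasurableSpace O]
    [MeasurableSpace Z] {νZ : Measure Z} [IsProbabilityMeasure νZ] {env : ℕ → Pol → Z → O}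
    {rew : O → ℝ} (he : IsEnvironment env rew) (t : ℕ) :
    Measurable (meanReward νZ env rew t) := by
  have h : StronglyMeasurable fun x : Pol × Z => rew (env t x.1 x.2) :=
    (he.measurable_rew.comp (he.measurable_env t)).stronglyMeasurable
  exact h.integral_prod_right.measurable

theorem meanReward_mem {Pol O Z : Type*} [MeasurableSpace Pol] [MeasurableSpace O]
    [MeasurableSpace Z] {νZ : Measure Z} [IsProbabilityMeasure νZ] {env : ℕ → Pol → Z → O}
    {rew : O → ℝ} (he : IsEnvironment env rew) (t : ℕ) (π : Pol) :
    meanReward νZ env rew t π ∈ Set.Icc (0 : ℝ) 1 := by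
  have hm : Measurable fun z => rew (env t π z) :=
    (he.measurable_rew.comp (he.measurable_env t)).comp measurable_prodMk_left
  constructor
  · exact integral_nonneg fun z => (he.rew_mem _).1
  · have h := integral_mono (μ := νZ) (Integrable.of_mem_Icc 0 1 hm.aemeasurable
      (Filter.Eventually.of_forall fun z => he.rew_mem _)) (integrable_const (1 : ℝ))
      (fun z => (he.rew_mem _).2)
    simpa [meanReward] using h

theorem meanReward_le_optReward {Pol O Z : Type*} [MeasurableSpace Pol] [MeasurableSpace O]
    [MeasurableSpace Z] {νZ : Measure Z} [IsProbabilityMeasure νZ] {env : ℕ → Pol → Z → O}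
    {rew : O → ℝ} (he : IsEnvironment env rew) (t : ℕ) (π : Pol) :
    meanReward νZ env rew t π ≤ optReward νZ env rew t := by
  refine le_ciSup (f := fun π => meanReward νZ env rew t π) ⟨1, ?_⟩ π
  rintro _ ⟨π, rfl⟩
  exact (meanReward_mem he t π).2

namespace MasterState

variable {S U Pol O Z : Type*} [MeasurableSpace S] [MeasurableSpace U] [MeasurableSpace Pol]
  [MeasurableSpace O] [MeasurableSpace Z] {A : Learner S U Pol O} {env : ℕ → Pol → Z → O}
  {rew : O → ℝ} {ρ : ℕ → ℝ} {T : ℕ} {δ : ℝ} (νZ : Measure Z) [IsProbabilityMeasure νZ]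
  (νU : Measure U) [IsProbabilityMeasure νU]

open Classical in
/-- Concentration of the number of successful coins over predictable rounds. -/
theorem measure_coin_deviation (hA : A.IsMeasurable) (he : IsEnvironment env rew)
    (hρ : ∀ m, 0 < ρ (2 ^ m)) {n m : ℕ} (hnm : ρ (2 ^ n) ≤ ρ (2 ^ m)) (a x : ℝ)
    {D : ℕ → (ℕ → Z × (U × (ℕ → unitInterval))) → Prop} (hD : ∀ t, Measurable (D t))
    (hDd : ∀ t ω ω', (∀ u < t, ω u = ω' u) → (D t ω ↔ D t ω'))
    (hDn : ∀ t ω, D t ω → (toRun A env rew ρ T δ hρ ω).n t = n) (N : ℕ) :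
    interactionLaw νZ (masterSeed νU) {ω | x < ∑ t ∈ Finset.range N,
      if D t ω then a * (if (toRun A env rew ρ T δ hρ ω).coin t m then 1 else 0)
        - (Real.exp a - 1) * (ρ (2 ^ n) / ρ (2 ^ m)) else 0} ≤ ENNReal.ofReal (Real.exp (-x)) := by
  refine measure_le_sum_le_exp_neg (νZ.prod (masterSeed νU)) (h := fun t ω =>
    if D t ω then a * (if (toRun A env rew ρ T δ hρ ω).coin t m then 1 else 0)
        - (Real.exp a - 1) * (ρ (2 ^ n) / ρ (2 ^ m)) else 0) ?_ ?_ ?_ N x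
  · intro t
    refine Measurable.ite (measurableSet_setOfPred.2 (hD t)) (Measurable.sub_const
      (Measurable.const_mul (Measurable.ite (measurableSet_setOfPred.2
        (measurable_run_coin ρ T δ hA he hρ t m)) measurable_const measurable_const) _) _)
      measurable_const
  · intro t ω ω' h
    have e1 := hDd t ω ω' fun u hu => h u hu.le
    have e2 : (toRun A env rew ρ T δ hρ ω).coin t m ↔ (toRun A env rew ρ T δ hρ ω').coin t m := by
      change Coin A env rew ρ T δ ω t m ↔ Coin A env rew ρ T δ ω' t m
      have e3 : before A env rew ρ T δ ω t = before A env rew ρ T δ ω' t :=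
        Learner.state_congr _ _ fun u hu => h u hu.le
      rw [Coin, Coin, e3, h t le_rfl]
    simp only [e1, e2]
  · intro t ω
    have e1 : ∀ y, D t (Function.update ω t y) ↔ D t ω := fun y =>
      hDd t _ _ fun u hu => Function.update_of_ne hu.ne _ _
    by_cases hDt : D t ω
    · have e2 : ∀ y, (toRun A env rew ρ T δ hρ (Function.update ω t y)).coin t m ↔
          (y.2.2 m : ℝ) ≤ ρ (2 ^ n) / ρ (2 ^ m) := by
        intro y
        change Coin A env rew ρ T δ (Function.update ω t y) t m ↔ _
        have e3 : (before A env rew ρ T δ (Function.update ω t y) t).n = n :=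
          hDn t _ ((e1 y).2 hDt)
        rw [Coin, e3, Function.update_self]
      simp only [e1, hDt, if_true, e2]
      have hmp : MeasurePreserving (fun y : Z × (U × (ℕ → unitInterval)) => y.2.2 m)
          (νZ.prod (masterSeed νU)) volume :=
        (measurePreserving_eval_infinitePi (fun _ : ℕ => (volume : Measure unitInterval)) m).comp
          (measurePreserving_snd.comp measurePreserving_snd)
      have hmeas : Measurable fun v : unitInterval => ENNReal.ofReal (Real.exp
          (a * (if (v : ℝ) ≤ ρ (2 ^ n) / ρ (2 ^ m) then 1 else 0)
            - (Real.exp a - 1) * (ρ (2 ^ n) / ρ (2 ^ m)))) := by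
        refine (Real.measurable_exp.comp (Measurable.sub_const (Measurable.const_mul
          (Measurable.ite ?_ measurable_const measurable_const) _) _)).ennreal_ofReal
        exact measurableSet_le measurable_subtype_coe measurable_const
      have h1 := hmp.lintegral_comp hmeas
      rw [h1]
      exact exp_coin_le_one (div_pos (hρ n) (hρ m)).le ((div_le_one (hρ m)).2 hnm)
    · simp only [e1, hDt, if_false, Real.exp_zero, ENNReal.ofReal_one, lintegral_const,
        measure_univ, mul_one, le_refl]

/-- Concentration of the rewards. -/
theorem measure_reward_deviation (hA : A.IsMeasurable) (he : IsEnvironment env rew)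
    (hρ : ∀ m, 0 < ρ (2 ^ m)) {θ : ℝ} (hθ : 0 ≤ θ) (x : ℝ) (s e : ℕ) :
    interactionLaw νZ (masterSeed νU) {ω | x < ∑ t ∈ Finset.Ico s e,
      (θ * ((toRun A env rew ρ T δ hρ ω).R t - optReward νZ env rew t) - θ ^ 2 / 8)}
      ≤ ENNReal.ofReal (Real.exp (-x)) := by
  have hM := master_isMeasurable hA he.measurable_rew ρ T δ
  set M := master A rew ρ T δ with hMdef
  have hmeas : ∀ t, Measurable fun ω : ℕ → Z × (U × (ℕ → unitInterval)) =>
      θ * (rew (M.feedback env ω t)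
        - meanReward νZ env rew t (M.policy (M.state env ω t) (ω t).2)) - θ ^ 2 / 8 := by
    intro t
    refine Measurable.sub_const (Measurable.const_mul (Measurable.sub ?_ ?_) _) _
    · exact he.measurable_rew.comp (Learner.measurable_feedback hM he.measurable_env t)
    · exact (measurable_meanReward he t).comp (Learner.measurable_policy hM he.measurable_env t)
  have h := measure_le_sum_le_exp_neg (νZ.prod (masterSeed νU)) (h := fun t ω =>
    if s ≤ t then θ * (rew (M.feedback env ω t)
      - meanReward νZ env rew t (M.policy (M.state env ω t) (ω t).2)) - θ ^ 2 / 8 else 0)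
    (fun t => by
      by_cases hst : s ≤ t
      · simp only [hst, if_true]; exact hmeas t
      · simp only [hst, if_false]; exact measurable_const)
    (fun t ω ω' h => by
      have e3 : M.state env ω t = M.state env ω' t :=
        Learner.state_congr _ _ fun u hu => h u hu.le
      simp only [Learner.feedback, e3, h t le_rfl])
    (fun t ω => by
      by_cases hst : s ≤ t
      swap
      · simp [hst]
      simp only [hst, if_true]
      have e3 : ∀ y, M.state env (Function.update ω t y) t = M.state env ω t := fun y =>
        Learner.state_congr _ _ fun u hu => Function.update_of_ne hu.ne _ _
      have hm2 := (Real.measurable_exp.comp ((hmeas t).comp (measurable_update ω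
        (a := t)))).ennreal_ofReal
      simp only [Function.comp_def, Learner.feedback, e3, Function.update_self] at hm2 ⊢
      -- Integrating over the noise first, with the seed fixed, the policy is constant and
      -- Hoeffding's lemma applies.
      rw [lintegral_prod_symm _ hm2.aemeasurable]
      refine le_trans (lintegral_mono (g := fun _ => 1) fun w => ?_) (by simp)
      exact exp_reward_le_one νZ (f := fun z => rew (env t (M.policy (M.state env ω t) w) z))
        ((he.measurable_rew.comp (he.measurable_env t)).comp measurable_prodMk_left)
        (fun z => he.rew_mem _) θ)
    e x
  refine le_trans (measure_mono fun ω hω => ?_) h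
  refine lt_of_lt_of_le (show x < _ from hω) ?_
  have e1 : Finset.Ico s e = (Finset.range e).filter (s ≤ ·) := by
    ext u; simp [and_comm]
  rw [e1, Finset.sum_filter]
  refine Finset.sum_le_sum fun t _ => ?_
  split_ifs
  · have h1 := meanReward_le_optReward (νZ := νZ) he t (M.policy (M.state env ω t) (ω t).2)
    refine sub_le_sub_right (mul_le_mul_of_nonneg_left ?_ hθ) _
    exact sub_le_sub_left h1 _
  · exact le_rfl

end MasterState

/-! ### Rates, nearly stationary pieces, and the regret within a window. -/

/-- A rate `ρ` on `1, …, T` as the meta-algorithm uses it, and the factor `6 h l` by which it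
inflates it. -/
structure IsRate (ρ rhat : ℕ → ℝ) (T : ℕ) (h l : ℝ) : Prop where
  anti : ∀ i j, 1 ≤ i → i ≤ j → j ≤ T → ρ j ≤ ρ i
  mono : ∀ i j : ℕ, 1 ≤ i → i ≤ j → j ≤ T → i * ρ i ≤ j * ρ j
  sqrt_le : ∀ i : ℕ, 1 ≤ i → i ≤ T → √(i : ℝ) ≤ i * ρ i
  rhat_eq : ∀ i, rhat i = 6 * h * l * ρ i
  le_h : ∀ k : ℕ, 2 ^ k ≤ T → (k : ℝ) + 1 ≤ h
  two_le_h : 2 ≤ h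
  nine_le : 9 ≤ l

namespace IsRate

variable {ρ rhat : ℕ → ℝ} {T : ℕ} {h l : ℝ} (H : IsRate ρ rhat T h l)
include H

theorem one_le_mul {i : ℕ} (h1 : 1 ≤ i) (h2 : i ≤ T) : 1 ≤ i * ρ i := by
  refine le_trans ?_ (H.sqrt_le i h1 h2)
  rw [Real.one_le_sqrt]
  exact_mod_cast h1

theorem pos {i : ℕ} (h1 : 1 ≤ i) (h2 : i ≤ T) : 0 < ρ i := by
  have := H.one_le_mul h1 h2
  by_contra h3
  have : (i : ℝ) * ρ i ≤ 0 := mul_nonpos_of_nonneg_of_nonpos (by positivity) (not_lt.1 h3)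
  linarith

end IsRate

/-- A division of the rounds `0, …, T - 1` into `L` pieces of consecutive rounds, on each of which
`f` varies by at most `d`, which is small compared with the rate `ρ`. -/
structure NearStationary (f ρ : ℕ → ℝ) (T L : ℕ) where
  lab : ℕ → ℕ
  d : ℕ → ℝ
  mono : Monotone lab
  lab_lt : ∀ t < T, lab t < L
  sub_le : ∀ s t, s < T → t < T → lab s = lab t → f s - f t ≤ d (lab s)
  d_le : ∀ s t, s ≤ t → t < T → lab s = lab t → d (lab s) ≤ ρ (t + 1 - s)

namespace NearStationary

variable {f ρ : ℕ → ℝ} {T L : ℕ} (N : NearStationary f ρ T L)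

/-- The first round of a piece. -/
noncomputable def first (k : ℕ) : ℕ := sInf {t | N.lab t = k}

/-- The value of `f` in the first round of the piece of `t`. -/
noncomputable def base (t : ℕ) : ℝ := f (N.first (N.lab t))

theorem lab_first (t : ℕ) : N.lab (N.first (N.lab t)) = N.lab t :=
  Nat.sInf_mem (s := {s | N.lab s = N.lab t}) ⟨t, rfl⟩

theorem first_le {t k : ℕ} (h : N.lab t = k) : N.first k ≤ t := Nat.sInf_le h

theorem base_sub_le {t : ℕ} (h : t < T) : N.base t - f t ≤ N.d (N.lab t) := by
  have := N.sub_le (N.first (N.lab t)) t ((N.first_le rfl).trans_lt h) h (N.lab_first t)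
  rwa [N.lab_first] at this

theorem sub_base_le {t : ℕ} (h : t < T) : f t - N.base t ≤ N.d (N.lab t) :=
  N.sub_le t _ h ((N.first_le rfl).trans_lt h) (N.lab_first t).symm

theorem lab_eq_of_mem {s t u : ℕ} (h : N.lab s = N.lab t) (h1 : s ≤ u) (h2 : u ≤ t) :
    N.lab u = N.lab t :=
  le_antisymm (N.mono h2) (h ▸ N.mono h1)

theorem base_congr {s t : ℕ} (h : N.lab s = N.lab t) : N.base s = N.base t := by
  rw [base, base, h]

end NearStationary

/-- Drop nonpositive terms from the end until the last remaining index comes with a bound for its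
whole prefix. It is applied to the rounds of one instance: failing rounds are made nonpositive, and
the last non-failing round bounds the rest. -/
theorem sum_le_of_forall_nonpos_or {Q : Finset ℕ} {h : ℕ → ℝ} {K : ℝ} (hK : 0 ≤ K)
    (hQ : ∀ w ∈ Q, h w ≤ 0 ∨ ∑ u ∈ Q.filter (· ≤ w), h u ≤ K) : ∑ u ∈ Q, h u ≤ K := by
  induction Q using Finset.induction_on_max with
  | empty => simpa using hK
  | insert a s ha ih =>
    have has : a ∉ s := fun h => lt_irrefl _ (ha a h)
    rcases hQ a (Finset.mem_insert_self _ _) with h1 | h1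
    · rw [Finset.sum_insert has]
      have h2 := ih fun w hw => by
        refine (hQ w (Finset.mem_insert_of_mem hw)).imp_right fun h3 => ?_
        rwa [Finset.filter_insert, if_neg (not_le.2 (ha w hw))] at h3
      linarith
    · rwa [Finset.filter_true_of_mem] at h1
      intro u hu
      rcases Finset.mem_insert.1 hu with rfl | hu
      · exact le_rfl
      · exact (ha u hu).le

theorem card_filter_dvd_le (s e M : ℕ) :
    ((Finset.Ico s e).filter fun u => M ∣ u - s).card ≤ (e - s) / M + 1 := by
  have h := Finset.card_le_card_of_injOn (s := (Finset.Ico s e).filter fun u => M ∣ u - s)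
    (t := Finset.range ((e - s) / M + 1)) (fun u => (u - s) / M) ?_ ?_
  · simpa using h
  · intro u hu
    simp only [Finset.coe_filter, Finset.mem_Ico, Set.mem_ofPred_eq] at hu
    simp only [Finset.coe_range, Set.mem_Iio]
    exact Nat.lt_succ_of_le (Nat.div_le_div_right (by omega))
  · intro u hu v hv huv
    simp only [Finset.coe_filter, Finset.mem_Ico, Set.mem_ofPred_eq] at hu hv
    have h1 := Nat.div_mul_cancel hu.2
    have h2 := Nat.div_mul_cancel hv.2
    simp only at huv
    rw [huv] at h1
    omega

namespace Run

variable {f ρ rhat : ℕ → ℝ} {T L : ℕ} (X : Run rhat) (N : NearStationary f ρ T L)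

/-- The guarantee of the instance active in round `t` fails, and this instance started in the piece
of `t`. -/
def Viol (t : ℕ) : Prop :=
  N.first (N.lab t) ≤ X.instStart t ∧
    X.Violates (N.base t - 2 * N.d (N.lab t)) (fun j => 2 * (j * ρ j)) t

/-- In round `s` an instance of order `m` may start in a block of order `n`; its rounds are within
a piece, and the regret of the estimates is large for its length. -/
def Cand (n m s : ℕ) : Prop :=
  X.n s = n ∧ m ≤ n ∧ 2 ^ m ∣ X.pos s ∧ 0 < X.pos s ∧ s + 2 ^ m ≤ T ∧
    N.lab s = N.lab (s + 2 ^ m - 1) ∧ 12 * rhat (2 ^ m) ≤ N.base s - X.U (s - 1)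

open Classical in
/-- The rewards and the coins concentrate. -/
structure Typical (l : ℝ) : Prop where
  reward : ∀ s e : ℕ, s < e → e ≤ T →
    ∑ u ∈ Finset.Ico s e, (X.R u - f u) ≤ (1 / 8 + 4 * l) * √((e - s : ℕ) : ℝ)
  coin : ∀ s e n m : ℕ, e ≤ T → m ≤ n → 2 ^ n ≤ T →
    (((Finset.Ico s e).filter fun u => (X.n u = n ∧ 2 ^ m ∣ X.pos u) ∧ X.coin u m).card : ℝ)
      ≤ 7 / 4 * (ρ (2 ^ n) / ρ (2 ^ m))
        * ((Finset.Ico s e).filter fun u => X.n u = n ∧ 2 ^ m ∣ X.pos u).card + 4 * l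
  cand : ∀ n m : ℕ, m ≤ n → 2 ^ n ≤ T →
    ρ (2 ^ n) / ρ (2 ^ m) * ((Finset.range T).filter fun u => X.Cand N n m u).card
      ≤ 2 * (((Finset.range T).filter fun u => X.Cand N n m u ∧ X.coin u m).card + 4 * l)

theorem instStart_eq {t s u : ℕ} {m : ℕ} (hb : t - X.pos t ≤ s) (hsu : s ≤ u) (hut : u ≤ t)
    (hd : 2 ^ m ∣ X.pos s) (hlt : u < s + 2 ^ m) (hact : X.act u = m) : X.instStart u = s := by
  have h1 := X.pos_of_mem_block hb (hsu.trans hut)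
  have h2 := X.pos_of_mem_block (hb.trans hsu) hut
  obtain ⟨c, hc⟩ := hd
  have h3 : X.pos u = (u - s) + 2 ^ m * c := by omega
  rw [instStart, hact, h3, Nat.add_mul_mod_self_left, Nat.mod_eq_of_lt (by omega)]
  omega

open Classical in
/-- The regret against the estimates over the rounds from `s` to `t`, if only instances of order at
most `k` are active and all of them started within these rounds. -/
theorem sum_window_le {h l : ℝ} (H : IsRate ρ rhat T h l) (hX : X.Typical N l) {s t k : ℕ}
    (hg : ∀ u, X.g u - X.R u ≤ 1) (hst : s ≤ t) (htT : t < T) (hb : t - X.pos t ≤ s)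
    (hk : k ≤ X.n t) (hdvd : 2 ^ k ∣ X.pos s) (hact : ∀ u, s ≤ u → u ≤ t → X.act u ≤ k)
    (hlab : N.lab s = N.lab t) :
    ∑ u ∈ Finset.Ico s (t + 1), (X.g u - X.R u)
      ≤ 15 * l * h * ((t + 1 - s : ℕ) * ρ (t + 1 - s))
        + ((Finset.Ico s (t + 1)).filter fun u => X.Viol N u).card := by
  set W := Finset.Ico s (t + 1) with hW
  set len := t + 1 - s with hlen
  set C : ℕ → ℝ := fun j => j * ρ j with hC
  have hW' : ∀ u, u ∈ W ↔ s ≤ u ∧ u ≤ t := fun u => by rw [hW, Finset.mem_Ico]; omega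
  have hl := H.nine_le
  have hlen1 : 1 ≤ len := by omega
  have hlenT : len ≤ T := by omega
  have hC1 : ∀ j, 1 ≤ j → j ≤ T → 1 ≤ C j := fun j h1 h2 => H.one_le_mul h1 h2
  have hn : 2 ^ X.n t ≤ T := X.two_pow_le htT
  have hstart : ∀ u ∈ W, s ≤ X.instStart u ∧ X.instStart u ≤ u := by
    intro u hu
    rw [hW'] at hu
    refine ⟨?_, X.instStart_le u⟩
    have h1 := X.pos_of_mem_block hb hst
    have h2 := X.pos_of_mem_block (hb.trans hu.1) hu.2
    obtain ⟨c, hc⟩ := (pow_dvd_pow 2 (hact u hu.1 hu.2)).trans hdvd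
    have h3 : X.pos u = (u - s) + 2 ^ X.act u * c := by omega
    rw [instStart, h3, Nat.add_mul_mod_self_left]
    have := Nat.mod_le (u - s) (2 ^ X.act u)
    omega
  -- Since `g - R ≤ 1`, charging one unit to a failing round makes its term nonpositive.
  set hh : ℕ → ℝ := fun u => (X.g u - X.R u) - (if X.Viol N u then 1 else 0) with hhh
  suffices hmain : ∑ u ∈ W, hh u ≤ 15 * l * h * C len by
    rw [hhh, Finset.sum_sub_distrib, Finset.sum_boole] at hmain
    linarith
  have hmaps : ∀ u ∈ W, X.act u ∈ Finset.range (k + 1) := fun u hu => by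
    rw [hW'] at hu
    exact Finset.mem_range.2 (Nat.lt_succ_of_le (hact u hu.1 hu.2))
  rw [← Finset.sum_fiberwise_of_maps_to hmaps]
  have hkh : ((k : ℝ) + 1) ≤ h := H.le_h k ((Nat.pow_le_pow_right (by norm_num) hk).trans hn)
  have horder : ∀ m ∈ Finset.range (k + 1), ∑ u ∈ W.filter (fun u => X.act u = m), hh u
      ≤ 15 * l * C len := by
    intro m hm
    have hmk : m ≤ k := Nat.lt_succ_iff.1 (Finset.mem_range.1 hm)
    have hmT : 2 ^ m ≤ T := (Nat.pow_le_pow_right (by norm_num) (hmk.trans hk)).trans hn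
    -- An instance of order `m` has at most `M` rounds in the window, so it contributes at most `2 *
    -- C M`.
    set M := min (2 ^ m) len
    have hM1 : 1 ≤ M := le_min Nat.one_le_two_pow hlen1
    have hMT : M ≤ T := (min_le_right _ _).trans hlenT
    set Sm := W.filter (fun u => (X.n u = X.n t ∧ 2 ^ m ∣ X.pos u) ∧ X.coin u m) with hSm
    have hmaps2 : ∀ u ∈ W.filter (fun u => X.act u = m), X.instStart u ∈ Sm := by
      intro u hu
      rw [Finset.mem_filter] at hu
      obtain ⟨hu, hum⟩ := hu
      have h1 := hstart u hu
      rw [hW'] at hu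
      have h2 := (X.act_on u).2
      have h3 := X.dvd_pos_instStart u
      rw [hum] at h2 h3
      rw [hSm, Finset.mem_filter, hW']
      refine ⟨⟨h1.1, h1.2.trans hu.2⟩,
        ⟨X.n_of_mem_block (hb.trans h1.1) (h1.2.trans hu.2), h3⟩, ?_⟩
      rw [instStart, hum]
      exact h2
    rw [← Finset.sum_fiberwise_of_maps_to hmaps2]
    have hinner : ∀ s' ∈ Sm, ∑ u ∈ (W.filter (fun u => X.act u = m)).filter
        (fun u => X.instStart u = s'), hh u ≤ 2 * C M := by
      intro s' hs'
      rw [hSm, Finset.mem_filter, hW'] at hs'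
      obtain ⟨⟨hs1, hs2⟩, ⟨-, hs3⟩, -⟩ := hs'
      refine sum_le_of_forall_nonpos_or (by linarith [hC1 M hM1 hMT]) fun w hw => ?_
      rw [Finset.mem_filter, Finset.mem_filter, hW'] at hw
      obtain ⟨⟨⟨hw1, hw2⟩, hwm⟩, hws⟩ := hw
      by_cases hv : X.Viol N w
      · left
        simp only [hhh, hv, if_true]
        linarith [hg w]
      right
      have hlabw : N.lab w = N.lab t := N.lab_eq_of_mem hlab hw1 hw2
      have hfirst : N.first (N.lab w) ≤ X.instStart w := by
        rw [hws]
        exact (N.first_le (hlab.trans hlabw.symm)).trans hs1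
      have hnv : ¬ X.Violates (N.base w - 2 * N.d (N.lab w)) (fun j => 2 * (j * ρ j)) w :=
        fun h' => hv ⟨hfirst, h'⟩
      rw [Violates, not_not] at hnv
      have hlt := X.lt_instStart_add w
      rw [hws, hwm] at hlt
      have heq : ((W.filter (fun u => X.act u = m)).filter (fun u => X.instStart u = s')).filter
          (· ≤ w) = X.instRounds w := by
        ext u
        simp only [instRounds, Finset.mem_filter, hW', Finset.mem_Icc, hws, hwm]
        constructor
        · rintro ⟨⟨⟨-, h2⟩, h3⟩, h4⟩
          exact ⟨⟨h3 ▸ X.instStart_le u, h4⟩, h2⟩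
        · rintro ⟨⟨h1, h2⟩, h3⟩
          exact ⟨⟨⟨⟨by omega, by omega⟩, h3⟩,
            X.instStart_eq (hb.trans hs1) h1 (by omega) hs3 (by omega) h3⟩, h2⟩
      rw [heq]
      have hcard1 : 1 ≤ (X.instRounds w).card := Finset.card_pos.2 ⟨w, by
        simp [instRounds, X.instStart_le w]⟩
      have hcard2 : (X.instRounds w).card ≤ M := by
        refine (Finset.card_filter_le _ _).trans ?_
        rw [Nat.card_Icc, hws]
        exact le_min (by omega) (by omega)
      calc ∑ u ∈ X.instRounds w, hh u ≤ ∑ u ∈ X.instRounds w, (X.g u - X.R u) := by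
            refine Finset.sum_le_sum fun u _ => ?_
            simp only [hhh]
            split_ifs <;> linarith
        _ ≤ 2 * C (X.instRounds w).card := hnv.2
        _ ≤ 2 * C M := by
            have := H.mono _ _ hcard1 hcard2 hMT
            simp only [hC]
            linarith
    have hdvdm : ∀ u ∈ W, 2 ^ m ∣ X.pos u → 2 ^ m ∣ u - s := by
      intro u hu hd
      rw [hW'] at hu
      have h1 := X.pos_of_mem_block hb hst
      have h2 := X.pos_of_mem_block (hb.trans hu.1) hu.2
      have h3 : u - s = X.pos u - X.pos s := by omega
      rw [h3]
      exact Nat.dvd_sub hd ((pow_dvd_pow 2 hmk).trans hdvd)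
    -- The window starts at a multiple of `2 ^ m`, so the aligned rounds are those at multiples of
    -- `2 ^ m` from `s`.
    have hal : ((W.filter fun u => X.n u = X.n t ∧ 2 ^ m ∣ X.pos u).card : ℕ) ≤ len / 2 ^ m + 1 := by
      refine le_trans (Finset.card_le_card fun u hu => ?_) (card_filter_dvd_le s (t + 1) (2 ^ m))
      rw [Finset.mem_filter] at hu ⊢
      exact ⟨hu.1, hdvdm u hu.1 hu.2.2⟩
    have hSle : Sm.card ≤ (W.filter fun u => X.n u = X.n t ∧ 2 ^ m ∣ X.pos u).card := by
      refine Finset.card_le_card fun u hu => ?_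
      rw [hSm, Finset.mem_filter] at hu
      exact Finset.mem_filter.2 ⟨hu.1, hu.2.1⟩
    refine (Finset.sum_le_sum hinner).trans ?_
    rw [Finset.sum_const, nsmul_eq_mul]
    have hClen := hC1 len hlen1 hlenT
    rcases le_or_gt (2 ^ m) len with hcase | hcase
    · have hMe : M = 2 ^ m := min_eq_left hcase
      have hcoin := hX.coin s (t + 1) (X.n t) m (by omega) (hmk.trans hk) hn
      rw [hMe]
      have h2m : (0 : ℝ) < (2 ^ m : ℕ) := by positivity
      have hal' : (((W.filter fun u => X.n u = X.n t ∧ 2 ^ m ∣ X.pos u).card : ℕ) : ℝ) * (2 ^ m : ℕ)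
          ≤ 2 * len := by
        have h1 : (W.filter fun u => X.n u = X.n t ∧ 2 ^ m ∣ X.pos u).card * 2 ^ m ≤ 2 * len := by
          calc _ ≤ (len / 2 ^ m + 1) * 2 ^ m := Nat.mul_le_mul_right _ hal
            _ = len / 2 ^ m * 2 ^ m + 2 ^ m := by ring
            _ ≤ len + len := Nat.add_le_add (Nat.div_mul_le_self _ _) hcase
            _ = 2 * len := by ring
        exact_mod_cast h1
      have hρm := H.pos (i := 2 ^ m) Nat.one_le_two_pow hmT
      have hρn := H.pos (i := 2 ^ X.n t) Nat.one_le_two_pow hn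
      have hlen2 : len ≤ 2 ^ X.n t := by
        have h1 := X.pos_lt t
        have h2 := X.pos_le t
        omega
      have hρlen : ρ (2 ^ X.n t) ≤ ρ len := H.anti _ _ hlen1 hlen2 hn
      have hCm : C (2 ^ m) ≤ C len := H.mono _ _ Nat.one_le_two_pow hcase hlenT
      have hCm0 : 0 ≤ C (2 ^ m) := by linarith [hC1 (2 ^ m) Nat.one_le_two_pow hmT]
      set a : ℝ := (((W.filter fun u => X.n u = X.n t ∧ 2 ^ m ∣ X.pos u).card : ℕ) : ℝ) with ha
      -- The success probability `ρ (2 ^ n) / ρ (2 ^ m)` cancels the rate in `C (2 ^ m)`; this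
      -- balance is the reason for the choice of the probability in the schedule.
      calc (Sm.card : ℝ) * (2 * C (2 ^ m))
          ≤ (7 / 4 * (ρ (2 ^ X.n t) / ρ (2 ^ m)) * a + 4 * l) * (2 * C (2 ^ m)) :=
            mul_le_mul_of_nonneg_right hcoin (by linarith)
        _ = 7 / 2 * ρ (2 ^ X.n t) * (a * (2 ^ m : ℕ)) + 8 * l * C (2 ^ m) := by
            simp only [hC]
            field_simp
            ring
        _ ≤ 7 / 2 * ρ (2 ^ X.n t) * (2 * len) + 8 * l * C len := by gcongr
        _ ≤ 7 / 2 * ρ len * (2 * len) + 8 * l * C len := by gcongr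
        _ = (7 + 8 * l) * C len := by simp only [hC]; ring
        _ ≤ 15 * l * C len := by
            refine mul_le_mul_of_nonneg_right ?_ (by linarith)
            linarith
    · have hMe : M = len := min_eq_right hcase.le
      rw [hMe]
      have h1 : len / 2 ^ m = 0 := Nat.div_eq_of_lt hcase
      have h2 : (Sm.card : ℝ) ≤ 1 := by
        have : Sm.card ≤ 1 := by omega
        exact_mod_cast this
      nlinarith
  refine (Finset.sum_le_sum horder).trans ?_
  rw [Finset.sum_const, nsmul_eq_mul, Finset.card_range]
  have h3 : 0 ≤ 15 * l * C len := mul_nonneg (by linarith) (by linarith [hC1 len hlen1 hlenT])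
  push_cast
  calc ((k : ℝ) + 1) * (15 * l * C len) ≤ h * (15 * l * C len) :=
        mul_le_mul_of_nonneg_right hkh h3
    _ = 15 * l * h * C len := by ring

end Run

namespace NearStationary

variable {f ρ : ℕ → ℝ} {T L : ℕ} (N : NearStationary f ρ T L)

theorem d_nonneg {t : ℕ} (h : t < T) : 0 ≤ N.d (N.lab t) := by
  simpa using N.sub_le t t h h rfl

end NearStationary

namespace Run

variable {f ρ rhat : ℕ → ℝ} {T L : ℕ} (X : Run rhat) (N : NearStationary f ρ T L)

theorem le_instStart {s t u k : ℕ} (hb : t - X.pos t ≤ s) (hsu : s ≤ u) (hut : u ≤ t)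
    (hdvd : 2 ^ k ∣ X.pos s) (hact : X.act u ≤ k) : s ≤ X.instStart u := by
  have h1 := X.pos_of_mem_block hb (hsu.trans hut)
  have h2 := X.pos_of_mem_block (hb.trans hsu) hut
  obtain ⟨c, hc⟩ := (pow_dvd_pow 2 hact).trans hdvd
  have h3 : X.pos u = (u - s) + 2 ^ X.act u * c := by omega
  rw [instStart, h3, Nat.add_mul_mod_self_left]
  have := Nat.mod_le (u - s) (2 ^ X.act u)
  omega

theorem le_g_of_not_viol {s u : ℕ} (hs : s ≤ X.instStart u) (hlab : N.lab s = N.lab u)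
    (hv : ¬ X.Viol N u) : N.base u - 2 * N.d (N.lab u) ≤ X.g u := by
  by_contra h
  exact hv ⟨(N.first_le hlab).trans hs, fun h' => h h'.1⟩

theorem U_anti {s t : ℕ} (hb : t - X.pos t ≤ s) (hst : s ≤ t) : X.U t ≤ X.U s := by
  obtain ⟨u, h1, h2, h3⟩ := X.exists_U s
  rw [h3]
  have := X.start_of_mem_block hb hst
  exact X.U_le t u (by omega) (by omega)

open Classical in
/-- A candidate instance which is scheduled ends with a restart at the latest. -/
theorem restart_of_cand {h l : ℝ} (H : IsRate ρ rhat T h l) (hX : X.Typical N l)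
    (hg : ∀ u, X.g u ∈ Set.Icc (0 : ℝ) 1) (hR : ∀ u, X.R u ∈ Set.Icc (0 : ℝ) 1)
    (hf : ∀ u, f u ≤ 1)
    (hV : ((Finset.range T).filter (X.Viol N)).card ≤ 23) {n m s : ℕ} (hc : X.Cand N n m s)
    (hcoin : X.coin s m)
    (hb : (s + 2 ^ m - 1) - X.pos (s + 2 ^ m - 1) ≤ s) : X.restart (s + 2 ^ m - 1) := by
  obtain ⟨hn, hmn, hdvd, hpos, hT, hlab, hU⟩ := hc
  have hM : 1 ≤ 2 ^ m := Nat.one_le_two_pow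
  set e := s + 2 ^ m - 1 with he
  have hse : s ≤ e := by omega
  have heT : e < T := by omega
  have hne : X.n e = n := by rw [← hn, X.n_of_mem_block hb hse]
  have hpe : ∀ u, s ≤ u → u ≤ e → u - X.pos u % 2 ^ m = s := by
    intro u h1 h2
    have h3 := X.pos_of_mem_block hb hse
    have h4 := X.pos_of_mem_block (hb.trans h1) h2
    obtain ⟨c, hc⟩ := hdvd
    have h5 : X.pos u = (u - s) + 2 ^ m * c := by omega
    rw [h5, Nat.add_mul_mod_self_left, Nat.mod_eq_of_lt (by omega)]
    omega
  have hact : ∀ u, s ≤ u → u ≤ e → X.act u ≤ m := by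
    intro u h1 h2
    refine X.act_le u m ?_ ?_
    · rw [X.n_of_mem_block (hb.trans h1) h2, hne]; exact hmn
    · rw [hpe u h1 h2]; exact hcoin
  have hwin := X.sum_window_le N H hX (fun u => by linarith [(hg u).2, (hR u).1]) hse heT hb
    (hmn.trans_eq hne.symm) hdvd hact hlab
  have hlen : e + 1 - s = 2 ^ m := by omega
  rw [hlen] at hwin
  have hVle : (((Finset.Ico s (e + 1)).filter fun u => X.Viol N u).card : ℝ) ≤ 23 := by
    have : ((Finset.Ico s (e + 1)).filter fun u => X.Viol N u).card ≤ 23 := by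
      refine le_trans (Finset.card_le_card fun u hu => ?_) hV
      rw [Finset.mem_filter, Finset.mem_Ico] at hu
      rw [Finset.mem_filter, Finset.mem_range]
      exact ⟨by omega, hu.2⟩
    exact_mod_cast this
  have hMT : 2 ^ m ≤ T := by omega
  have hd : N.d (N.lab s) ≤ ρ (2 ^ m) := by
    have := N.d_le s e hse heT hlab
    rwa [hlen] at this
  have hd0 : 0 ≤ N.d (N.lab s) := N.d_nonneg (by omega)
  -- In a failing round the unit charge exceeds `base ≤ 1`, and `0 ≤ g` is enough.
  have hsum : ∑ u ∈ Finset.Ico s (e + 1), (N.base s - 2 * N.d (N.lab s)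
      - (if X.Viol N u then 1 else 0)) ≤ ∑ u ∈ Finset.Ico s (e + 1), X.g u := by
    refine Finset.sum_le_sum fun u hu => ?_
    rw [Finset.mem_Ico] at hu
    have hu2 : u ≤ e := by omega
    have hlu : N.lab u = N.lab s := (N.lab_eq_of_mem hlab hu.1 hu2).trans hlab.symm
    split_ifs with hv
    · have h1 : N.base s ≤ 1 := hf _
      linarith [(hg u).1]
    · have h1 := X.le_g_of_not_viol N
        (X.le_instStart hb hu.1 hu2 hdvd (hact u hu.1 hu2)) hlu.symm hv
      rw [N.base_congr hlu, hlu] at h1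
      linarith
  rw [Finset.sum_sub_distrib, Finset.sum_const, Finset.sum_boole, Nat.card_Ico, hlen,
    nsmul_eq_mul] at hsum
  rw [Finset.sum_sub_distrib] at hwin
  have hM0 : (0 : ℝ) < ((2 ^ m : ℕ) : ℝ) := by positivity
  have hρM := H.one_le_mul hM hMT
  have hl := H.nine_le
  have hh := H.two_le_h
  have hlh : 18 ≤ l * h := by nlinarith
  rw [X.restart_iff]
  refine Or.inl ⟨m, hmn.trans_eq hne.symm, ?_, ?_, ?_⟩
  · rw [hpe e hse le_rfl]; exact hcoin
  · have h3 := X.pos_of_mem_block hb hse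
    obtain ⟨c, hc⟩ := hdvd
    refine ⟨c + 1, ?_⟩
    have := X.pos_le e
    rw [mul_add, mul_one]
    omega
  · have hs : e + 1 - 2 ^ m = s := by omega
    -- A candidate has positive offset, so `s - 1` lies in the same block, where `U` decreases.
    have hUe : X.U e ≤ X.U (s - 1) := by
      refine X.U_anti ?_ (by omega)
      have := X.start_of_mem_block hb hse
      have := X.pos_le s
      omega
    rw [hs, one_div, le_inv_mul_iff₀ (by positivity)]
    rw [H.rhat_eq] at hU ⊢
    push_cast at hM0 hρM hwin hsum hVle ⊢
    set M : ℝ := 2 ^ m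
    have h5 : M * (X.U e + 9 * (6 * h * l * ρ (2 ^ m)))
        ≤ M * (N.base s - 3 * (6 * h * l * ρ (2 ^ m))) := by
      refine mul_le_mul_of_nonneg_left ?_ hM0.le
      linarith
    have h6 : M * N.d (N.lab s) ≤ M * ρ (2 ^ m) := mul_le_mul_of_nonneg_left hd hM0.le
    -- The threshold `12 rhat` of a candidate leaves `3 rhat`, that is `18 l h` times `M * ρ`, above
    -- test 1. The window bound takes `15 l h` of it. The remaining `3 l h ≥ 54` covers the
    -- variation `2 d ≤ 2 ρ` and twice the 23 failures.
    have h7 : 18 * (M * ρ (2 ^ m)) ≤ l * h * (M * ρ (2 ^ m)) :=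
      mul_le_mul_of_nonneg_right hlh (by linarith)
    linarith

/-- There is no restart in a block within a piece as long as no guarantee fails. -/
theorem not_restart {h l : ℝ} (H : IsRate ρ rhat T h l) (hX : X.Typical N l)
    (hg : ∀ u, X.g u ∈ Set.Icc (0 : ℝ) 1) (hR : ∀ u, X.R u ∈ Set.Icc (0 : ℝ) 1) {t : ℕ}
    (htT : t < T) (hlab : N.lab (t - X.pos t) = N.lab t)
    (hv : ∀ u, t - X.pos t ≤ u → u ≤ t → ¬ X.Viol N u) : ¬ X.restart t := by
  classical
  have hl := H.nine_le
  have hh := H.two_le_h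
  have hlh : 18 ≤ l * h := by nlinarith
  have hpos := X.pos_le t
  intro hr
  rw [X.restart_iff] at hr
  set b := t - X.pos t with hb
  have hbt : b ≤ t := by omega
  rcases hr with ⟨m, hm, -, hdvd, hle⟩ | hle
  · have hmp : 2 ^ m ≤ X.pos t + 1 := Nat.le_of_dvd (by omega) hdvd
    have hM : 1 ≤ 2 ^ m := Nat.one_le_two_pow
    have hMT : 2 ^ m ≤ T := by omega
    have hrew := hX.reward (t + 1 - 2 ^ m) (t + 1) (by omega) (by omega)
    have hlen : t + 1 - (t + 1 - 2 ^ m) = 2 ^ m := by omega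
    rw [hlen] at hrew
    have hlab' : N.lab (t + 1 - 2 ^ m) = N.lab t := N.lab_eq_of_mem hlab (by omega) (by omega)
    have hd : N.d (N.lab t) ≤ ρ (2 ^ m) := by
      have := N.d_le (t + 1 - 2 ^ m) t (by omega) htT hlab'
      rwa [hlen, hlab'] at this
    have hf : ∑ u ∈ Finset.Ico (t + 1 - 2 ^ m) (t + 1), f u
        ≤ ((2 ^ m : ℕ) : ℝ) * (N.base t + N.d (N.lab t)) := by
      have h1 := Finset.sum_le_card_nsmul (Finset.Ico (t + 1 - 2 ^ m) (t + 1)) f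
        (N.base t + N.d (N.lab t)) fun u hu => ?_
      · rwa [Nat.card_Ico, hlen, nsmul_eq_mul] at h1
      rw [Finset.mem_Ico] at hu
      have hlu : N.lab u = N.lab t := N.lab_eq_of_mem hlab (by omega) (by omega)
      have := N.sub_base_le (t := u) (by omega)
      rw [N.base_congr hlu, hlu] at this
      linarith
    have hU : N.base t - 2 * N.d (N.lab t) ≤ X.U t := by
      obtain ⟨u, h1, h2, h3⟩ := X.exists_U t
      rw [h3]
      have hlu : N.lab u = N.lab t := N.lab_eq_of_mem hlab h1 h2
      have h4 := X.start_le_instStart u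
      rw [X.start_of_mem_block h1 h2] at h4
      have h5 := X.le_g_of_not_viol N h4 (hlab.trans hlu.symm) (hv u h1 h2)
      rwa [N.base_congr hlu, hlu] at h5
    have hsq := H.sqrt_le (2 ^ m) hM hMT
    rw [Finset.sum_sub_distrib] at hrew
    rw [one_div, le_inv_mul_iff₀ (by positivity), H.rhat_eq] at hle
    have hρ := H.pos hM hMT
    have hM0 : (0 : ℝ) < ((2 ^ m : ℕ) : ℝ) := by positivity
    have h1 : (1 / 8 + 4 * l) * √((2 ^ m : ℕ) : ℝ)
        ≤ (1 / 8 + 4 * l) * (((2 ^ m : ℕ) : ℝ) * ρ (2 ^ m)) :=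
      mul_le_mul_of_nonneg_left hsq (by linarith)
    push_cast at *
    set M : ℝ := 2 ^ m
    have h2 : M * (X.U t + 9 * (6 * h * l * ρ (2 ^ m)))
        ≤ M * (N.base t + N.d (N.lab t) + (1 / 8 + 4 * l) * ρ (2 ^ m)) := by linarith
    have h3 := le_of_mul_le_mul_left h2 hM0
    -- Average rewards exceed the base value by at most `d + (1 / 8 + 4 l) ρ`, and `U` is at most `2
    -- d` below it, with `d ≤ ρ`. Test 1 would need an excess of `54 l h ρ`.
    have h4 : 54 * (l * h) * ρ (2 ^ m) ≤ (4 + 4 * l) * ρ (2 ^ m) := by linarith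
    have h5 := le_of_mul_le_mul_right h4 hρ
    nlinarith
  · have hps : X.pos b = 0 := by
      have := X.pos_of_mem_block (t := t) (u := b) le_rfl hbt
      omega
    have hwin := X.sum_window_le N H hX (fun u => by linarith [(hg u).2, (hR u).1]) hbt htT
      le_rfl (k := X.n t) le_rfl (by rw [hps]; exact dvd_zero _)
      (fun u h1 h2 => (X.act_on u).1.trans_eq (X.n_of_mem_block h1 h2)) hlab
    have hvc : ((Finset.Ico b (t + 1)).filter fun u => X.Viol N u).card = 0 := by
      rw [Finset.card_eq_zero, Finset.filter_eq_empty_iff]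
      intro u hu
      rw [Finset.mem_Ico] at hu
      exact hv u hu.1 (by omega)
    have hlen : t + 1 - b = X.pos t + 1 := by omega
    rw [hvc, hlen, Nat.cast_zero, add_zero] at hwin
    have hp : (0 : ℝ) < ((X.pos t + 1 : ℕ) : ℝ) := by positivity
    rw [one_div, le_inv_mul_iff₀ hp, H.rhat_eq] at hle
    -- Test 2 asks for `18 h l` where the window bound allows `15 h l`.
    have h1 := H.one_le_mul (i := X.pos t + 1) (by omega) (by omega)
    nlinarith

end Run

/-! ### Counting restarts, blocks and scheduled candidates. -/

namespace Run

variable {f ρ rhat : ℕ → ℝ} {T L : ℕ} (X : Run rhat) (N : NearStationary f ρ T L)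

open Classical in
/-- Each restart is caused by a new piece or by a failing guarantee. -/
theorem card_restart_le {h l : ℝ} (H : IsRate ρ rhat T h l) (hX : X.Typical N l)
    (hg : ∀ u, X.g u ∈ Set.Icc (0 : ℝ) 1) (hR : ∀ u, X.R u ∈ Set.Icc (0 : ℝ) 1) {S : Finset ℕ}
    (hS : ∀ t ∈ S, t < T ∧ X.restart t) :
    S.card ≤ (S.image N.lab).card
      + ((Finset.range T).filter fun u => X.Viol N u ∧ N.lab u ∈ S.image N.lab).card := by
  rw [← Finset.card_filter_add_card_filter_not (s := S) fun t => N.lab (t - X.pos t) ≠ N.lab t]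
  refine Nat.add_le_add ?_ ?_
  · refine Finset.card_le_card_of_injOn N.lab (fun t ht => ?_) ?_
    · exact Finset.mem_image_of_mem _ (Finset.mem_filter.1 ht).1
    · have key : ∀ t ∈ S, ∀ t' ∈ S, N.lab (t' - X.pos t') ≠ N.lab t' → t < t' →
          N.lab t ≠ N.lab t' := by
        intro t ht t' ht' hne hlt heq
        have h1 := X.restart_succ_le_start hlt (hS t ht).2
        have h2 := N.mono (show t ≤ t' - X.pos t' by omega)
        have h3 := N.mono (show t' - X.pos t' ≤ t' by omega)
        omega
      intro t ht t' ht' heq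
      rw [Finset.mem_coe, Finset.mem_filter] at ht ht'
      rcases lt_trichotomy t t' with hlt | hlt | hlt
      · exact absurd heq (key t ht.1 t' ht'.1 ht'.2 hlt)
      · exact hlt
      · exact absurd heq.symm (key t' ht'.1 t ht.1 ht.2 hlt)
  · have hex : ∀ t, t ∈ S → N.lab (t - X.pos t) = N.lab t →
        ∃ u, t - X.pos t ≤ u ∧ u ≤ t ∧ X.Viol N u := by
      intro t ht hlab
      by_contra hcon
      push Not at hcon
      exact X.not_restart N H hX hg hR (hS t ht).1 hlab hcon (hS t ht).2
    choose! v hv using hex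
    refine Finset.card_le_card_of_injOn v (fun t ht => ?_) ?_
    · rw [Finset.mem_coe, Finset.mem_filter, not_not] at ht
      obtain ⟨h1, h2, h3⟩ := hv t ht.1 ht.2
      have := (hS t ht.1).1
      rw [Finset.mem_coe, Finset.mem_filter, Finset.mem_range]
      refine ⟨by omega, h3, ?_⟩
      rw [N.lab_eq_of_mem ht.2 h1 h2]
      exact Finset.mem_image_of_mem _ ht.1
    · have key : ∀ t ∈ S, N.lab (t - X.pos t) = N.lab t → ∀ t' ∈ S,
          N.lab (t' - X.pos t') = N.lab t' → t < t' → v t ≠ v t' := by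
        intro t ht h1 t' ht' h2 hlt heq
        have h3 := hv t ht h1
        have h4 := hv t' ht' h2
        have h5 := X.restart_succ_le_start hlt (hS t ht).2
        omega
      intro t ht t' ht' heq
      rw [Finset.mem_coe, Finset.mem_filter, not_not] at ht ht'
      rcases lt_trichotomy t t' with hlt | hlt | hlt
      · exact absurd heq (key t ht.1 ht.2 t' ht'.1 ht'.2 hlt)
      · exact hlt
      · exact absurd heq.symm (key t' ht'.1 ht'.2 t ht.1 ht.2 hlt)

/-- The first rounds before round `t` of blocks of order `n`. -/
def starts (n t : ℕ) : Finset ℕ := (Finset.range t).filter fun u => X.n u = n ∧ X.pos u = 0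

open Classical in
-- Between two restarts the orders strictly increase, so each order starts at most once per restart.
-- The extra term says whether order `n` has been reached since the latest restart.
theorem card_starts_succ_le (n t : ℕ) : (X.starts n (t + 1)).card
    ≤ ((Finset.range t).filter X.restart).card + if n ≤ X.n t then 1 else 0 := by
  induction t with
  | zero =>
    simp only [starts, zero_add, Finset.range_one, Finset.filter_singleton, X.n_zero, X.pos_zero]
    by_cases hn : n = 0
    · subst hn; simp
    · rw [if_neg (by simp; omega)]; simp
  | succ t ih =>
    rw [starts, Finset.range_add_one, Finset.filter_insert, ← starts, Finset.range_add_one (n := t),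
      Finset.filter_insert]
    have e1 : (t + 1) ∉ X.starts n (t + 1) := by simp [starts]
    have e2 : t ∉ (Finset.range t).filter X.restart := by simp
    by_cases hr : X.restart t
    · obtain ⟨h1, h2⟩ := X.of_restart t hr
      rw [if_pos hr, Finset.card_insert_of_notMem e2, h1, h2]
      split_ifs at ih ⊢ <;> first | omega | (rw [Finset.card_insert_of_notMem e1]; omega)
    rw [if_neg hr]
    by_cases hc : X.pos t + 1 = 2 ^ X.n t
    · obtain ⟨h1, h2⟩ := X.of_complete t hr hc
      rw [h1, h2]
      split_ifs at ih ⊢ <;> first | omega | (rw [Finset.card_insert_of_notMem e1]; omega)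
    · obtain ⟨h1, h2⟩ := X.of_continue t hr hc
      rw [h1, h2, if_neg (by simp)]
      exact ih

open Classical in
theorem card_starts_le (n t : ℕ) :
    (X.starts n t).card ≤ ((Finset.range t).filter X.restart).card + 1 := by
  cases t with
  | zero => simp [starts]
  | succ t =>
    refine (X.card_starts_succ_le n t).trans (Nat.add_le_add ?_ (by split_ifs <;> simp))
    exact Finset.card_le_card (Finset.filter_subset_filter _ (Finset.range_subset_range.2 (by omega)))

/-- Each block of order `n + 1` directly follows a completed block of `2 ^ n` rounds; the second
term keeps track of an unfinished block of order `n` during the induction. -/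
theorem two_pow_mul_card_starts_succ_le (n t : ℕ) :
    2 ^ n * (X.starts (n + 1) (t + 1)).card + (if X.n t = n then X.pos t else 0) ≤ t := by
  induction t with
  | zero =>
    simp [starts, Finset.filter_singleton, X.n_zero, X.pos_zero]
  | succ t ih =>
    rw [starts, Finset.range_add_one, Finset.filter_insert, ← starts]
    have e1 : (t + 1) ∉ X.starts (n + 1) (t + 1) := by simp [starts]
    by_cases hr : X.restart t
    · obtain ⟨h1, h2⟩ := X.of_restart t hr
      rw [h1, h2, if_neg (by omega)]
      split_ifs at ih ⊢ <;> omega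
    by_cases hc : X.pos t + 1 = 2 ^ X.n t
    · obtain ⟨h1, h2⟩ := X.of_complete t hr hc
      rw [h1, h2]
      by_cases hn : X.n t = n
      · rw [hn] at hc
        rw [if_pos hn] at ih
        rw [if_pos (by simp [hn]), Finset.card_insert_of_notMem e1, mul_add, mul_one]
        split_ifs <;> omega
      · rw [if_neg (by omega)]
        split_ifs at ih ⊢ <;> omega
    · obtain ⟨h1, h2⟩ := X.of_continue t hr hc
      rw [h1, h2, if_neg (by simp)]
      split_ifs at ih ⊢ <;> omega

theorem two_pow_mul_card_starts_le (n t : ℕ) : 2 ^ n * (X.starts n t).card ≤ 2 * t := by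
  cases n with
  | zero =>
    have : (X.starts 0 t).card ≤ t := (Finset.card_filter_le _ _).trans_eq (Finset.card_range t)
    omega
  | succ n =>
    cases t with
    | zero => simp [starts]
    | succ t =>
      have := X.two_pow_mul_card_starts_succ_le n t
      rw [pow_succ, mul_comm (2 ^ n) 2, mul_assoc]
      omega

open Classical in
/-- In each block at most one candidate instance of a given order is scheduled. -/
theorem card_cand_coin_le {h l : ℝ} (H : IsRate ρ rhat T h l) (hX : X.Typical N l)
    (hg : ∀ u, X.g u ∈ Set.Icc (0 : ℝ) 1) (hR : ∀ u, X.R u ∈ Set.Icc (0 : ℝ) 1)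
    (hf : ∀ u, f u ≤ 1) (hV : ((Finset.range T).filter (X.Viol N)).card ≤ 23) (n m : ℕ) :
    ((Finset.range T).filter fun u => X.Cand N n m u ∧ X.coin u m).card
      ≤ (X.starts n T).card := by
  refine Finset.card_le_card_of_injOn (fun u => u - X.pos u) (fun u hu => ?_) ?_
  · rw [Finset.mem_coe, Finset.mem_filter, Finset.mem_range] at hu
    have h1 := X.pos_of_mem_block (t := u) (u := u - X.pos u) le_rfl (Nat.sub_le _ _)
    have h2 := X.n_of_mem_block (t := u) (u := u - X.pos u) le_rfl (Nat.sub_le _ _)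
    simp only [starts, Finset.coe_filter, Finset.mem_range, Set.mem_ofPred_eq]
    exact ⟨by omega, h2.trans hu.2.1.1, by omega⟩
  · have key : ∀ s s', X.Cand N n m s → X.coin s m → X.Cand N n m s' → s < s' →
        s - X.pos s ≠ s' - X.pos s' := by
      intro s s' hs hcoin hs' hlt heq
      have hp := X.pos_le s
      have hp' := X.pos_le s'
      obtain ⟨c, hc⟩ := hs.2.2.1
      obtain ⟨c', hc'⟩ := hs'.2.2.1
      have h1 : 2 ^ m * c < 2 ^ m * c' := by omega
      have h2 : c < c' := lt_of_mul_lt_mul_left' h1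
      have h3 : 2 ^ m * (c + 1) ≤ 2 ^ m * c' := Nat.mul_le_mul_left _ h2
      rw [mul_add, mul_one] at h3
      have h4 : 1 ≤ 2 ^ m := Nat.one_le_two_pow
      -- Aligned starts are at least `2 ^ m` apart, so the earlier instance ends before `s'` and
      -- would force a restart inside the common block.
      have h5 := X.start_of_mem_block (t := s') (u := s + 2 ^ m - 1) (by omega) (by omega)
      refine X.not_restart_of_mem_block (t := s') (u := s + 2 ^ m - 1) (by omega) (by omega) ?_
      exact X.restart_of_cand N H hX hg hR hf hV hs hcoin (by omega)
    intro s hs s' hs' heq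
    rw [Finset.mem_coe, Finset.mem_filter] at hs hs'
    rcases lt_trichotomy s s' with hlt | hlt | hlt
    · exact absurd heq (key s s' hs.2.1 hs.2.2 hs'.2.1 hlt)
    · exact hlt
    · exact absurd heq.symm (key s' s hs'.2.1 hs'.2.2 hs.2.1 hlt)

end Run

/-! ### The regret of a typical run. -/

/-- The sum of `C` over the sizes of the sets of rounds with the same label. -/
noncomputable def fiberSum (lam : ℕ → ℕ) (T : ℕ) (C : ℕ → ℝ) : ℝ :=
  ∑ j ∈ (Finset.range T).image lam, C ((Finset.range T).filter fun t => lam t = j).card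

/-- Monotonicity of the labels makes every fiber an interval, so an estimate for intervals can be
applied fiber by fiber. -/
theorem sum_le_fiberSum {lam : ℕ → ℕ} (hlam : Monotone lam) {T : ℕ} {F C : ℕ → ℝ}
    (h : ∀ a e, a ≤ e → e < T → (∀ t < T, lam t = lam e ↔ a ≤ t ∧ t ≤ e) →
      ∑ t ∈ Finset.Icc a e, F t ≤ C (e + 1 - a)) :
    ∑ t ∈ Finset.range T, F t ≤ fiberSum lam T C := by
  rw [fiberSum, ← Finset.sum_fiberwise_of_maps_to
    (fun t ht => Finset.mem_image_of_mem lam ht)]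
  refine Finset.sum_le_sum fun j hj => ?_
  have hne : ((Finset.range T).filter fun t => lam t = j).Nonempty := by
    obtain ⟨t, ht, rfl⟩ := Finset.mem_image.1 hj
    exact ⟨t, Finset.mem_filter.2 ⟨ht, rfl⟩⟩
  set Q := (Finset.range T).filter fun t => lam t = j with hQ
  have ha := Finset.min'_mem Q hne
  have he := Finset.max'_mem Q hne
  set a := Q.min' hne
  set e := Q.max' hne
  rw [hQ, Finset.mem_filter, Finset.mem_range] at ha he
  have key : ∀ t < T, lam t = lam e ↔ a ≤ t ∧ t ≤ e := by
    intro t ht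
    constructor
    · intro h'
      have : t ∈ Q := Finset.mem_filter.2 ⟨Finset.mem_range.2 ht, h'.trans he.2⟩
      exact ⟨Finset.min'_le _ _ this, Finset.le_max' _ _ this⟩
    · rintro ⟨h1, h2⟩
      exact le_antisymm (hlam h2) ((he.2.trans ha.2.symm).trans_le (hlam h1))
  have hae : a ≤ e := Finset.min'_le_max' Q hne
  have hIcc : Q = Finset.Icc a e := by
    ext t
    rw [hQ, Finset.mem_filter, Finset.mem_range, Finset.mem_Icc]
    constructor
    · rintro ⟨h1, h2⟩
      exact (key t h1).1 (h2.trans he.2.symm)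
    · rintro ⟨h1, h2⟩
      have h3 : t < T := by omega
      exact ⟨h3, ((key t h3).2 ⟨h1, h2⟩).trans he.2⟩
  have := h a e hae he.1 key
  rwa [hIcc, Nat.card_Icc]

namespace Run

variable {f ρ rhat : ℕ → ℝ} {T L : ℕ} (X : Run rhat) (N : NearStationary f ρ T L)

/-- The number of the block of round `t`. -/
def block (t : ℕ) : ℕ := ((Finset.range (t + 1)).filter fun u => X.pos u = 0).card

theorem block_mono : Monotone X.block := fun s t h => Finset.card_le_card
  (Finset.filter_subset_filter _ (Finset.range_subset_range.2 (by omega)))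

theorem block_eq_iff {s t : ℕ} (h : s ≤ t) : X.block s = X.block t ↔ t - X.pos t ≤ s := by
  have hsub : (Finset.range (s + 1)).filter (fun u => X.pos u = 0)
      ⊆ (Finset.range (t + 1)).filter fun u => X.pos u = 0 :=
    Finset.filter_subset_filter _ (Finset.range_subset_range.2 (by omega))
  have hp := X.pos_le t
  constructor
  · intro h1
    by_contra h2
    have h3 := Finset.eq_of_subset_of_card_le hsub h1.ge
    have h4 := X.pos_of_mem_block (t := t) (u := t - X.pos t) le_rfl (by omega)
    have h5 : t - X.pos t ∈ (Finset.range (t + 1)).filter fun u => X.pos u = 0 := by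
      rw [Finset.mem_filter, Finset.mem_range]
      omega
    rw [← h3, Finset.mem_filter, Finset.mem_range] at h5
    omega
  · intro h1
    refine congrArg Finset.card (hsub.antisymm fun u hu => ?_)
    rw [Finset.mem_filter, Finset.mem_range] at hu ⊢
    refine ⟨?_, hu.2⟩
    by_contra h2
    have := X.pos_of_mem_block (t := t) (u := u) (by omega) (by omega)
    omega

/-- The number of the pair of a block and a piece. -/
def cell (t : ℕ) : ℕ := N.lab t + X.block t

theorem cell_mono : Monotone (X.cell N) := fun _ _ h => Nat.add_le_add (N.mono h) (X.block_mono h)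

theorem of_cell_eq {s t : ℕ} (h : s ≤ t) (h' : X.cell N s = X.cell N t) :
    N.lab s = N.lab t ∧ t - X.pos t ≤ s := by
  have h1 := N.mono h
  have h2 := X.block_mono h
  rw [← X.block_eq_iff h]
  simp only [cell] at h'
  omega

/-- The regret of the estimates in round `t` is large for an instance of order `m`. -/
def Bad (m t : ℕ) : Prop := m ≤ X.n t ∧ 12 * rhat (2 ^ m) ≤ N.base t - X.U t

/-- Test 2 did not fail before the last round `e` of the block, which bounds the sum up to `e - 1`
by `18 h l C`; the last round adds at most `1`, whether or not it ends in a restart. -/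
theorem sum_block_le {h l : ℝ} (H : IsRate ρ rhat T h l) (hl : 1 ≤ h * l)
    (hg : ∀ u, X.g u - X.R u ≤ 1) :
    ∑ t ∈ Finset.range T, (X.g t - X.R t)
      ≤ fiberSum X.block T fun j => 19 * h * l * (j * ρ j) := by
  refine sum_le_fiberSum X.block_mono fun a e hae heT key => ?_
  have hp := X.pos_le e
  have ha : a = e - X.pos e := by
    refine le_antisymm ((key _ (by omega)).1 ((X.block_eq_iff (by omega)).2 le_rfl)).1 ?_
    exact (X.block_eq_iff hae).1 ((key a (by omega)).2 ⟨le_rfl, hae⟩)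
  have hlen : e + 1 - a = X.pos e + 1 := by omega
  have hI : Finset.Icc a e = Finset.Ico a (e + 1) := by
    ext; simp only [Finset.mem_Icc, Finset.mem_Ico]; omega
  rw [hI, Finset.sum_Ico_succ_top hae, hlen]
  have hC := H.one_le_mul (i := X.pos e + 1) (by omega) (by omega)
  suffices hsuff : ∑ u ∈ Finset.Ico a e, (X.g u - X.R u)
      ≤ 18 * h * l * ((X.pos e + 1 : ℕ) * ρ (X.pos e + 1)) by
    nlinarith [hg e]
  rcases Nat.eq_zero_or_pos (X.pos e) with h0 | h0
  · rw [Finset.Ico_eq_empty (by omega), Finset.sum_empty]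
    nlinarith
  · have hnr := X.not_restart_of_mem_block (t := e) (u := e - 1) (by omega) (by omega)
    have hpe := X.pos_of_mem_block (t := e) (u := e - 1) (by omega) (by omega)
    rw [X.restart_iff, not_or, not_le] at hnr
    have h1 := hnr.2
    have h2 : e - 1 - X.pos (e - 1) = a := by omega
    have h3 : X.pos (e - 1) + 1 = X.pos e := by omega
    have h4 : e - 1 + 1 = e := by omega
    have h5 : (0 : ℝ) < (X.pos e : ℕ) := by exact_mod_cast h0
    rw [h2, h3, h4, one_div, inv_mul_lt_iff₀ h5, H.rhat_eq] at h1
    have h6 := H.mono (X.pos e) (X.pos e + 1) h0 (by omega) (by omega)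
    nlinarith

open Classical in
-- A dyadic decomposition of the gap to `U`: a term `24 rhat (2 ^ m)` for each bad order, plus the
-- rate of the whole block, which is unavoidable.
theorem sub_g_le {h l : ℝ} (H : IsRate ρ rhat T h l)
    (hg : ∀ u, X.g u ∈ Set.Icc (0 : ℝ) 1) (hf : ∀ u, f u ≤ 1) {t : ℕ} (ht : t < T) :
    f t - X.g t ≤ N.d (N.lab t) + 12 * rhat (2 ^ X.n t)
      + ∑ m ∈ Finset.range (X.n t + 1), if X.Bad N m t then 24 * rhat (2 ^ m) else 0 := by
  have h1 := N.sub_base_le ht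
  have h2 := X.U_le t t (Nat.sub_le _ _) le_rfl
  have hn := X.two_pow_le ht
  have hl := H.nine_le
  have hh := H.two_le_h
  have hhl : 0 ≤ 6 * h * l := by nlinarith
  have hr0 : ∀ m, m ≤ X.n t → 0 ≤ rhat (2 ^ m) := fun m hm => by
    rw [H.rhat_eq]
    exact mul_nonneg hhl (H.pos Nat.one_le_two_pow
      ((Nat.pow_le_pow_right (by norm_num) hm).trans hn)).le
  -- If order `k + 1` is not bad, the gap is below its threshold. If it is, its term pays for the
  -- bound at order `k`, because `C` nondecreasing gives `rhat (2 ^ k) ≤ 2 * rhat (2 ^ (k + 1))`.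
  have key : ∀ k, k ≤ X.n t → N.base t - X.U t ≤ 12 * rhat (2 ^ k)
      + ∑ m ∈ Finset.range (k + 1), if X.Bad N m t then 24 * rhat (2 ^ m) else 0 := by
    intro k
    induction k with
    | zero =>
      intro _
      rw [zero_add, Finset.sum_range_one]
      split_ifs with hb
      · have h3 : N.base t ≤ 1 := hf _
        have h4 : 0 ≤ X.U t := by
          obtain ⟨u, -, -, h5⟩ := X.exists_U t
          rw [h5]; exact (hg u).1
        have h5 := H.one_le_mul (i := 1) le_rfl (by omega)
        rw [Nat.cast_one, one_mul] at h5
        rw [pow_zero, H.rhat_eq]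
        nlinarith
      · rw [Bad, not_and, not_le] at hb
        linarith [hb (Nat.zero_le _)]
    | succ k ih =>
      intro hk
      rw [Finset.sum_range_succ]
      split_ifs with hb
      · have h3 := ih (by omega)
        have h4 : rhat (2 ^ k) ≤ 2 * rhat (2 ^ (k + 1)) := by
          have h5 := H.mono (2 ^ k) (2 ^ (k + 1)) Nat.one_le_two_pow
            (Nat.pow_le_pow_right (by norm_num) (by omega))
            ((Nat.pow_le_pow_right (by norm_num) hk).trans hn)
          rw [H.rhat_eq, H.rhat_eq]
          push_cast [pow_succ] at h5
          have h6 : (0 : ℝ) < 2 ^ k := by positivity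
          have h7 : ρ (2 ^ k) ≤ 2 * ρ (2 ^ (k + 1)) := by
            rw [pow_succ]
            refine le_of_mul_le_mul_left ?_ h6
            linarith
          nlinarith
        linarith [hr0 (k + 1) hk]
      · rw [Bad, not_and, not_le] at hb
        have h3 : 0 ≤ ∑ m ∈ Finset.range (k + 1), if X.Bad N m t then 24 * rhat (2 ^ m) else 0 := by
          refine Finset.sum_nonneg fun m hm => ?_
          rw [Finset.mem_range] at hm
          split_ifs
          · linarith [hr0 m (by omega)]
          · exact le_rfl
        linarith [hb hk]
  linarith [key _ le_rfl]

/-- The latest round up to `t` in which an instance of order `m` may start. -/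
def slot (m t : ℕ) : ℕ := t - X.pos t % 2 ^ m

open Classical in
/-- In the intersection of a block and a piece, most bad rounds belong to candidate instances. -/
theorem card_bad_le {a e m : ℕ} (heT : e < T) (hlab : N.lab a = N.lab e)
    (hb : e - X.pos e ≤ a) :
    ((Finset.Icc a e).filter fun t => X.Bad N m t ∧ ¬ X.Cand N (X.n t) m (X.slot m t)).card
      ≤ 2 * 2 ^ m := by
  set Q := (Finset.Icc a e).filter fun t => X.Bad N m t ∧ ¬ X.Cand N (X.n t) m (X.slot m t)
  rcases Q.eq_empty_or_nonempty with h0 | hne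
  · simp [h0]
  have ht0 := Finset.min'_mem Q hne
  set t0 := Q.min' hne
  -- Once a bad round `t0` has occurred, every aligned start after it in the cell already sees the
  -- gap. Its window can only fail to fit near the end of the cell, so exceptions lie within `2 ^ m`
  -- of either end.
  have hsub : Q ⊆ Finset.Ico t0 (t0 + 2 ^ m) ∪ Finset.Ico (e + 1 - 2 ^ m) (e + 1) := by
    intro t ht
    have ht0t : t0 ≤ t := Finset.min'_le _ _ ht
    rw [Finset.mem_filter, Finset.mem_Icc] at ht ht0
    obtain ⟨⟨hat, hte⟩, hbad, hnc⟩ := ht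
    by_contra hcon
    rw [Finset.mem_union, Finset.mem_Ico, Finset.mem_Ico] at hcon
    have h2m : 1 ≤ 2 ^ m := Nat.one_le_two_pow
    have hmod : X.pos t % 2 ^ m < 2 ^ m := Nat.mod_lt _ h2m
    have hmod2 := Nat.mod_le (X.pos t) (2 ^ m)
    have hbt : t - X.pos t ≤ a := by rw [X.start_of_mem_block (hb.trans hat) hte]; exact hb
    set s := X.slot m t with hs
    rw [slot] at hs
    have hst : s ≤ t := Nat.sub_le _ _
    have ht0s : t0 < s := by omega
    have hps := X.pos_of_mem_block (t := t) (u := s) (by omega) hst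
    have hpt := X.pos_le t
    have hns := X.n_of_mem_block (t := t) (u := s) (by omega) hst
    have hls : ∀ u, a ≤ u → u ≤ e → N.lab u = N.lab e := fun u h1 h2 => N.lab_eq_of_mem hlab h1 h2
    apply hnc
    refine ⟨hns, hbad.1, ?_, by omega, by omega, ?_, ?_⟩
    · have : X.pos s = X.pos t - X.pos t % 2 ^ m := by omega
      rw [this]
      exact Nat.dvd_sub_mod _
    · rw [hls s (by omega) (by omega), hls (s + 2 ^ m - 1) (by omega) (by omega)]
    · have h1 := ht0.2.1.2
      have h2 := X.U_anti (s := t0) (t := s - 1) (by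
        rw [X.start_of_mem_block (t := t) (u := s - 1) (by omega) (by omega)]; omega) (by omega)
      rw [N.base_congr ((hls s (by omega) (by omega)).trans (hls t0 ht0.1.1 ht0.1.2).symm)]
      linarith
  refine (Finset.card_le_card hsub).trans ((Finset.card_union_le _ _).trans ?_)
  rw [Nat.card_Ico, Nat.card_Ico]
  omega

open Classical in
-- In a cell with `j` rounds there are at most `min j (2 * 2 ^ m)` exceptional rounds, each of cost
-- proportional to `ρ (2 ^ m)`. Either `ρ (2 ^ m) ≤ ρ j` or `C (2 ^ m) ≤ C j` turns this into `C j`.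
theorem sum_bad_le {h l : ℝ} (H : IsRate ρ rhat T h l) (m : ℕ) :
    ∑ t ∈ Finset.range T, (if X.Bad N m t ∧ ¬ X.Cand N (X.n t) m (X.slot m t) then
      24 * rhat (2 ^ m) else 0) ≤ fiberSum (X.cell N) T fun j => 288 * h * l * (j * ρ j) := by
  refine sum_le_fiberSum (X.cell_mono N) fun a e hae heT key => ?_
  obtain ⟨hlab, hb⟩ := X.of_cell_eq N hae ((key a (by omega)).2 ⟨le_rfl, hae⟩)
  have hcard := X.card_bad_le N (m := m) heT hlab hb
  have hl := H.nine_le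
  have hh := H.two_le_h
  have hhl : 0 ≤ h * l := by nlinarith
  set j := e + 1 - a
  have hj1 : 1 ≤ j := by omega
  have hjT : j ≤ T := by omega
  have hC := H.one_le_mul hj1 hjT
  rw [← Finset.sum_filter, Finset.sum_const, nsmul_eq_mul]
  set Q := (Finset.Icc a e).filter fun t => X.Bad N m t ∧ ¬ X.Cand N (X.n t) m (X.slot m t) with hQ
  rcases Q.eq_empty_or_nonempty with h0 | ⟨t, ht⟩
  · rw [h0, Finset.card_empty, Nat.cast_zero, zero_mul]
    nlinarith
  rw [hQ, Finset.mem_filter, Finset.mem_Icc] at ht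
  have hmT : 2 ^ m ≤ T :=
    (Nat.pow_le_pow_right (by norm_num) ht.2.1.1).trans (X.two_pow_le (by omega))
  have hρm := H.pos (i := 2 ^ m) Nat.one_le_two_pow hmT
  have hQj : Q.card ≤ j := by
    refine (Finset.card_filter_le _ _).trans ?_
    rw [Nat.card_Icc]
  have hmain : (Q.card : ℝ) * ρ (2 ^ m) ≤ 2 * (j * ρ j) := by
    rcases le_total j (2 ^ m) with hjm | hjm
    · have h1 : (Q.card : ℝ) ≤ j := by exact_mod_cast hQj
      have h2 := H.anti _ _ hj1 hjm hmT
      have h3 : (Q.card : ℝ) * ρ (2 ^ m) ≤ j * ρ j := by gcongr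
      linarith
    · have h1 : (Q.card : ℝ) ≤ 2 * (2 ^ m : ℕ) := by exact_mod_cast hcard
      have h2 := H.mono _ _ Nat.one_le_two_pow hjm hjT
      have h3 : (Q.card : ℝ) * ρ (2 ^ m) ≤ 2 * (2 ^ m : ℕ) * ρ (2 ^ m) := by gcongr
      linarith
  rw [H.rhat_eq]
  nlinarith

open Classical in
theorem card_cand_window_le (n m : ℕ) :
    ((Finset.range T).filter fun t => X.n t = n ∧ X.Cand N n m (X.slot m t)).card
      ≤ 2 ^ m * ((Finset.range T).filter fun s => X.Cand N n m s).card := by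
  rw [mul_comm]
  have hmaps : ∀ t ∈ (Finset.range T).filter fun t => X.n t = n ∧ X.Cand N n m (X.slot m t),
      X.slot m t ∈ (Finset.range T).filter fun s => X.Cand N n m s := by
    intro t ht
    rw [Finset.mem_filter, Finset.mem_range] at ht ⊢
    exact ⟨(Nat.sub_le _ _).trans_lt ht.1, ht.2.2⟩
  rw [Finset.card_eq_sum_card_fiberwise hmaps, ← smul_eq_mul]
  refine Finset.sum_le_card_nsmul _ _ _ fun s _ => ?_
  have : ((Finset.filter (fun t => X.n t = n ∧ X.Cand N n m (X.slot m t)) (Finset.range T)).filter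
      fun t => X.slot m t = s) ⊆ Finset.Ico s (s + 2 ^ m) := by
    intro t ht
    rw [Finset.mem_filter] at ht
    have h1 := ht.2
    have h2 := Nat.mod_lt (X.pos t) (Nat.one_le_two_pow (n := m))
    have h3 := Nat.mod_le (X.pos t) (2 ^ m)
    have h4 := X.pos_le t
    rw [slot] at h1
    rw [Finset.mem_Ico]
    omega
  refine (Finset.card_le_card this).trans ?_
  rw [Nat.card_Ico, Nat.add_sub_cancel_left]

open Classical in
/-- The regret in a typical run. -/
theorem regret_le {h l : ℝ} {K : ℕ} (H : IsRate ρ rhat T h l) (hX : X.Typical N l)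
    (hg : ∀ u, X.g u ∈ Set.Icc (0 : ℝ) 1) (hR : ∀ u, X.R u ∈ Set.Icc (0 : ℝ) 1)
    (hf : ∀ u, f u ≤ 1) (hV : ((Finset.range T).filter (X.Viol N)).card ≤ 23)
    (hK : ∀ n, 2 ^ n ≤ T ↔ n < K) (hKh : (K : ℝ) ≤ h) :
    ∑ t ∈ Finset.range T, (f t - X.R t)
      ≤ fiberSum (X.cell N) T (fun j => 400 * h ^ 2 * l * (j * ρ j))
        + fiberSum X.block T (fun j => 19 * h * l * (j * ρ j))
        + ∑ n ∈ Finset.range K, ∑ m ∈ Finset.range (n + 1), 288 * h * l *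
          ((2 ^ m : ℕ) * ρ (2 ^ m) * ρ (2 ^ m) / ρ (2 ^ n)) * ((X.starts n T).card + 4 * l) := by
  have hl := H.nine_le
  have hh := H.two_le_h
  have hhl : 18 ≤ h * l := by nlinarith
  have hmT : ∀ n < K, ∀ m ≤ n, 2 ^ m ≤ T := fun n hn m hm =>
    (Nat.pow_le_pow_right (by norm_num) hm).trans ((hK n).2 hn)
  have h1 : ∀ t ∈ Finset.range T, f t - X.R t ≤
      (X.g t - X.R t) + (N.d (N.lab t) + 12 * rhat (2 ^ X.n t))
      + ∑ m ∈ Finset.range K,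
        (if X.Bad N m t ∧ ¬ X.Cand N (X.n t) m (X.slot m t) then 24 * rhat (2 ^ m) else 0)
      + ∑ n ∈ Finset.range K, ∑ m ∈ Finset.range (n + 1),
        (if X.n t = n ∧ X.Cand N n m (X.slot m t) then 24 * rhat (2 ^ m) else 0) := by
    intro t ht
    rw [Finset.mem_range] at ht
    have hnK : X.n t < K := (hK _).1 (X.two_pow_le ht)
    have hr0 : ∀ m, m < K → 0 ≤ rhat (2 ^ m) := fun m hm => by
      rw [H.rhat_eq]
      exact mul_nonneg (by nlinarith) (H.pos Nat.one_le_two_pow ((hK m).2 hm)).le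
    have h2 := X.sub_g_le N H hg hf ht
    have h3 : ∑ m ∈ Finset.range (X.n t + 1), (if X.Bad N m t then 24 * rhat (2 ^ m) else 0)
        ≤ ∑ m ∈ Finset.range (X.n t + 1), ((if X.Bad N m t ∧ ¬ X.Cand N (X.n t) m (X.slot m t) then
          24 * rhat (2 ^ m) else 0) + if X.n t = X.n t ∧ X.Cand N (X.n t) m (X.slot m t) then
          24 * rhat (2 ^ m) else 0) := by
      refine Finset.sum_le_sum fun m hm => ?_
      have := hr0 m (by rw [Finset.mem_range] at hm; omega)
      by_cases hb : X.Bad N m t <;> by_cases hc : X.Cand N (X.n t) m (X.slot m t) <;>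
        simp [hb, hc, this]
    rw [Finset.sum_add_distrib] at h3
    have h4 : ∑ m ∈ Finset.range (X.n t + 1), (if X.Bad N m t ∧ ¬ X.Cand N (X.n t) m (X.slot m t)
        then 24 * rhat (2 ^ m) else 0) ≤ ∑ m ∈ Finset.range K,
        (if X.Bad N m t ∧ ¬ X.Cand N (X.n t) m (X.slot m t) then 24 * rhat (2 ^ m) else 0) := by
      refine Finset.sum_le_sum_of_subset_of_nonneg (Finset.range_subset_range.2 hnK)
        fun m hm _ => ?_
      have := hr0 m (Finset.mem_range.1 hm)
      split_ifs <;> linarith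
    have h5 := Finset.single_le_sum (s := Finset.range K) (f := fun n =>
      ∑ m ∈ Finset.range (n + 1),
        (if X.n t = n ∧ X.Cand N n m (X.slot m t) then 24 * rhat (2 ^ m) else 0))
      (fun n hn => Finset.sum_nonneg fun m hm => by
        rw [Finset.mem_range] at hn hm
        have := hr0 m (by omega)
        split_ifs <;> linarith) (Finset.mem_range.2 hnK)
    simp only [true_and] at h3 h5
    linarith
  refine (Finset.sum_le_sum h1).trans ?_
  rw [Finset.sum_add_distrib, Finset.sum_add_distrib, Finset.sum_add_distrib]
  have hB := X.sum_block_le H (by linarith) fun u => by linarith [(hg u).2, (hR u).1]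
  have hD : ∑ t ∈ Finset.range T, (N.d (N.lab t) + 12 * rhat (2 ^ X.n t))
      ≤ fiberSum (X.cell N) T fun j => (1 + 72 * h * l) * (j * ρ j) := by
    refine sum_le_fiberSum (X.cell_mono N) fun a e hae heT key => ?_
    obtain ⟨hlab, hb⟩ := X.of_cell_eq N hae ((key a (by omega)).2 ⟨le_rfl, hae⟩)
    have hpe := X.pos_lt e
    have h3 := Finset.sum_le_card_nsmul (Finset.Icc a e)
      (fun t => N.d (N.lab t) + 12 * rhat (2 ^ X.n t))
      ((1 + 72 * h * l) * ρ (e + 1 - a)) fun t ht => ?_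
    · rw [Nat.card_Icc, nsmul_eq_mul] at h3
      linarith
    rw [Finset.mem_Icc] at ht
    have h4 := N.d_le a e hae heT hlab
    rw [N.lab_eq_of_mem hlab ht.1 ht.2, ← hlab, X.n_of_mem_block (hb.trans ht.1) ht.2, H.rhat_eq]
    have hpl := X.pos_le e
    have h5 := H.anti (e + 1 - a) (2 ^ X.n e) (by omega) (by omega) (X.two_pow_le heT)
    nlinarith
  have hM : ∑ t ∈ Finset.range T, ∑ m ∈ Finset.range K,
        (if X.Bad N m t ∧ ¬ X.Cand N (X.n t) m (X.slot m t) then 24 * rhat (2 ^ m) else 0)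
      ≤ fiberSum (X.cell N) T fun j => 288 * h ^ 2 * l * (j * ρ j) := by
    rw [Finset.sum_comm]
    refine (Finset.sum_le_card_nsmul _ _ _ fun m _ => X.sum_bad_le N H m).trans ?_
    rw [Finset.card_range, nsmul_eq_mul, fiberSum, fiberSum, Finset.mul_sum]
    refine Finset.sum_le_sum fun j hj => ?_
    obtain ⟨t, ht, rfl⟩ := Finset.mem_image.1 hj
    have hc1 : 1 ≤ ((Finset.range T).filter fun u => X.cell N u = X.cell N t).card :=
      Finset.card_pos.2 ⟨t, Finset.mem_filter.2 ⟨ht, rfl⟩⟩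
    have hc2 : ((Finset.range T).filter fun u => X.cell N u = X.cell N t).card ≤ T :=
      (Finset.card_filter_le _ _).trans_eq (Finset.card_range T)
    have hC := H.one_le_mul hc1 hc2
    set c := ((Finset.range T).filter fun u => X.cell N u = X.cell N t).card
    calc (K : ℝ) * (288 * h * l * (c * ρ c)) ≤ h * (288 * h * l * (c * ρ c)) :=
          mul_le_mul_of_nonneg_right hKh (mul_nonneg (by nlinarith) (by linarith))
      _ = _ := by ring
  have hW : ∑ t ∈ Finset.range T, ∑ n ∈ Finset.range K, ∑ m ∈ Finset.range (n + 1),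
        (if X.n t = n ∧ X.Cand N n m (X.slot m t) then 24 * rhat (2 ^ m) else 0)
      ≤ ∑ n ∈ Finset.range K, ∑ m ∈ Finset.range (n + 1), 288 * h * l *
          ((2 ^ m : ℕ) * ρ (2 ^ m) * ρ (2 ^ m) / ρ (2 ^ n)) * ((X.starts n T).card + 4 * l) := by
    rw [Finset.sum_comm]
    refine Finset.sum_le_sum fun n hn => ?_
    rw [Finset.sum_comm]
    refine Finset.sum_le_sum fun m hm => ?_
    rw [Finset.mem_range] at hn hm
    have hnT : 2 ^ n ≤ T := (hK n).2 hn
    rw [← Finset.sum_filter, Finset.sum_const, nsmul_eq_mul, H.rhat_eq]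
    have c1 := X.card_cand_window_le N (T := T) n m
    have c2 := hX.cand n m (by omega) hnT
    have c3 := X.card_cand_coin_le N H hX hg hR hf hV n m
    have hρn := H.pos (i := 2 ^ n) Nat.one_le_two_pow hnT
    have hρm := H.pos (i := 2 ^ m) Nat.one_le_two_pow (hmT n hn m (by omega))
    set c : ℝ := (((Finset.range T).filter fun s => X.Cand N n m s).card : ℝ)
    have c1' : (((Finset.range T).filter
        fun t => X.n t = n ∧ X.Cand N n m (X.slot m t)).card : ℝ) ≤ (2 ^ m : ℕ) * c := by
      simp only [c]
      exact_mod_cast c1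
    have c3' : (((Finset.range T).filter
        fun u => X.Cand N n m u ∧ X.coin u m).card : ℝ) ≤ (X.starts n T).card := by
      exact_mod_cast c3
    -- Few candidates are scheduled and coins succeed often enough, so there are few candidates in
    -- all. This is where the exploration probability is used.
    have c4 : ρ (2 ^ n) * c ≤ ρ (2 ^ m) * (2 * ((X.starts n T).card + 4 * l)) := by
      have : ρ (2 ^ n) / ρ (2 ^ m) * c ≤ 2 * ((X.starts n T).card + 4 * l) := by linarith
      rwa [div_mul_eq_mul_div, div_le_iff₀ hρm, mul_comm _ (ρ (2 ^ m))] at this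
    have c5 : c ≤ ρ (2 ^ m) * (2 * ((X.starts n T).card + 4 * l)) / ρ (2 ^ n) := by
      rw [le_div_iff₀ hρn, mul_comm]; exact c4
    calc _ ≤ ((2 ^ m : ℕ) * c) * (24 * (6 * h * l * ρ (2 ^ m))) :=
          mul_le_mul_of_nonneg_right c1' (by
            have : 0 ≤ h * l * ρ (2 ^ m) := mul_nonneg (by linarith) hρm.le
            linarith)
      _ ≤ ((2 ^ m : ℕ) * (ρ (2 ^ m) * (2 * ((X.starts n T).card + 4 * l)) / ρ (2 ^ n)))
          * (24 * (6 * h * l * ρ (2 ^ m))) := by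
          refine mul_le_mul_of_nonneg_right (mul_le_mul_of_nonneg_left c5 (Nat.cast_nonneg _)) (by
            have : 0 ≤ h * l * ρ (2 ^ m) := mul_nonneg (by linarith) hρm.le
            linarith)
      _ = _ := by ring
  have hsum : fiberSum (X.cell N) T (fun j => (1 + 72 * h * l) * (j * ρ j))
      + fiberSum (X.cell N) T (fun j => 288 * h ^ 2 * l * (j * ρ j))
      ≤ fiberSum (X.cell N) T (fun j => 400 * h ^ 2 * l * (j * ρ j)) := by
    rw [fiberSum, fiberSum, fiberSum, ← Finset.sum_add_distrib]
    refine Finset.sum_le_sum fun j hj => ?_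
    obtain ⟨t, ht, rfl⟩ := Finset.mem_image.1 hj
    have hc1 : 1 ≤ ((Finset.range T).filter fun u => X.cell N u = X.cell N t).card :=
      Finset.card_pos.2 ⟨t, Finset.mem_filter.2 ⟨ht, rfl⟩⟩
    have hc2 : ((Finset.range T).filter fun u => X.cell N u = X.cell N t).card ≤ T :=
      (Finset.card_filter_le _ _).trans_eq (Finset.card_range T)
    have hC := H.one_le_mul hc1 hc2
    rw [← add_mul]
    refine mul_le_mul_of_nonneg_right ?_ (by linarith)
    have : 2 * (h * l) ≤ h * (h * l) := mul_le_mul_of_nonneg_right hh (by linarith)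
    linarith
  linarith

end Run

/-! ### Analytic estimates for power rates. -/

/-- The rate `(c₁ t ^ p + c₂) / t` capped at `1`. -/
noncomputable def cappedRate (c₁ c₂ p : ℝ) (t : ℕ) : ℝ := min (c₁ * (t : ℝ) ^ p + c₂) t / t

/-- The regret bound for `x` rounds of a stationary environment. -/
noncomputable def baseBound (c₁ c₂ p x : ℝ) : ℝ := c₁ * x ^ p + c₂ / c₁ * x ^ (1 - p)

/-- The regret bound for `N` pieces of a horizon of `T` rounds. -/
noncomputable def piecesBound (c₁ c₂ p T N : ℝ) : ℝ :=
  c₁ * N ^ (1 - p) * T ^ p + c₂ / c₁ * N ^ p * T ^ (1 - p)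

namespace Real

/-- Jensen's inequality for the concave power, up to a factor `2`: with the mean size `y = T / N`,
small terms are at most `y ^ q` and large ones at most `y ^ (q - 1) * x i`. -/
theorem sum_rpow_le_of_card_le {ι : Type*} (s : Finset ι) (x : ι → ℝ) {q N T : ℝ} (hq0 : 0 < q)
    (hq1 : q < 1) (hN : 0 < N) (hT : 0 < T) (hx : ∀ i ∈ s, 0 ≤ x i) (hs : (s.card : ℝ) ≤ N)
    (hsum : ∑ i ∈ s, x i ≤ T) : ∑ i ∈ s, x i ^ q ≤ 2 * (N ^ (1 - q) * T ^ q) := by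
  set y := T / N with hy
  have hy0 : 0 < y := by positivity
  have h1 : ∀ i ∈ s, x i ^ q ≤ y ^ q + y ^ (q - 1) * x i := by
    intro i hi
    have h0 := hx i hi
    rcases le_or_gt (x i) y with h | h
    · have : x i ^ q ≤ y ^ q := Real.rpow_le_rpow h0 h hq0.le
      have : 0 ≤ y ^ (q - 1) * x i := by positivity
      linarith
    · have hxi : 0 < x i := hy0.trans h
      have e : x i ^ q = x i ^ (q - 1) * x i := by
        rw [← Real.rpow_add_one hxi.ne']; congr 1; ring
      have : x i ^ (q - 1) ≤ y ^ (q - 1) := Real.rpow_le_rpow_of_nonpos hy0 h.le (by linarith)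
      have h2 : 0 ≤ y ^ q := by positivity
      nlinarith
  refine (Finset.sum_le_sum h1).trans ?_
  rw [Finset.sum_add_distrib, Finset.sum_const, nsmul_eq_mul, ← Finset.mul_sum]
  have e1 : N * y ^ q = N ^ (1 - q) * T ^ q := by
    rw [hy, Real.div_rpow hT.le hN.le, Real.rpow_sub hN, Real.rpow_one]; field_simp
  have e2 : y ^ (q - 1) * T = N ^ (1 - q) * T ^ q := by
    rw [hy, Real.div_rpow hT.le hN.le, Real.rpow_sub hN, Real.rpow_sub hT, Real.rpow_sub hN,
      Real.rpow_one, Real.rpow_one]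
    field_simp
  have h3 : (s.card : ℝ) * y ^ q ≤ N * y ^ q := by gcongr
  have h4 : y ^ (q - 1) * ∑ i ∈ s, x i ≤ y ^ (q - 1) * T := by gcongr
  linarith

/-- Write `N * x ^ q = N ^ (1 - q) * (N * x) ^ q`: both the number of blocks and their total length
enter. -/
theorem mul_rpow_le_of_mul_le {x N E T q : ℝ} (hx : 0 ≤ x) (hN : 0 ≤ N) (hNE : N ≤ E) (hT : 0 ≤ T)
    (hNx : N * x ≤ 2 * T) (hq0 : 0 < q) (hq1 : q < 1) :
    N * x ^ q ≤ 2 * (E ^ (1 - q) * T ^ q) := by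
  rcases hN.eq_or_lt with rfl | hN0
  · rw [zero_mul]; positivity
  have e : N * x ^ q = N ^ (1 - q) * (N * x) ^ q := by
    rw [Real.mul_rpow hN hx, ← mul_assoc, ← Real.rpow_add hN0]
    norm_num
  have h2 : (2 : ℝ) ^ q ≤ 2 := by
    calc (2 : ℝ) ^ q ≤ 2 ^ (1 : ℝ) := Real.rpow_le_rpow_of_exponent_le (by norm_num) hq1.le
      _ = 2 := Real.rpow_one 2
  have hE : 0 ≤ E := hN.trans hNE
  calc N * x ^ q = N ^ (1 - q) * (N * x) ^ q := e
    _ ≤ E ^ (1 - q) * (2 * T) ^ q := by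
        have : 0 ≤ 1 - q := by linarith
        gcongr
    _ = 2 ^ q * (E ^ (1 - q) * T ^ q) := by rw [Real.mul_rpow (by norm_num) hT]; ring
    _ ≤ 2 * (E ^ (1 - q) * T ^ q) := by
        have : 0 ≤ E ^ (1 - q) * T ^ q := by positivity
        gcongr

end Real

section Rate

variable {c₁ c₂ p : ℝ} (h1 : 0 < c₁) (h2 : 0 < c₂) (hp : 1 / 2 ≤ p) (hp1 : p < 1)

theorem mul_cappedRate {t : ℕ} (ht : 1 ≤ t) :
    t * cappedRate c₁ c₂ p t = min (c₁ * (t : ℝ) ^ p + c₂) t := by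
  have : (t : ℝ) ≠ 0 := by positivity
  rw [cappedRate]
  field_simp

include h1 h2

theorem cappedRate_pos {t : ℕ} (ht : 1 ≤ t) : 0 < cappedRate c₁ c₂ p t := by
  have : (0 : ℝ) < t := by exact_mod_cast ht
  rw [cappedRate]
  positivity

theorem baseBound_nonneg {x : ℝ} (hx : 0 ≤ x) : 0 ≤ baseBound c₁ c₂ p x := by
  rw [baseBound]; positivity

theorem piecesBound_nonneg {T N : ℝ} (hT : 0 ≤ T) (hN : 0 ≤ N) : 0 ≤ piecesBound c₁ c₂ p T N := by
  rw [piecesBound]; positivity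

/-- The cap turns the constant `c₂` into the lower-order term: either `c₁ ≤ t ^ (1 - p)`, and `c₂`
is at most `(c₂ / c₁) * t ^ (1 - p)`, or the trivial bound `t` is at most `c₁ * t ^ p`. -/
theorem mul_cappedRate_le {t : ℕ} (ht : 1 ≤ t) :
    t * cappedRate c₁ c₂ p t ≤ 2 * baseBound c₁ c₂ p t := by
  have ht0 : (0 : ℝ) < t := by exact_mod_cast ht
  rw [mul_cappedRate ht]
  have hb : 0 ≤ c₁ * (t : ℝ) ^ p := by positivity
  have hb2 : 0 ≤ c₂ / c₁ * (t : ℝ) ^ (1 - p) := by positivity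
  rcases le_total c₁ ((t : ℝ) ^ (1 - p)) with h | h
  · refine (min_le_left _ _).trans ?_
    have : c₂ ≤ c₂ / c₁ * (t : ℝ) ^ (1 - p) := by
      calc c₂ = c₂ / c₁ * c₁ := by field_simp
        _ ≤ _ := by gcongr
    rw [baseBound]
    linarith
  · refine (min_le_right _ _).trans ?_
    have : (t : ℝ) ≤ c₁ * (t : ℝ) ^ p := by
      calc (t : ℝ) = (t : ℝ) ^ (1 - p) * (t : ℝ) ^ p := by
            rw [← Real.rpow_add ht0]; norm_num
        _ ≤ _ := by gcongr
    rw [baseBound]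
    linarith

include hp hp1

theorem baseBound_mono {x y : ℝ} (hx : 0 ≤ x) (hxy : x ≤ y) :
    baseBound c₁ c₂ p x ≤ baseBound c₁ c₂ p y := by
  have h3 : 0 ≤ p := by linarith
  have h4 : 0 ≤ 1 - p := by linarith
  rw [baseBound, baseBound]
  gcongr

theorem piecesBound_mono {T x y : ℝ} (hT : 0 ≤ T) (hx : 0 ≤ x) (hxy : x ≤ y) :
    piecesBound c₁ c₂ p T x ≤ piecesBound c₁ c₂ p T y := by
  have h3 : 0 ≤ p := by linarith
  have h4 : 0 ≤ 1 - p := by linarith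
  rw [piecesBound, piecesBound]
  gcongr

theorem piecesBound_mul_le {T κ x : ℝ} (hT : 0 ≤ T) (hκ : 1 ≤ κ) (hx : 0 ≤ x) :
    piecesBound c₁ c₂ p T (κ * x) ≤ κ * piecesBound c₁ c₂ p T x := by
  have hκ0 : 0 ≤ κ := by linarith
  have h3 : ∀ q : ℝ, q ≤ 1 → κ ^ q ≤ κ := fun q hq => by
    simpa using Real.rpow_le_rpow_of_exponent_le hκ hq
  have h4 : c₁ * x ^ (1 - p) * T ^ p * κ ^ (1 - p) ≤ c₁ * x ^ (1 - p) * T ^ p * κ :=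
    mul_le_mul_of_nonneg_left (h3 _ (by linarith)) (by positivity)
  have h5 : c₂ / c₁ * x ^ p * T ^ (1 - p) * κ ^ p ≤ c₂ / c₁ * x ^ p * T ^ (1 - p) * κ :=
    mul_le_mul_of_nonneg_left (h3 _ hp1.le) (by positivity)
  rw [piecesBound, piecesBound, Real.mul_rpow hκ0 hx, Real.mul_rpow hκ0 hx]
  linarith

theorem piecesBound_add_le {T x y : ℝ} (hT : 0 ≤ T) (hx : 0 ≤ x) (hy : 0 ≤ y) :
    piecesBound c₁ c₂ p T (x + y) ≤ piecesBound c₁ c₂ p T x + piecesBound c₁ c₂ p T y := by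
  have h3 := Real.rpow_add_le_add_rpow hx hy (p := p) (by linarith) hp1.le
  have h4 := Real.rpow_add_le_add_rpow hx hy (p := 1 - p) (by linarith) (by linarith)
  have h5 : 0 ≤ c₁ * T ^ p := by positivity
  have h6 : 0 ≤ c₂ / c₁ * T ^ (1 - p) := by positivity
  rw [piecesBound, piecesBound, piecesBound]
  nlinarith

/-- When the cap is inactive at `n`, `m * ρ m ^ 2` is at most twice `c₁ ^ 2 * m ^ (2 * p - 1) + c₂`.
This is increasing in `m` exactly because `p ≥ 1 / 2`, and at `m = n` it factors as `baseBound`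
times `c₁ * n ^ p / n`, a lower bound for the rate. -/
theorem mul_cappedRate_mul_le {m n : ℕ} (hm : 1 ≤ m) (hmn : m ≤ n) :
    m * cappedRate c₁ c₂ p m * cappedRate c₁ c₂ p m / cappedRate c₁ c₂ p n
      ≤ 2 * baseBound c₁ c₂ p n := by
  have hn : 1 ≤ n := hm.trans hmn
  have hm0 : (0 : ℝ) < m := by exact_mod_cast hm
  have hn0 : (0 : ℝ) < n := by exact_mod_cast hn
  have hmn' : (m : ℝ) ≤ n := by exact_mod_cast hmn
  have hρm := cappedRate_pos (p := p) h1 h2 hm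
  have hρn := cappedRate_pos (p := p) h1 h2 hn
  rw [div_le_iff₀ hρn]
  have hle1 : cappedRate c₁ c₂ p m ≤ 1 := by
    rw [cappedRate, div_le_one hm0]; exact min_le_right _ _
  rcases le_total (n : ℝ) (c₁ * (n : ℝ) ^ p + c₂) with h | h
  · have e : cappedRate c₁ c₂ p n = 1 := by rw [cappedRate, min_eq_right h, div_self hn0.ne']
    have h3 := mul_cappedRate_le (p := p) h1 h2 hm
    have h4 := baseBound_mono h1 h2 hp hp1 hm0.le hmn'
    have h5 : m * cappedRate c₁ c₂ p m * cappedRate c₁ c₂ p m ≤ m * cappedRate c₁ c₂ p m :=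
      mul_le_of_le_one_right (by positivity) hle1
    rw [e]
    linarith
  · have e : cappedRate c₁ c₂ p n = (c₁ * (n : ℝ) ^ p + c₂) / n := by rw [cappedRate, min_eq_left h]
    have h3 : c₁ ^ 2 * (n : ℝ) ^ (2 * p - 1) + c₂
        ≤ baseBound c₁ c₂ p n * cappedRate c₁ c₂ p n := by
      have e1 : (n : ℝ) ^ (2 * p - 1) = (n : ℝ) ^ p * (n : ℝ) ^ p / n := by
        rw [Real.rpow_sub hn0, two_mul, Real.rpow_add hn0, Real.rpow_one]
      have e2 : (n : ℝ) ^ (1 - p) * (n : ℝ) ^ p = n := by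
        rw [← Real.rpow_add hn0]; norm_num
      have e3 : c₁ ^ 2 * (n : ℝ) ^ (2 * p - 1) + c₂
          = baseBound c₁ c₂ p n * (c₁ * (n : ℝ) ^ p / n) := by
        rw [e1, baseBound]
        field_simp
        linear_combination -(c₂) * e2
      rw [e3, e]
      have := baseBound_nonneg (p := p) h1 h2 hn0.le
      gcongr
      linarith
    have h4 : m * cappedRate c₁ c₂ p m * cappedRate c₁ c₂ p m
        ≤ 2 * (c₁ ^ 2 * (m : ℝ) ^ (2 * p - 1) + c₂) := by
      have e1 : (m : ℝ) ^ (2 * p - 1) = (m : ℝ) ^ p * (m : ℝ) ^ p / m := by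
        rw [Real.rpow_sub hm0, two_mul, Real.rpow_add hm0, Real.rpow_one]
      rw [mul_cappedRate hm]
      have hx0 : 0 < c₁ * (m : ℝ) ^ p := by positivity
      set x := c₁ * (m : ℝ) ^ p with hx
      have e2 : c₁ ^ 2 * (m : ℝ) ^ (2 * p - 1) = x * x / m := by rw [e1, hx]; ring
      rw [e2, cappedRate, ← hx]
      -- For `m ≤ c₂` the cap gives `m ^ 2 ≤ c₂ * m`; otherwise `(x + c₂) ^ 2 ≤ 2 * (x ^ 2 + c₂ ^
      -- 2)` and `c₂ ^ 2 ≤ c₂ * m`.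
      have h5 : min (x + c₂) (m : ℝ) * min (x + c₂) (m : ℝ) ≤ 2 * (x * x + c₂ * m) := by
        rcases le_total (m : ℝ) c₂ with hc | hc
        · have := min_le_right (x + c₂) (m : ℝ)
          have h6 : 0 ≤ min (x + c₂) (m : ℝ) := by positivity
          nlinarith
        · have := min_le_left (x + c₂) (m : ℝ)
          have h6 : 0 ≤ min (x + c₂) (m : ℝ) := by positivity
          nlinarith [sq_nonneg (x - c₂)]
      have h7 : 2 * (x * x / m + c₂) = 2 * (x * x + c₂ * m) / m := by field_simp
      rw [h7, ← mul_div_assoc]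
      gcongr
    have h5 : (m : ℝ) ^ (2 * p - 1) ≤ (n : ℝ) ^ (2 * p - 1) :=
      Real.rpow_le_rpow hm0.le hmn' (by linarith)
    have h6 : c₁ ^ 2 * (m : ℝ) ^ (2 * p - 1) ≤ c₁ ^ 2 * (n : ℝ) ^ (2 * p - 1) := by gcongr
    linarith

/-- The sizes of the fibers add up to `T`; concavity is used for the exponents `p` and `1 - p`
separately. -/
theorem fiberSum_le {lam : ℕ → ℕ} {T : ℕ} {E : ℝ} (hT : 1 ≤ T)
    (hE : (((Finset.range T).image lam).card : ℝ) ≤ E) {a : ℝ} (ha : 0 ≤ a) :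
    fiberSum lam T (fun j => a * (j * cappedRate c₁ c₂ p j)) ≤ a * (4 * piecesBound c₁ c₂ p T E) := by
  have hT0 : (0 : ℝ) < T := by exact_mod_cast hT
  have hE0 : 0 < E := by
    refine lt_of_lt_of_le ?_ hE
    have : 0 < ((Finset.range T).image lam).card :=
      Finset.card_pos.2 ((Finset.nonempty_range_iff.2 (by omega)).image _)
    exact_mod_cast this
  rw [fiberSum, ← Finset.mul_sum]
  refine mul_le_mul_of_nonneg_left ?_ ha
  set x : ℕ → ℝ := fun j => ((Finset.range T).filter fun t => lam t = j).card with hx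
  have hsum : ∑ j ∈ (Finset.range T).image lam, x j ≤ T := by
    have := Finset.card_eq_sum_card_image lam (Finset.range T)
    rw [Finset.card_range] at this
    simp only [hx]
    exact_mod_cast this.ge
  have h3 := Real.sum_rpow_le_of_card_le _ x (q := p) (by linarith) hp1 hE0 hT0
    (fun j _ => Nat.cast_nonneg _) hE hsum
  have h4 := Real.sum_rpow_le_of_card_le _ x (q := 1 - p) (by linarith) (by linarith) hE0 hT0
    (fun j _ => Nat.cast_nonneg _) hE hsum
  rw [sub_sub_cancel] at h4
  have h5 : ∀ j ∈ (Finset.range T).image lam, x j * cappedRate c₁ c₂ p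
      ((Finset.range T).filter fun t => lam t = j).card ≤ 2 * baseBound c₁ c₂ p (x j) := by
    intro j hj
    refine mul_cappedRate_le h1 h2 (Finset.card_pos.2 ?_)
    obtain ⟨t, ht, rfl⟩ := Finset.mem_image.1 hj
    exact ⟨t, Finset.mem_filter.2 ⟨ht, rfl⟩⟩
  refine (Finset.sum_le_sum h5).trans ?_
  simp only [baseBound]
  rw [← Finset.mul_sum, Finset.sum_add_distrib, ← Finset.mul_sum, ← Finset.mul_sum, piecesBound]
  have h6 : 0 ≤ c₂ / c₁ := by positivity
  nlinarith [mul_le_mul_of_nonneg_left h3 h1.le, mul_le_mul_of_nonneg_left h4 h6]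

theorem mul_baseBound_le {x N E T : ℝ} (hx : 0 ≤ x) (hN : 0 ≤ N) (hNE : N ≤ E) (hT : 0 ≤ T)
    (hNx : N * x ≤ 2 * T) : N * baseBound c₁ c₂ p x ≤ 2 * piecesBound c₁ c₂ p T E := by
  have h3 := Real.mul_rpow_le_of_mul_le hx hN hNE hT hNx (q := p) (by linarith) hp1
  have h4 := Real.mul_rpow_le_of_mul_le hx hN hNE hT hNx (q := 1 - p) (by linarith) (by linarith)
  rw [sub_sub_cancel] at h4
  have h6 : 0 ≤ c₂ / c₁ := by positivity
  rw [baseBound, piecesBound]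
  nlinarith [mul_le_mul_of_nonneg_left h3 h1.le, mul_le_mul_of_nonneg_left h4 h6]

theorem isRate_cappedRate {T : ℕ} {δ : ℝ} (hT : 2 ^ 14 ≤ T) (hδ : 0 < δ) (hδ1 : δ < 1)
    (hlow : ∀ t : ℕ, 1 ≤ t → t ≤ T → √(t : ℝ) ≤ c₁ * (t : ℝ) ^ p + c₂) :
    IsRate (cappedRate c₁ c₂ p) (MasterState.rhoHat (cappedRate c₁ c₂ p) T δ) T (Real.logb 2 T + 1)
      (Real.log (T / δ)) where
  anti i j hi hij hj := by
    have hi0 : (0 : ℝ) < i := by exact_mod_cast hi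
    have hij' : (i : ℝ) ≤ j := by exact_mod_cast hij
    have hj0 : (0 : ℝ) < j := hi0.trans_le hij'
    rw [cappedRate, cappedRate, div_le_div_iff₀ hj0 hi0]
    have e : ∀ t : ℝ, 0 < t → t ^ p = t ^ (p - 1) * t := fun t ht => by
      rw [← Real.rpow_add_one ht.ne']; congr 1; ring
    have h3 : (j : ℝ) ^ (p - 1) ≤ (i : ℝ) ^ (p - 1) :=
      Real.rpow_le_rpow_of_nonpos hi0 hij' (by linarith)
    rw [min_mul_of_nonneg _ _ hi0.le, min_mul_of_nonneg _ _ hj0.le, e i hi0, e j hj0]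
    refine min_le_min ?_ (by linarith)
    have h4 : c₁ * (i * j : ℝ) * (j : ℝ) ^ (p - 1) ≤ c₁ * (i * j : ℝ) * (i : ℝ) ^ (p - 1) := by
      gcongr
    nlinarith
  mono i j hi hij hj := by
    rw [mul_cappedRate hi, mul_cappedRate (hi.trans hij)]
    have : 0 ≤ p := by linarith
    gcongr
  sqrt_le i hi hiT := by
    rw [mul_cappedRate hi]
    refine le_min (hlow i hi hiT) ?_
    rw [Real.sqrt_le_iff]
    have : (1 : ℝ) ≤ i := by exact_mod_cast hi
    exact ⟨by linarith, by nlinarith⟩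
  rhat_eq i := rfl
  le_h k hk := by
    have hT0 : (0 : ℝ) < T := by
      have : 0 < T := by omega
      exact_mod_cast this
    have : (k : ℝ) ≤ Real.logb 2 T := by
      rw [Real.le_logb_iff_rpow_le (by norm_num) hT0, Real.rpow_natCast]
      exact_mod_cast hk
    linarith
  two_le_h := by
    have hT0 : (0 : ℝ) < T := by
      have : 0 < T := by omega
      exact_mod_cast this
    have : (1 : ℝ) ≤ Real.logb 2 T := by
      rw [Real.le_logb_iff_rpow_le (by norm_num) hT0, Real.rpow_one]
      have : 2 ≤ T := by omega
      exact_mod_cast this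
    linarith
  nine_le := by
    -- The horizon `2 ^ 14` gives a logarithm of at least `14 * log 2 > 9`.
    have hT' : ((2 : ℝ) ^ 14) ≤ T := by exact_mod_cast hT
    have h3 : ((2 : ℝ) ^ 14) ≤ T / δ := by
      rw [le_div_iff₀ hδ]
      nlinarith
    have h4 := Real.log_le_log (by positivity) h3
    rw [Real.log_pow] at h4
    have := Real.log_two_gt_d9
    push_cast at h4
    linarith

end Rate

/-! ### Summing up: the typical regret for power rates. -/

namespace Run

variable {f ρ rhat : ℕ → ℝ} {T L : ℕ} (X : Run rhat) (N : NearStationary f ρ T L)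

theorem card_image_block_le :
    ((Finset.range T).image X.block).card
      ≤ ((Finset.range T).filter fun u => X.pos u = 0).card := by
  refine (Finset.card_le_card (t := Finset.Icc 1 _) fun j hj => ?_).trans_eq (Nat.card_Icc _ _)
  obtain ⟨t, ht, rfl⟩ := Finset.mem_image.1 hj
  rw [Finset.mem_range] at ht
  rw [Finset.mem_Icc]
  refine ⟨Finset.card_pos.2 ⟨0, ?_⟩, Finset.card_le_card
    (Finset.filter_subset_filter _ (Finset.range_subset_range.2 ht))⟩
  simp [X.pos_zero]

/-- Walking through the rounds, a new cell needs a new piece or a new block, so the numbers of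
pieces and blocks add rather than multiply. -/
theorem card_image_cell_le :
    ((Finset.range T).image (X.cell N)).card
      ≤ L + ((Finset.range T).filter fun u => X.pos u = 0).card := by
  refine (Finset.card_le_card (t := Finset.range _) fun j hj => ?_).trans_eq (Finset.card_range _)
  obtain ⟨t, ht, rfl⟩ := Finset.mem_image.1 hj
  rw [Finset.mem_range] at ht
  have h1 := N.lab_lt t ht
  have h2 : X.block t ≤ ((Finset.range T).filter fun u => X.pos u = 0).card :=
    Finset.card_le_card (Finset.filter_subset_filter _ (Finset.range_subset_range.2 ht))
  rw [Finset.mem_range, cell]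
  omega

theorem card_pos_eq_zero_eq {K : ℕ} (hK : ∀ n, 2 ^ n ≤ T → n < K) :
    ((Finset.range T).filter fun u => X.pos u = 0).card
      = ∑ n ∈ Finset.range K, (X.starts n T).card := by
  rw [Finset.card_eq_sum_card_fiberwise (f := X.n) (t := Finset.range K)]
  · refine Finset.sum_congr rfl fun n _ => ?_
    rw [starts, Finset.filter_filter]
    simp only [and_comm]
  · intro t ht
    rw [Finset.mem_coe, Finset.mem_filter, Finset.mem_range] at ht
    rw [Finset.mem_coe, Finset.mem_range]
    exact hK _ (X.two_pow_le ht.1)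

open Classical in
/-- The regret in a typical run for the rate `(c₁ t ^ p + c₂) / t`. -/
theorem regret_le_piecesBound {c₁ c₂ p h l : ℝ} (h1 : 0 < c₁) (h2 : 0 < c₂) (hp : 1 / 2 ≤ p)
    (hp1 : p < 1) {N : NearStationary f (cappedRate c₁ c₂ p) T L}
    (H : IsRate (cappedRate c₁ c₂ p) rhat T h l) (hT : 1 ≤ T)
    (hX : X.Typical N l) (hg : ∀ u, X.g u ∈ Set.Icc (0 : ℝ) 1)
    (hR : ∀ u, X.R u ∈ Set.Icc (0 : ℝ) 1) (hf : ∀ u, f u ≤ 1)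
    (hV : ((Finset.range T).filter (X.Viol N)).card ≤ 23) :
    ∑ t ∈ Finset.range T, (f t - X.R t)
      ≤ 70000 * h ^ 4 * l ^ 2 * piecesBound c₁ c₂ p T L := by
  set K := Nat.log 2 T + 1 with hKdef
  have hK : ∀ n, 2 ^ n ≤ T ↔ n < K := fun n => by
    rw [hKdef, Nat.lt_succ_iff, Nat.le_log_iff_pow_le (by norm_num) (by omega)]
  have hKh : (K : ℝ) ≤ h := by
    rw [hKdef]
    push_cast
    exact H.le_h _ (Nat.pow_log_le_self 2 (by omega))
  have hl := H.nine_le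
  have hh := H.two_le_h
  have hL1 : 1 ≤ L := (Nat.zero_le _).trans_lt (N.lab_lt 0 (by omega))
  have hL : (1 : ℝ) ≤ L := by exact_mod_cast hL1
  have hT0 : (0 : ℝ) ≤ T := Nat.cast_nonneg _
  have hrest : ((Finset.range T).filter X.restart).card ≤ L + 23 := by
    refine (X.card_restart_le N H hX hg hR (S := (Finset.range T).filter X.restart)
      fun t ht => by simpa using ht).trans (Nat.add_le_add ?_ ?_)
    · refine (Finset.card_le_card (t := Finset.range L) fun j hj => ?_).trans_eq
        (Finset.card_range L)
      obtain ⟨t, ht, rfl⟩ := Finset.mem_image.1 hj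
      rw [Finset.mem_filter, Finset.mem_range] at ht
      exact Finset.mem_range.2 (N.lab_lt t ht.1)
    · refine le_trans (Finset.card_le_card fun u hu => ?_) hV
      rw [Finset.mem_filter] at hu ⊢
      exact ⟨hu.1, hu.2.1⟩
  -- At most `L + 23` restarts and one initial block sequence; at most `h` orders then give the
  -- number of blocks.
  have hstarts : ∀ n, ((X.starts n T).card : ℝ) ≤ 25 * L := fun n => by
    have h3 := (X.card_starts_le n T).trans (Nat.add_le_add_right hrest 1)
    have h4 : (X.starts n T).card ≤ 25 * L := by omega
    exact_mod_cast h4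
  have hzero : (((Finset.range T).filter fun u => X.pos u = 0).card : ℝ) ≤ h * (25 * L) := by
    rw [X.card_pos_eq_zero_eq fun n => (hK n).1]
    push_cast
    refine (Finset.sum_le_card_nsmul _ _ _ fun n _ => hstarts n).trans ?_
    rw [Finset.card_range, nsmul_eq_mul]
    gcongr
  set E : ℝ := 26 * h * L with hE
  have hhL : (L : ℝ) ≤ h * L := by nlinarith
  have hcell : (((Finset.range T).image (X.cell N)).card : ℝ) ≤ E := by
    have h3 : (((Finset.range T).image (X.cell N)).card : ℝ)
        ≤ L + ((Finset.range T).filter fun u => X.pos u = 0).card := by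
      exact_mod_cast X.card_image_cell_le N
    rw [hE]
    linarith
  have hblock : (((Finset.range T).image X.block).card : ℝ) ≤ E := by
    have h3 : (((Finset.range T).image X.block).card : ℝ)
        ≤ ((Finset.range T).filter fun u => X.pos u = 0).card := by
      exact_mod_cast X.card_image_block_le
    rw [hE]
    linarith
  set G := piecesBound c₁ c₂ p T E with hG
  have hE1 : 1 ≤ E := by rw [hE]; linarith
  have hG0 : 0 ≤ G := piecesBound_nonneg h1 h2 hT0 (by linarith)
  have hhl : 18 ≤ h * l := by nlinarith
  have h3 := X.regret_le N H hX hg hR hf hV hK hKh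
  have h4 := fiberSum_le h1 h2 hp hp1 hT hcell (a := 400 * h ^ 2 * l) (by positivity)
  have h5 := fiberSum_le h1 h2 hp hp1 hT hblock (a := 19 * h * l) (by nlinarith)
  have h6 : ∑ n ∈ Finset.range K, ∑ m ∈ Finset.range (n + 1), 288 * h * l *
          ((2 ^ m : ℕ) * cappedRate c₁ c₂ p (2 ^ m) * cappedRate c₁ c₂ p (2 ^ m)
            / cappedRate c₁ c₂ p (2 ^ n)) * ((X.starts n T).card + 4 * l)
      ≤ h * (h * (576 * (h * l) * ((2 + 4 * l) * G))) := by
    have hc0 : 0 ≤ 576 * (h * l) * ((2 + 4 * l) * G) :=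
      mul_nonneg (by linarith) (mul_nonneg (by linarith) hG0)
    have hin : ∀ n ∈ Finset.range K, ∑ m ∈ Finset.range (n + 1), 288 * h * l *
          ((2 ^ m : ℕ) * cappedRate c₁ c₂ p (2 ^ m) * cappedRate c₁ c₂ p (2 ^ m)
            / cappedRate c₁ c₂ p (2 ^ n)) * ((X.starts n T).card + 4 * l)
        ≤ h * (576 * (h * l) * ((2 + 4 * l) * G)) := by
      intro n hn
      rw [Finset.mem_range] at hn
      have hnT := (hK n).2 hn
      have hnT' : ((2 ^ n : ℕ) : ℝ) ≤ T := by exact_mod_cast hnT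
      have hB0 := baseBound_nonneg (p := p) h1 h2 (Nat.cast_nonneg (α := ℝ) (2 ^ n))
      have hstE : ((X.starts n T).card : ℝ) ≤ E := by
        rw [hE]; linarith [hstarts n]
      have hNB : ((X.starts n T).card : ℝ) * baseBound c₁ c₂ p (2 ^ n : ℕ) ≤ 2 * G := by
        refine mul_baseBound_le h1 h2 hp hp1 (Nat.cast_nonneg _) (Nat.cast_nonneg _) hstE hT0 ?_
        rw [mul_comm]
        exact_mod_cast X.two_pow_mul_card_starts_le n T
      -- The logarithmic deviation term is not proportional to the number of blocks; it is compared
      -- with a single stationary piece of the whole horizon.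
      have hB1 : baseBound c₁ c₂ p (2 ^ n : ℕ) ≤ G := by
        refine (baseBound_mono h1 h2 hp hp1 (Nat.cast_nonneg _) hnT').trans ?_
        have := piecesBound_mono h1 h2 hp hp1 hT0 zero_le_one hE1
        rw [hG]
        refine le_trans (le_of_eq ?_) this
        rw [baseBound, piecesBound, Real.one_rpow, Real.one_rpow, mul_one, mul_one]
      refine (Finset.sum_le_card_nsmul _ _ (576 * (h * l) * ((2 + 4 * l) * G)) fun m hm => ?_).trans
        ?_
      · rw [Finset.mem_range] at hm
        have h7 := mul_cappedRate_mul_le h1 h2 hp hp1 (m := 2 ^ m) (n := 2 ^ n)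
          Nat.one_le_two_pow (Nat.pow_le_pow_right (by norm_num) (by omega))
        have h8 : (0 : ℝ) ≤ (X.starts n T).card + 4 * l := by positivity
        calc _ ≤ 288 * h * l * (2 * baseBound c₁ c₂ p (2 ^ n : ℕ)) * ((X.starts n T).card + 4 * l) := by
              gcongr
          _ = 576 * (h * l) * ((X.starts n T).card * baseBound c₁ c₂ p (2 ^ n : ℕ)
              + 4 * l * baseBound c₁ c₂ p (2 ^ n : ℕ)) := by ring
          _ ≤ 576 * (h * l) * (2 * G + 4 * l * G) := by gcongr
          _ = _ := by ring
      · rw [Finset.card_range, nsmul_eq_mul]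
        have : ((n + 1 : ℕ) : ℝ) ≤ K := by exact_mod_cast hn
        exact mul_le_mul_of_nonneg_right (this.trans hKh) hc0
    refine (Finset.sum_le_card_nsmul _ _ _ hin).trans ?_
    rw [Finset.card_range, nsmul_eq_mul]
    exact mul_le_mul_of_nonneg_right hKh (mul_nonneg (by linarith) hc0)
  have h7 : G ≤ 26 * h * piecesBound c₁ c₂ p T L :=
    piecesBound_mul_le h1 h2 hp hp1 hT0 (by linarith) (by linarith)
  have hA : 0 ≤ h * l * G := mul_nonneg (by linarith) hG0
  have h8 : ∑ t ∈ Finset.range T, (f t - X.R t) ≤ 2690 * (h ^ 3 * l ^ 2) * G := by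
    have i1 : h * l * G * 36 ≤ h * l * G * (h * (h * l)) :=
      mul_le_mul_of_nonneg_left (by nlinarith) hA
    have i2 : h * (h * l * G) * 18 ≤ h * (h * l * G) * (h * l) :=
      mul_le_mul_of_nonneg_left hhl (mul_nonneg (by linarith) hA)
    have i3 : h * (h * (h * l * G)) * 9 ≤ h * (h * (h * l * G)) * l :=
      mul_le_mul_of_nonneg_left hl (mul_nonneg (by linarith) (mul_nonneg (by linarith) hA))
    nlinarith
  calc _ ≤ 2690 * (h ^ 3 * l ^ 2) * G := h8
    _ ≤ 2690 * (h ^ 3 * l ^ 2) * (26 * h * piecesBound c₁ c₂ p T L) := by gcongr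
    _ = 69940 * (h ^ 4 * l ^ 2 * piecesBound c₁ c₂ p T L) := by ring
    _ ≤ 70000 * (h ^ 4 * l ^ 2 * piecesBound c₁ c₂ p T L) := by
        have : 0 ≤ h ^ 4 * l ^ 2 * piecesBound c₁ c₂ p T L :=
          mul_nonneg (by positivity) (piecesBound_nonneg h1 h2 hT0 (by linarith))
        linarith
    _ = _ := by ring

end Run

/-! ### The probability of an atypical run. -/

theorem measure_le_card_mul {Ω ι : Type*} [MeasurableSpace Ω] {μ : Measure Ω} {c : ℝ≥0∞}
    {s : Finset ι} {A : ι → Set Ω} {B : Set Ω} (hA : ∀ i ∈ s, μ (A i) ≤ c)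
    (hB : ∀ ω ∈ B, ∃ i ∈ s, ω ∈ A i) : μ B ≤ s.card * c := by
  calc μ B ≤ μ (⋃ i ∈ s, A i) := measure_mono fun ω hω => by
        obtain ⟨i, hi, h⟩ := hB ω hω
        exact Set.mem_biUnion hi h
    _ ≤ ∑ i ∈ s, μ (A i) := measure_biUnion_finset_le _ _
    _ ≤ s.card • c := Finset.sum_le_card_nsmul _ _ _ hA
    _ = _ := nsmul_eq_mul _ _

theorem optReward_le_one {Pol O Z : Type*} [MeasurableSpace Pol] [MeasurableSpace O]
    [MeasurableSpace Z] {νZ : Measure Z} [IsProbabilityMeasure νZ] {env : ℕ → Pol → Z → O}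
    {rew : O → ℝ} (he : IsEnvironment env rew) (t : ℕ) : optReward νZ env rew t ≤ 1 :=
  Real.iSup_le (fun π => (meanReward_mem he t π).2) zero_le_one

namespace MasterState

variable {S U Pol O Z : Type*} [MeasurableSpace S] [MeasurableSpace U] [MeasurableSpace Pol]
  [MeasurableSpace O] [MeasurableSpace Z] {A : Learner S U Pol O} {env : ℕ → Pol → Z → O}
  {rew : O → ℝ} {ρ : ℕ → ℝ} {T : ℕ} {δ : ℝ} (νZ : Measure Z) [IsProbabilityMeasure νZ]
  (νU : Measure U) [IsProbabilityMeasure νU] {L : ℕ}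

theorem measurable_cand (hA : A.IsMeasurable) (he : IsEnvironment env rew)
    (hρ : ∀ m, 0 < ρ (2 ^ m)) {f : ℕ → ℝ} (N : NearStationary f ρ T L) (n m t : ℕ) :
    Measurable fun ω => (toRun A env rew ρ T δ hρ ω).Cand N n m t := by
  have hn := measurable_run_n ρ T δ hA he hρ t
  have hp := measurable_run_pos ρ T δ hA he hρ t
  refine Measurable.and ?_ (Measurable.and measurable_const (Measurable.and ?_ (Measurable.and ?_
    (Measurable.and measurable_const (Measurable.and measurable_const ?_)))))
  · exact (measurable_of_countable (· = n)).comp hn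
  · exact (measurable_of_countable (2 ^ m ∣ ·)).comp hp
  · exact (measurable_of_countable (0 < ·)).comp hp
  · exact measurableSet_setOfPred.1 (measurableSet_le measurable_const
      (measurable_const.sub (measurable_run_U ρ T δ hA he hρ (t - 1))))

omit [MeasurableSpace S] [MeasurableSpace U] [MeasurableSpace Pol] [MeasurableSpace O]
  [MeasurableSpace Z] in
-- Candidacy in round `t` refers to `U (t - 1)`, not to `U t`, so it is decided before the coins of
-- round `t` are tossed. The concentration of the coins over candidate rounds needs this
-- predictability.
theorem cand_congr (hρ : ∀ m, 0 < ρ (2 ^ m)) {f : ℕ → ℝ} (N : NearStationary f ρ T L)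
    (n m : ℕ) {t : ℕ} {ω ω' : ℕ → Z × (U × (ℕ → unitInterval))} (h : ∀ u < t, ω u = ω' u) :
    (toRun A env rew ρ T δ hρ ω).Cand N n m t ↔ (toRun A env rew ρ T δ hρ ω').Cand N n m t := by
  have e : ∀ u ≤ t, before A env rew ρ T δ ω u = before A env rew ρ T δ ω' u := fun u hu =>
    Learner.state_congr _ _ fun v hv => h v (by omega)
  have e1 : (toRun A env rew ρ T δ hρ ω).n t = (toRun A env rew ρ T δ hρ ω').n t :=
    congrArg MasterState.n (e t le_rfl)
  have e2 : (toRun A env rew ρ T δ hρ ω).pos t = (toRun A env rew ρ T δ hρ ω').pos t :=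
    congrArg MasterState.pos (e t le_rfl)
  rw [Run.Cand, Run.Cand, e1, e2]
  rcases Nat.eq_zero_or_pos t with rfl | ht
  · rw [(toRun A env rew ρ T δ hρ ω').pos_zero]
    simp
  · have e3 : executed A env rew ρ T δ ω (t - 1) = executed A env rew ρ T δ ω' (t - 1) := by
      simp only [executed, scheduled, Learner.feedback, e (t - 1) (by omega), h (t - 1) (by omega)]
    have e4 : (toRun A env rew ρ T δ hρ ω).U (t - 1) = (toRun A env rew ρ T δ hρ ω').U (t - 1) := by
      change (⨅ i : Fin ((before A env rew ρ T δ ω (t - 1)).pos + 1),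
        (executed A env rew ρ T δ ω (t - 1)).g i) = ⨅ i : Fin ((before A env rew ρ T δ ω' (t - 1)).pos
          + 1), (executed A env rew ρ T δ ω' (t - 1)).g i
      rw [e3, e (t - 1) (by omega)]
    rw [e4]

open Classical in
-- A union bound over windows and orders; each single deviation has probability at most `exp (-(4 *
-- l))`.
theorem measure_not_typical_le {h l : ℝ} (hA : A.IsMeasurable) (he : IsEnvironment env rew)
    (hρ : ∀ m, 0 < ρ (2 ^ m)) (N : NearStationary (optReward νZ env rew) ρ T L)
    (H : IsRate ρ (rhoHat ρ T δ) T h l) {K : ℕ} (hK : ∀ n, 2 ^ n ≤ T → n < K) :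
    interactionLaw νZ (masterSeed νU)
        {ω | ¬ (toRun A env rew ρ T δ hρ ω).Typical N l}
      ≤ ((T * (T + 1) + T * (T + 1) * (K * K) + K * K : ℕ) : ℝ≥0∞)
        * ENNReal.ofReal (Real.exp (-(4 * l))) := by
  set X := toRun A env rew ρ T δ hρ with hXdef
  set μ := interactionLaw νZ (masterSeed νU)
  set c := ENNReal.ofReal (Real.exp (-(4 * l))) with hc
  have hl := H.nine_le
  have hanti : ∀ {n m : ℕ}, m ≤ n → 2 ^ n ≤ T → ρ (2 ^ n) ≤ ρ (2 ^ m) := fun hmn hn =>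
    H.anti _ _ Nat.one_le_two_pow (Nat.pow_le_pow_right (by norm_num) hmn) hn
  have hreward : μ {ω | ¬ ∀ s e : ℕ, s < e → e ≤ T → ∑ u ∈ Finset.Ico s e,
      ((X ω).R u - optReward νZ env rew u) ≤ (1 / 8 + 4 * l) * √((e - s : ℕ) : ℝ)}
      ≤ ((T * (T + 1) : ℕ) : ℝ≥0∞) * c := by
    -- The exponent `θ = 1 / √(length)` balances the deviation `4 l` against the variance term,
    -- which sums to `1 / 8`.
    have := measure_le_card_mul (μ := μ) (c := c) (s := Finset.range T ×ˢ Finset.range (T + 1))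
      (A := fun i => {ω | 4 * l < ∑ t ∈ Finset.Ico i.1 i.2,
        ((1 / √((i.2 - i.1 : ℕ) : ℝ)) * ((X ω).R t - optReward νZ env rew t)
          - (1 / √((i.2 - i.1 : ℕ) : ℝ)) ^ 2 / 8)}) (fun i _ => ?_)
      (B := {ω | ¬ ∀ s e : ℕ, s < e → e ≤ T → ∑ u ∈ Finset.Ico s e,
      ((X ω).R u - optReward νZ env rew u) ≤ (1 / 8 + 4 * l) * √((e - s : ℕ) : ℝ)}) fun ω hω => ?_
    · rwa [Finset.card_product, Finset.card_range, Finset.card_range] at this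
    · exact measure_reward_deviation νZ νU hA he hρ (by positivity) _ _ _
    · rw [Set.mem_ofPred_eq] at hω
      push Not at hω
      obtain ⟨s, e, hse, heT, hlt⟩ := hω
      refine ⟨(s, e), by simp; omega, ?_⟩
      have hpos : (0 : ℝ) < √((e - s : ℕ) : ℝ) := Real.sqrt_pos.2 (by
        have : 0 < e - s := by omega
        exact_mod_cast this)
      rw [Set.mem_ofPred_eq, Finset.sum_sub_distrib, ← Finset.mul_sum, Finset.sum_const,
        Nat.card_Ico, nsmul_eq_mul, one_div, inv_pow, Real.sq_sqrt (Nat.cast_nonneg _)]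
      have hne : ((e - s : ℕ) : ℝ) ≠ 0 := by
        have : e - s ≠ 0 := by omega
        exact_mod_cast this
      have e1 : ((e - s : ℕ) : ℝ) * (((e - s : ℕ) : ℝ)⁻¹ / 8) = 1 / 8 := by field_simp
      simp only
      rw [e1, lt_sub_iff_add_lt, lt_inv_mul_iff₀ hpos]
      linarith
  have hcoin : μ {ω | ¬ ∀ s e n m : ℕ, e ≤ T → m ≤ n → 2 ^ n ≤ T →
      (((Finset.Ico s e).filter fun u => ((X ω).n u = n ∧ 2 ^ m ∣ (X ω).pos u) ∧
        (X ω).coin u m).card : ℝ) ≤ 7 / 4 * (ρ (2 ^ n) / ρ (2 ^ m))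
        * ((Finset.Ico s e).filter fun u => (X ω).n u = n ∧ 2 ^ m ∣ (X ω).pos u).card + 4 * l}
      ≤ ((T * (T + 1) * (K * K) : ℕ) : ℝ≥0∞) * c := by
    have := measure_le_card_mul (μ := μ) (c := c) (s := ((Finset.range T ×ˢ Finset.range (T + 1)) ×ˢ
        (Finset.range K ×ˢ Finset.range K)).filter fun i => i.2.2 ≤ i.2.1 ∧ 2 ^ i.2.1 ≤ T)
      (A := fun i => {ω | 4 * l < ∑ t ∈ Finset.range i.1.2,
        if i.1.1 ≤ t ∧ (X ω).n t = i.2.1 ∧ 2 ^ i.2.2 ∣ (X ω).pos t then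
          1 * (if (X ω).coin t i.2.2 then 1 else 0)
            - (Real.exp 1 - 1) * (ρ (2 ^ i.2.1) / ρ (2 ^ i.2.2)) else 0}) (fun i hi => ?_)
      (B := {ω | ¬ ∀ s e n m : ℕ, e ≤ T → m ≤ n → 2 ^ n ≤ T →
      (((Finset.Ico s e).filter fun u => ((X ω).n u = n ∧ 2 ^ m ∣ (X ω).pos u) ∧
        (X ω).coin u m).card : ℝ) ≤ 7 / 4 * (ρ (2 ^ n) / ρ (2 ^ m))
        * ((Finset.Ico s e).filter fun u => (X ω).n u = n ∧ 2 ^ m ∣ (X ω).pos u).card + 4 * l})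
      fun ω hω => ?_
    · refine this.trans (mul_le_mul_left (Nat.cast_le.2 ((Finset.card_filter_le _ _).trans ?_)) _)
      simp [Finset.card_product]
    · rw [Finset.mem_filter] at hi
      have hdev := measure_coin_deviation (T := T) (δ := δ) νZ νU hA he hρ (hanti hi.2.1 hi.2.2) 1
        (4 * l) (D := fun t ω => i.1.1 ≤ t ∧ (X ω).n t = i.2.1 ∧ 2 ^ i.2.2 ∣ (X ω).pos t)
        ?_ ?_ ?_ i.1.2
      · convert hdev
      · intro t
        exact measurable_const.and (((measurable_of_countable (· = i.2.1)).comp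
          (measurable_run_n ρ T δ hA he hρ t)).and ((measurable_of_countable (2 ^ i.2.2 ∣ ·)).comp
          (measurable_run_pos ρ T δ hA he hρ t)))
      · intro t ω ω' hω
        have e : before A env rew ρ T δ ω t = before A env rew ρ T δ ω' t :=
          Learner.state_congr _ _ hω
        have e1 : (X ω).n t = (X ω').n t := congrArg MasterState.n e
        have e2 : (X ω).pos t = (X ω').pos t := congrArg MasterState.pos e
        simp only [e1, e2]
      · exact fun t ω hω => hω.2.1
    · rw [Set.mem_ofPred_eq] at hω
      push Not at hω
      obtain ⟨s, e, n, m, heT, hmn, hn, hlt⟩ := hω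
      have hse : s < e := by
        by_contra hcon
        rw [Finset.Ico_eq_empty (by omega)] at hlt
        simp only [Finset.filter_empty, Finset.card_empty, Nat.cast_zero, mul_zero] at hlt
        linarith
      have hnK := hK n hn
      refine ⟨((s, e), (n, m)), by simp; omega, ?_⟩
      have e1 : (Finset.range e).filter (fun t => s ≤ t ∧ (X ω).n t = n ∧ 2 ^ m ∣ (X ω).pos t)
          = (Finset.Ico s e).filter fun u => (X ω).n u = n ∧ 2 ^ m ∣ (X ω).pos u := by
        ext u
        simp only [Finset.mem_filter, Finset.mem_range, Finset.mem_Ico]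
        tauto
      rw [Set.mem_ofPred_eq]
      simp only [one_mul]
      rw [← Finset.sum_filter, e1, Finset.sum_sub_distrib, Finset.sum_boole, Finset.sum_const,
        nsmul_eq_mul, Finset.filter_filter]
      have hq : 0 ≤ ρ (2 ^ n) / ρ (2 ^ m) := (div_pos (hρ n) (hρ m)).le
      -- The constant in the upper bound for the coins, from the exponent `a = 1`.
      have hexp : Real.exp 1 - 1 ≤ 7 / 4 := by linarith [Real.exp_one_lt_d9]
      have h3 := mul_le_mul_of_nonneg_right hexp (mul_nonneg hq (Nat.cast_nonneg (α := ℝ)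
        ((Finset.Ico s e).filter fun u => (X ω).n u = n ∧ 2 ^ m ∣ (X ω).pos u).card))
      linarith
  have hcand : μ {ω | ¬ ∀ n m : ℕ, m ≤ n → 2 ^ n ≤ T →
      ρ (2 ^ n) / ρ (2 ^ m) * ((Finset.range T).filter fun u => (X ω).Cand N n m u).card
      ≤ 2 * (((Finset.range T).filter fun u => (X ω).Cand N n m u ∧ (X ω).coin u m).card + 4 * l)}
      ≤ ((K * K : ℕ) : ℝ≥0∞) * c := by
    have := measure_le_card_mul (μ := μ) (c := c)
      (s := (Finset.range K ×ˢ Finset.range K).filter fun i => i.2 ≤ i.1 ∧ 2 ^ i.1 ≤ T)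
      (A := fun i => {ω | 4 * l < ∑ t ∈ Finset.range T,
        if (X ω).Cand N i.1 i.2 t then (-1) * (if (X ω).coin t i.2 then 1 else 0)
            - (Real.exp (-1) - 1) * (ρ (2 ^ i.1) / ρ (2 ^ i.2)) else 0}) (fun i hi => ?_)
      (B := {ω | ¬ ∀ n m : ℕ, m ≤ n → 2 ^ n ≤ T →
      ρ (2 ^ n) / ρ (2 ^ m) * ((Finset.range T).filter fun u => (X ω).Cand N n m u).card
      ≤ 2 * (((Finset.range T).filter fun u => (X ω).Cand N n m u ∧ (X ω).coin u m).card + 4 * l)})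
      fun ω hω => ?_
    · refine this.trans (mul_le_mul_left (Nat.cast_le.2 ((Finset.card_filter_le _ _).trans ?_)) _)
      simp [Finset.card_product]
    · rw [Finset.mem_filter] at hi
      exact measure_coin_deviation νZ νU hA he hρ (hanti hi.2.1 hi.2.2) (-1) _ (D := fun t ω =>
        (X ω).Cand N i.1 i.2 t) (measurable_cand hA he hρ N i.1 i.2)
        (fun t ω ω' hω => cand_congr hρ N i.1 i.2 hω) (fun t ω hω => hω.1) _
    · rw [Set.mem_ofPred_eq] at hω
      push Not at hω
      obtain ⟨n, m, hmn, hn, hlt⟩ := hω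
      have hnK := hK n hn
      refine ⟨(n, m), by simp; omega, ?_⟩
      rw [Set.mem_ofPred_eq]
      simp only
      rw [← Finset.sum_filter, Finset.sum_sub_distrib, ← Finset.mul_sum, Finset.sum_boole,
        Finset.sum_const, nsmul_eq_mul, Finset.filter_filter]
      have hq : 0 ≤ ρ (2 ^ n) / ρ (2 ^ m) := (div_pos (hρ n) (hρ m)).le
      -- With `a = -1` the drift factor `1 - exp (-1)` is at least `1 / 2`, whence the factor `2` in
      -- the bound for candidates.
      have hexp : Real.exp (-1) ≤ 1 / 2 := by
        rw [Real.exp_neg, one_div]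
        exact inv_anti₀ (by norm_num) (by linarith [Real.exp_one_gt_d9])
      have h3 := mul_le_mul_of_nonneg_right hexp (mul_nonneg hq (Nat.cast_nonneg (α := ℝ)
        ((Finset.range T).filter fun u => (X ω).Cand N n m u).card))
      linarith
  have hsub : {ω | ¬ (X ω).Typical N l} ⊆
      ({ω | ¬ ∀ s e : ℕ, s < e → e ≤ T → ∑ u ∈ Finset.Ico s e,
      ((X ω).R u - optReward νZ env rew u) ≤ (1 / 8 + 4 * l) * √((e - s : ℕ) : ℝ)}
      ∪ {ω | ¬ ∀ s e n m : ℕ, e ≤ T → m ≤ n → 2 ^ n ≤ T →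
      (((Finset.Ico s e).filter fun u => ((X ω).n u = n ∧ 2 ^ m ∣ (X ω).pos u) ∧
        (X ω).coin u m).card : ℝ) ≤ 7 / 4 * (ρ (2 ^ n) / ρ (2 ^ m))
        * ((Finset.Ico s e).filter fun u => (X ω).n u = n ∧ 2 ^ m ∣ (X ω).pos u).card + 4 * l})
      ∪ {ω | ¬ ∀ n m : ℕ, m ≤ n → 2 ^ n ≤ T →
      ρ (2 ^ n) / ρ (2 ^ m) * ((Finset.range T).filter fun u => (X ω).Cand N n m u).card
      ≤ 2 * (((Finset.range T).filter fun u => (X ω).Cand N n m u ∧ (X ω).coin u m).card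
        + 4 * l)} := by
    intro ω hω
    by_contra hcon
    simp only [Set.mem_union, not_or, Set.mem_ofPred_eq, not_not] at hcon
    exact hω ⟨hcon.1.1, hcon.1.2, hcon.2⟩
  refine (measure_mono hsub).trans ((measure_union_le _ _).trans
    ((add_le_add (measure_union_le _ _) le_rfl).trans ?_))
  refine (add_le_add (add_le_add hreward hcoin) hcand).trans_eq ?_
  push_cast
  ring

end MasterState

/-! ### The expected number of failing guarantees. -/

section Counting

variable {Ω ι : Type*} [MeasurableSpace Ω] {μ : Measure Ω}

open Classical in
theorem lintegral_card_filter (s : Finset ι) {A : ι → Set Ω} (hA : ∀ i, MeasurableSet (A i)) :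
    ∫⁻ ω, ((s.filter fun i => ω ∈ A i).card : ℝ≥0∞) ∂μ = ∑ i ∈ s, μ (A i) := by
  have h : ∀ ω, ((s.filter fun i => ω ∈ A i).card : ℝ≥0∞)
      = ∑ i ∈ s, (A i).indicator (fun _ => 1) ω := by
    intro ω
    simp only [Set.indicator_apply, Finset.sum_boole]
  simp only [h]
  rw [lintegral_finsetSum _ fun i _ => measurable_const.indicator (hA i)]
  exact Finset.sum_congr rfl fun i _ => by rw [lintegral_indicator_const (hA i), one_mul]

open Classical in
-- Integrates a counting inequality; on the exceptional set the trivial count is used. That set is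
-- not assumed measurable, hence the measurable hull.
theorem sum_measure_le_of_card_le [IsProbabilityMeasure μ] (s s' : Finset ι) {A B : ι → Set Ω}
    (hA : ∀ i, MeasurableSet (A i)) (hB : ∀ i, MeasurableSet (B i)) {F : Set Ω}
    (h : ∀ ω ∉ F, (s.filter fun i => ω ∈ A i).card ≤ 1 + (s'.filter fun i => ω ∈ B i).card) :
    ∑ i ∈ s, μ (A i) ≤ 1 + ∑ i ∈ s', μ (B i) + s.card * μ F := by
  rw [← lintegral_card_filter s hA, ← lintegral_card_filter s' hB, ← measure_toMeasurable F]
  set F' := toMeasurable μ F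
  have hF' : MeasurableSet F' := measurableSet_toMeasurable μ F
  have h1 : ∀ ω, ((s.filter fun i => ω ∈ A i).card : ℝ≥0∞)
      ≤ (1 + (s'.filter fun i => ω ∈ B i).card) + F'.indicator (fun _ => (s.card : ℝ≥0∞)) ω := by
    intro ω
    by_cases hω : ω ∈ F'
    · rw [Set.indicator_of_mem hω]
      refine le_trans ?_ le_add_self
      exact_mod_cast Finset.card_filter_le _ _
    · rw [Set.indicator_of_notMem hω, add_zero]
      exact_mod_cast h ω fun h' => hω (subset_toMeasurable μ F h')
  refine (lintegral_mono h1).trans_eq ?_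
  rw [lintegral_add_right _ (measurable_const.indicator hF'), lintegral_add_left measurable_const,
    lintegral_indicator_const hF', lintegral_const, measure_univ, mul_one]

open Classical in
-- Markov's inequality for the number of events that occur.
theorem mul_measure_le_card_le (s : Finset ι) {A : ι → Set Ω} (hA : ∀ i, MeasurableSet (A i))
    (k : ℕ) : (k : ℝ≥0∞) * μ {ω | k ≤ (s.filter fun i => ω ∈ A i).card} ≤ ∑ i ∈ s, μ (A i) := by
  rw [← lintegral_card_filter s hA]
  refine le_trans (le_of_eq ?_) (mul_meas_ge_le_lintegral₀ ?_ (k : ℝ≥0∞))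
  · congr 2
    ext ω
    simp only [Set.mem_ofPred_eq, Nat.cast_le]
  · have h : (fun ω => ((s.filter fun i => ω ∈ A i).card : ℝ≥0∞))
        = fun ω => ∑ i ∈ s, (A i).indicator (fun _ => 1) ω := by
      funext ω
      simp only [Set.indicator_apply, Finset.sum_boole]
    rw [h]
    exact (Finset.measurable_sum _ fun i _ => measurable_const.indicator (hA i)).aemeasurable

end Counting

namespace MasterState

variable {S U Pol O Z : Type*} [MeasurableSpace S] [MeasurableSpace U] [MeasurableSpace Pol]
  [MeasurableSpace O] [MeasurableSpace Z] {A : Learner S U Pol O} {env : ℕ → Pol → Z → O}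
  {rew : O → ℝ} {ρ : ℕ → ℝ} {T : ℕ} {δ : ℝ} {νZ : Measure Z} [IsProbabilityMeasure νZ]
  {νU : Measure U} [IsProbabilityMeasure νU] {Δ ρ₀ : ℕ → ℝ} {L : ℕ}

theorem measurable_viol (hA : A.IsMeasurable) (he : IsEnvironment env rew)
    (hρ : ∀ m, 0 < ρ (2 ^ m)) {f : ℕ → ℝ} (N : NearStationary f ρ T L) (t : ℕ) :
    Measurable fun ω => (toRun A env rew ρ T δ hρ ω).Viol N t :=
  Measurable.and ((measurable_of_countable (N.first (N.lab t) ≤ ·)).comp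
    (measurable_run_instStart ρ T δ hA he hρ t)) (measurable_violates ρ T δ hA he hρ _ _ t)

open Classical in
/-- The probability of a failing guarantee in terms of those of the restarts in the same piece. -/
theorem measure_viol_le (hb : BaseGuarantee νZ νU env rew A T δ Δ ρ₀)
    (he : IsEnvironment env rew) (hA : A.IsMeasurable) (hΔ : ∀ u, u + 1 < T → 0 ≤ Δ u)
    (hρ : ∀ m, 0 < ρ (2 ^ m)) (N : NearStationary (optReward νZ env rew) ρ T L)
    (hN : ∀ s t, s ≤ t → t < T → N.lab s = N.lab t →
      (drift Δ s t ≤ N.d (N.lab s) ∨ 1 ≤ N.d (N.lab s)) ∧ drift Δ s t ≤ ρ₀ (t + 1 - s))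
    (hB : ∀ j : ℕ, 1 ≤ j → j ≤ T → ∀ x ≤ ρ₀ j, min (j : ℝ) (j * (ρ₀ j + x)) ≤ 2 * (j * ρ j))
    {t : ℕ} (ht : t < T) :
    interactionLaw νZ (masterSeed νU) {ω | (toRun A env rew ρ T δ hρ ω).Viol N t}
      ≤ ENNReal.ofReal (δ / T) * (1 + ∑ u ∈ (Finset.range T).filter fun u => N.lab u = N.lab t,
        interactionLaw νZ (masterSeed νU) {ω | Restarts A env rew ρ T δ ω u}) := by
  set μ := interactionLaw νZ (masterSeed νU) with hμ
  set a := N.first (N.lab t) with ha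
  have hat : a ≤ t := N.first_le rfl
  have hla : N.lab a = N.lab t := N.lab_first t
  have hlab : ∀ u, a ≤ u → u ≤ t → N.lab u = N.lab t := fun u h1 h2 => N.lab_eq_of_mem hla h1 h2
  set F := N.base t - 2 * N.d (N.lab t)
  set B : ℕ → ℝ := fun j => 2 * (j * ρ j)
  -- The event that the epoch relevant for round `t` may begin in round `r`: the piece begins there,
  -- or a restart has just happened. It is decided before round `r`.
  set E : ℕ → Set (ℕ → Z × (U × (ℕ → unitInterval))) := fun r =>
    {ω | r = a ∨ Restarts A env rew ρ T δ ω (r - 1)} with hEdef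
  have hEm : ∀ r, MeasurableSet (E r) := fun r =>
    measurableSet_setOfPred.2 (measurable_const.or (measurable_restarts ρ T δ hA he (r - 1)))
  set V : ℕ → Set (ℕ → Z × (U × (ℕ → unitInterval))) := fun r => {ω | ω ∈ E r ∧
        (∀ u, r ≤ u → u < t → ¬ Restarts A env rew ρ T δ ω u) ∧
        r ≤ (toRun A env rew ρ T δ hρ ω).instStart t ∧
        (toRun A env rew ρ T δ hρ ω).Violates F B t} with hVdef
  have hV : ∀ r ∈ Finset.Icc a t, μ (V r) ≤ ENNReal.ofReal (δ / T) * μ (E r) := by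
    intro r hr
    rw [Finset.mem_Icc] at hr
    have hlr := hlab r hr.1 hr.2
    have hd := hN r t hr.2 ht hlr
    have hanti : ∀ j, 1 ≤ j → j ≤ t + 1 - r → drift Δ r t ≤ ρ₀ j := fun j h1 h2 =>
      hd.2.trans (hb.antitone ⟨h1, by omega⟩ ⟨by omega, by omega⟩ h2)
    refine measure_violates_le hb he hA hΔ hρ hr.2 ht ?_ ?_ hanti (hEm r) ?_
    · rw [hlr] at hd
      rcases hd.1 with h1 | h1
      · right
        intro u hu1 hu2
        have h2 := N.base_sub_le (t := u) (by omega)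
        have hlu := hlab u (hr.1.trans hu1) hu2
        rw [N.base_congr hlu, hlu] at h2
        simp only [F]
        linarith
      · left
        have h2 : N.base t ≤ 1 := optReward_le_one he _
        simp only [F]
        linarith
    · exact fun j h1 h2 => hB j h1 (by omega) _ (hanti j h1 h2)
    · intro ω ω' hω hE
      by_cases hra : r = a
      · exact Or.inl hra
      refine Or.inr ?_
      have h1 : Restarts A env rew ρ T δ ω (r - 1) := hE.resolve_left hra
      have e1 : before A env rew ρ T δ ω (r - 1) = before A env rew ρ T δ ω' (r - 1) :=
        Learner.state_congr _ _ fun v hv => hω v (by omega)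
      have e3 : executed A env rew ρ T δ ω (r - 1) = executed A env rew ρ T δ ω' (r - 1) := by
        simp only [executed, scheduled, Learner.feedback, e1, hω (r - 1) (by omega)]
      rw [Restarts, e3] at h1
      exact h1
  have hsub : {ω | (toRun A env rew ρ T δ hρ ω).Viol N t} ⊆ ⋃ r ∈ Finset.Icc a t, V r := by
    intro ω hω
    obtain ⟨h1, h2⟩ := hω
    -- Take the last possible `r`: there is no restart from then until `t`, and the active instance
    -- started no earlier.
    have hne : ((Finset.Icc a t).filter fun r => ω ∈ E r).Nonempty :=
      ⟨a, Finset.mem_filter.2 ⟨Finset.mem_Icc.2 ⟨le_rfl, hat⟩, Or.inl rfl⟩⟩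
    have hmem := Finset.max'_mem _ hne
    set r := Finset.max' _ hne with hr
    rw [Finset.mem_filter, Finset.mem_Icc] at hmem
    refine Set.mem_biUnion (Finset.mem_coe.2 (Finset.mem_Icc.2 hmem.1)) ⟨hmem.2, ?_, ?_, h2⟩
    · intro u hu1 hu2 hrest
      have h3 : u + 1 ∈ (Finset.Icc a t).filter fun r => ω ∈ E r :=
        Finset.mem_filter.2 ⟨Finset.mem_Icc.2 ⟨by omega, hu2⟩, Or.inr hrest⟩
      have := Finset.le_max' _ _ h3
      omega
    · by_cases hra : r = a
      · rw [hra]; exact h1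
      have h3 : Restarts A env rew ρ T δ ω (r - 1) := hmem.2.resolve_left hra
      have h4 := (toRun A env rew ρ T δ hρ ω).restart_succ_le_start (s := r - 1) (t := t)
        (by omega) h3
      have h5 := (toRun A env rew ρ T δ hρ ω).start_le_instStart t
      omega
  calc μ {ω | (toRun A env rew ρ T δ hρ ω).Viol N t} ≤ ∑ r ∈ Finset.Icc a t, μ (V r) :=
        (measure_mono hsub).trans (measure_biUnion_finset_le _ _)
    _ ≤ ∑ r ∈ Finset.Icc a t, ENNReal.ofReal (δ / T) * μ (E r) := Finset.sum_le_sum hV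
    _ = ENNReal.ofReal (δ / T) * ∑ r ∈ Finset.Icc a t, μ (E r) := by rw [Finset.mul_sum]
    _ ≤ _ := by
        gcongr
        have e : Finset.Icc a t = insert a (Finset.Ioc a t) := by
          ext u; simp only [Finset.mem_Icc, Finset.mem_insert, Finset.mem_Ioc]; omega
        rw [e, Finset.sum_insert (by simp)]
        refine add_le_add prob_le_one ?_
        have e2 : ∀ r ∈ Finset.Ioc a t, μ (E r) = μ {ω | Restarts A env rew ρ T δ ω (r - 1)} := by
          intro r hr
          rw [Finset.mem_Ioc] at hr
          simp only [hEdef, show r ≠ a by omega, false_or]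
        rw [Finset.sum_congr rfl e2]
        have e3 : ∀ r ∈ Finset.Ioc a t, r - 1 ∈ (Finset.range T).filter
            fun u => N.lab u = N.lab t := fun r hr => by
          rw [Finset.mem_Ioc] at hr
          exact Finset.mem_filter.2 ⟨Finset.mem_range.2 (by omega), hlab _ (by omega) (by omega)⟩
        rw [← Finset.sum_image (f := fun u => μ {ω | Restarts A env rew ρ T δ ω u})
          (g := fun r => r - 1) (fun x hx y hy hxy => by
            rw [Finset.mem_coe, Finset.mem_Ioc] at hx hy
            simp only at hxy
            omega)]
        exact Finset.sum_le_sum_of_subset (Finset.image_subset_iff.2 e3)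

open Classical in
/-- With high probability the run is typical and few guarantees fail. -/
theorem measure_not_typical_or_viol_le {h l : ℝ} (hδ : 0 < δ) (hδ1 : δ < 1)
    (hb : BaseGuarantee νZ νU env rew A T δ Δ ρ₀)
    (he : IsEnvironment env rew) (hA : A.IsMeasurable) (hΔ : ∀ u, u + 1 < T → 0 ≤ Δ u)
    (hρ : ∀ m, 0 < ρ (2 ^ m)) (N : NearStationary (optReward νZ env rew) ρ T L)
    (H : IsRate ρ (rhoHat ρ T δ) T h l) (hT : 1 ≤ T)
    (hN : ∀ s t, s ≤ t → t < T → N.lab s = N.lab t →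
      (drift Δ s t ≤ N.d (N.lab s) ∨ 1 ≤ N.d (N.lab s)) ∧ drift Δ s t ≤ ρ₀ (t + 1 - s))
    (hB : ∀ j : ℕ, 1 ≤ j → j ≤ T → ∀ x ≤ ρ₀ j, min (j : ℝ) (j * (ρ₀ j + x)) ≤ 2 * (j * ρ j))
    (hsize : ∀ j, 4 * ((Finset.range T).filter fun u => N.lab u = j).card ≤ 3 * T)
    (hX : interactionLaw νZ (masterSeed νU) {ω | ¬ (toRun A env rew ρ T δ hρ ω).Typical N l}
      ≤ ENNReal.ofReal (δ / (2 * T))) :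
    interactionLaw νZ (masterSeed νU) {ω | ¬ ((toRun A env rew ρ T δ hρ ω).Typical N l ∧
      ((Finset.range T).filter ((toRun A env rew ρ T δ hρ ω).Viol N)).card ≤ 23)}
      ≤ ENNReal.ofReal δ := by
  have hT0 : (0 : ℝ) < T := by exact_mod_cast hT
  set μ := interactionLaw νZ (masterSeed νU) with hμ
  set Rs : ℕ → Set (ℕ → Z × (U × (ℕ → unitInterval))) :=
    fun u => {ω | Restarts A env rew ρ T δ ω u} with hRs
  set Vs : ℕ → Set (ℕ → Z × (U × (ℕ → unitInterval))) :=
    fun u => {ω | (toRun A env rew ρ T δ hρ ω).Viol N u} with hVs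
  have hRm : ∀ u, MeasurableSet (Rs u) := fun u =>
    measurableSet_setOfPred.2 (measurable_restarts ρ T δ hA he u)
  have hVm : ∀ u, MeasurableSet (Vs u) := fun u =>
    measurableSet_setOfPred.2 (measurable_viol hA he hρ N u)
  set I : ℕ → Finset ℕ := fun j => (Finset.range T).filter fun u => N.lab u = j with hI
  -- Restarts and failures in a piece control each other's expected number.
  have hpiece : ∀ j, ∑ t ∈ I j, μ (Vs t) ≤ ENNReal.ofReal (12 * δ / T * (I j).card) := by
    intro j
    set F := {ω | ¬ (toRun A env rew ρ T δ hρ ω).Typical N l}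
    have h1 : ∑ u ∈ I j, μ (Rs u) ≤ 1 + ∑ t ∈ I j, μ (Vs t) + (I j).card * μ F := by
      refine sum_measure_le_of_card_le (I j) (I j) hRm hVm fun ω hω => ?_
      have hX' : (toRun A env rew ρ T δ hρ ω).Typical N l := not_not.1 hω
      have h2 := (toRun A env rew ρ T δ hρ ω).card_restart_le N H hX' (fun u => hb.est_mem _ _)
        (fun u => he.rew_mem _) (S := (I j).filter fun i => ω ∈ Rs i) fun t ht => by
          rw [Finset.mem_filter, Finset.mem_filter, Finset.mem_range] at ht
          exact ⟨ht.1.1, ht.2⟩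
      have him : ((I j).filter fun i => ω ∈ Rs i).image N.lab ⊆ {j} := by
        intro k hk
        obtain ⟨u, hu, rfl⟩ := Finset.mem_image.1 hk
        rw [Finset.mem_filter, Finset.mem_filter] at hu
        exact Finset.mem_singleton.2 hu.1.2
      refine h2.trans (Nat.add_le_add ((Finset.card_le_card him).trans_eq
        (Finset.card_singleton j)) (Finset.card_le_card fun u hu => ?_))
      rw [Finset.mem_filter] at hu
      exact Finset.mem_filter.2 ⟨Finset.mem_filter.2 ⟨hu.1, Finset.mem_singleton.1 (him hu.2.2)⟩,
        hu.2.1⟩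
    have h2 : ∑ t ∈ I j, μ (Vs t)
        ≤ (I j).card * (ENNReal.ofReal (δ / T) * (1 + ∑ u ∈ I j, μ (Rs u))) := by
      refine (Finset.sum_le_card_nsmul _ _ _ fun t ht => ?_).trans_eq (nsmul_eq_mul _ _)
      rw [Finset.mem_filter, Finset.mem_range] at ht
      have := measure_viol_le hb he hA hΔ hρ N hN hB ht.1
      rwa [ht.2] at this
    have hfin : ∀ (A : ℕ → Set (ℕ → Z × (U × (ℕ → unitInterval)))), ∑ t ∈ I j, μ (A t) ≠ ∞ :=
      fun A => (ENNReal.sum_lt_top.2 fun t _ => measure_lt_top _ _).ne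
    set x := ∑ u ∈ I j, μ (Rs u) with hx
    set v := ∑ u ∈ I j, μ (Vs u) with hv
    have hxf : x ≠ ∞ := hfin _
    have hvf : v ≠ ∞ := hfin _
    set c : ℝ := ((I j).card : ℝ) with hc
    have hc0 : 0 ≤ c := Nat.cast_nonneg _
    have hcT : 4 * c ≤ 3 * T := by
      rw [hc]; exact_mod_cast hsize j
    have hq : (((I j).card : ℕ) : ℝ≥0∞) = ENNReal.ofReal c := by
      rw [hc, ENNReal.ofReal_natCast]
    have h3 : x.toReal ≤ 1 + v.toReal + c * (δ / (2 * T)) := by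
      have h4 : x ≤ ENNReal.ofReal (1 + v.toReal + c * (δ / (2 * T))) := by
        refine h1.trans ?_
        rw [ENNReal.ofReal_add (by positivity) (by positivity), ENNReal.ofReal_add zero_le_one
          ENNReal.toReal_nonneg, ENNReal.ofReal_one, ENNReal.ofReal_toReal hvf,
          ENNReal.ofReal_mul hc0, hq]
        gcongr
      exact ENNReal.toReal_le_of_le_ofReal (by positivity) h4
    have h5 : v.toReal ≤ c * (δ / T * (1 + x.toReal)) := by
      refine ENNReal.toReal_le_of_le_ofReal (by positivity) (h2.trans_eq ?_)
      rw [ENNReal.ofReal_mul hc0, ENNReal.ofReal_mul (by positivity),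
        ENNReal.ofReal_add zero_le_one ENNReal.toReal_nonneg, ENNReal.ofReal_one,
        ENNReal.ofReal_toReal hxf, hq]
    rw [← ENNReal.ofReal_toReal hvf]
    refine ENNReal.ofReal_le_ofReal ?_
    -- With `w = y * δ ≤ 3 / 4`, the two inequalities give `v ≤ w * (2 + v + w / 2)`. As `1 - w ≥ 1
    -- / 4`, solving for `v` yields `v ≤ 9.5 w`, below `12 w`. The bound on the size of the piece
    -- keeps `1 - w` away from zero even for `δ` close to `1`.
    set y := c / T with hy
    have hy0 : 0 ≤ y := by positivity
    have hy1 : y ≤ 3 / 4 := by rw [hy, div_le_iff₀ hT0]; linarith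
    have e1 : c * (δ / (2 * T)) = y * δ / 2 := by rw [hy]; field_simp
    have e2 : c * (δ / T * (1 + x.toReal)) = y * δ * (1 + x.toReal) := by rw [hy]; ring
    have e3 : 12 * δ / T * c = 12 * (y * δ) := by rw [hy]; ring
    rw [e1] at h3
    rw [e2] at h5
    rw [e3]
    have hv0 : 0 ≤ v.toReal := ENNReal.toReal_nonneg
    have hw0 : 0 ≤ y * δ := by positivity
    have hw1 : y * δ ≤ 3 / 4 := by nlinarith
    nlinarith
  have htotal : ∑ t ∈ Finset.range T, μ (Vs t) ≤ ENNReal.ofReal (12 * δ) := by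
    rw [← Finset.sum_fiberwise_of_maps_to (g := N.lab) (t := (Finset.range T).image N.lab)
      fun t ht => Finset.mem_image_of_mem _ ht]
    refine (Finset.sum_le_sum fun j _ => hpiece j).trans_eq ?_
    rw [← ENNReal.ofReal_sum_of_nonneg fun j _ => by positivity, ← Finset.mul_sum]
    congr 1
    have := Finset.card_eq_sum_card_image N.lab (Finset.range T)
    rw [Finset.card_range] at this
    have h1 : ∑ j ∈ (Finset.range T).image N.lab, ((I j).card : ℝ) = T := by
      exact_mod_cast this.symm
    rw [h1]
    field_simp
  -- Markov at level `24`: an expectation of at most `12 δ` leaves probability at most `δ / 2`.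
  have hmarkov : μ {ω | 24 ≤ ((Finset.range T).filter fun i => ω ∈ Vs i).card}
      ≤ ENNReal.ofReal (δ / 2) := by
    have h1 := (mul_measure_le_card_le (μ := μ) (Finset.range T) hVm 24).trans htotal
    have e : ENNReal.ofReal (12 * δ) = ((24 : ℕ) : ℝ≥0∞) * ENNReal.ofReal (δ / 2) := by
      rw [← ENNReal.ofReal_natCast, ← ENNReal.ofReal_mul (by norm_num)]
      congr 1
      push_cast
      ring
    rw [e] at h1
    exact (ENNReal.mul_le_mul_iff_right (by norm_num) (ENNReal.natCast_ne_top 24)).1 h1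
  have hsub : {ω | ¬ ((toRun A env rew ρ T δ hρ ω).Typical N l ∧
      ((Finset.range T).filter ((toRun A env rew ρ T δ hρ ω).Viol N)).card ≤ 23)}
      ⊆ {ω | ¬ (toRun A env rew ρ T δ hρ ω).Typical N l}
        ∪ {ω | 24 ≤ ((Finset.range T).filter fun i => ω ∈ Vs i).card} := by
    intro ω hω
    rw [Set.mem_ofPred_eq, not_and_or, not_le] at hω
    exact hω
  refine (measure_mono hsub).trans ((measure_union_le _ _).trans
    ((add_le_add hX hmarkov).trans ?_))
  rw [← ENNReal.ofReal_add (by positivity) (by positivity)]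
  refine ENNReal.ofReal_le_ofReal ?_
  have : δ / (2 * T) ≤ δ / 2 := by
    refine div_le_div_of_nonneg_left hδ.le (by norm_num) ?_
    have : (1 : ℝ) ≤ T := by exact_mod_cast hT
    linarith
  linarith

end MasterState

/-! ### The regret bound for a given division of the rounds. -/

section Drift

variable {Pol O Z : Type*} [MeasurableSpace Pol] [MeasurableSpace O]
  [MeasurableSpace Z] {νZ : Measure Z} [IsProbabilityMeasure νZ] {env : ℕ → Pol → Z → O}
  {rew : O → ℝ} {T : ℕ} {Δ : ℕ → ℝ}

theorem optReward_nonneg (he : IsEnvironment env rew) (t : ℕ) : 0 ≤ optReward νZ env rew t :=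
  Real.iSup_nonneg fun π => (meanReward_mem he t π).1

theorem abs_optReward_sub_le [Nonempty Pol] (he : IsEnvironment env rew)
    (hΔ : IsNonstationarity νZ env rew T Δ) {s t : ℕ} (hst : s ≤ t) (ht : t < T) :
    |optReward νZ env rew s - optReward νZ env rew t| ≤ drift Δ s t := by
  induction t, hst using Nat.le_induction with
  | base => simp [drift]
  | succ t hst ih =>
    have h1 := ih (by omega)
    have h2 : |optReward νZ env rew t - optReward νZ env rew (t + 1)| ≤ Δ t := by
      have h3 : optReward νZ env rew t ≤ optReward νZ env rew (t + 1) + Δ t := ciSup_le fun π => by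
        have h4 := abs_le.1 (hΔ t ht π)
        have h5 := meanReward_le_optReward (νZ := νZ) he (t + 1) π
        linarith [h4.2]
      have h6 : optReward νZ env rew (t + 1) ≤ optReward νZ env rew t + Δ t := ciSup_le fun π => by
        have h4 := abs_le.1 (hΔ t ht π)
        have h5 := meanReward_le_optReward (νZ := νZ) he t π
        linarith [h4.1]
      rw [abs_le]
      constructor <;> linarith
    have h3 : drift Δ s (t + 1) = drift Δ s t + Δ t := Finset.sum_Ico_succ_top hst _
    rw [h3]
    exact (abs_sub_le _ (optReward νZ env rew t) _).trans (add_le_add h1 h2)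

omit [MeasurableSpace Pol] [MeasurableSpace O] [IsProbabilityMeasure νZ] in
theorem IsNonstationarity.nonneg [Nonempty Pol] (hΔ : IsNonstationarity νZ env rew T Δ) {u : ℕ}
    (hu : u + 1 < T) : 0 ≤ Δ u :=
  (abs_nonneg _).trans (hΔ u hu (Classical.arbitrary Pol))

end Drift

/-- Cutting the horizon in half costs one more label and makes every piece at most `(T + 1) / 2`
long, which is at most `3T / 4` for `T ≥ 2`. -/
theorem card_filter_add_ite_le {lab : ℕ → ℕ} (hlab : Monotone lab) {T : ℕ} (hT : 2 ≤ T) (j : ℕ) :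
    4 * ((Finset.range T).filter fun t => lab t + (if T ≤ 2 * t then 1 else 0) = j).card
      ≤ 3 * T := by
  by_cases h : ∃ t < T, 2 * t < T ∧ lab t + (if T ≤ 2 * t then 1 else 0) = j
  · obtain ⟨t, htT, ht2, ht⟩ := h
    rw [if_neg (by omega)] at ht
    have hsub : ((Finset.range T).filter fun t => lab t + (if T ≤ 2 * t then 1 else 0) = j)
        ⊆ Finset.range ((T + 1) / 2) := by
      intro s hs
      rw [Finset.mem_filter, Finset.mem_range] at hs
      rw [Finset.mem_range]
      by_contra hcon
      have hle : T ≤ 2 * s := by omega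
      rw [if_pos hle] at hs
      have := hlab (show t ≤ s by omega)
      omega
    have := Finset.card_le_card hsub
    rw [Finset.card_range] at this
    omega
  · push Not at h
    have hsub : ((Finset.range T).filter fun t => lab t + (if T ≤ 2 * t then 1 else 0) = j)
        ⊆ Finset.Ico (T / 2) T := by
      intro s hs
      rw [Finset.mem_filter, Finset.mem_range] at hs
      rw [Finset.mem_Ico]
      refine ⟨?_, hs.1⟩
      by_contra hcon
      exact h s hs.1 (by omega) hs.2
    have := Finset.card_le_card hsub
    rw [Nat.card_Ico] at this
    omega

theorem ten_mul_log_sq_le {T : ℕ} (hT : 2 ^ 14 ≤ T) : 10 * (Nat.log 2 T + 1) ^ 2 ≤ T := by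
  have h1 : ∀ k, 14 ≤ k → 10 * (k + 1) ^ 2 ≤ 2 ^ k := by
    intro k hk
    induction k, hk using Nat.le_induction with
    | base => norm_num
    | succ k hk ih => rw [pow_succ 2 k]; nlinarith
  have h2 : 14 ≤ Nat.log 2 T := (Nat.le_log_iff_pow_le (by norm_num) (by omega)).2 hT
  exact (h1 _ h2).trans (Nat.pow_log_le_self 2 (by omega))

/-- Each event has probability at most `(δ / T) ^ 4`, and there are at most `T ^ 3 / 2` of them. The
extra `1 / T` is needed because atypical runs are charged up to one restart per round. -/
theorem card_mul_exp_le {T : ℕ} {δ : ℝ} (hT : 2 ^ 14 ≤ T) (hδ : 0 < δ) (hδ1 : δ < 1) {K : ℕ}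
    (hK : K = Nat.log 2 T + 1) :
    ((T * (T + 1) + T * (T + 1) * (K * K) + K * K : ℕ) : ℝ)
      * Real.exp (-(4 * Real.log (T / δ))) ≤ δ / (2 * T) := by
  have hT1 : (1 : ℝ) ≤ T := by
    have : 1 ≤ T := by omega
    exact_mod_cast this
  have hT0 : (0 : ℝ) < T := by linarith
  have e : Real.exp (-(4 * Real.log (T / δ))) = (δ / T) ^ 4 := by
    have h0 : (0 : ℝ) < T / δ := by positivity
    have : -(4 * Real.log (T / δ)) = (4 : ℕ) * Real.log (δ / T) := by
      rw [← inv_div δ (T : ℝ), Real.log_inv]; push_cast; ring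
    rw [this, Real.exp_nat_mul, Real.exp_log (by positivity)]
  have hK1 : (1 : ℝ) ≤ K := by
    have : 1 ≤ K := by omega
    exact_mod_cast this
  have hKT : 10 * (K : ℝ) ^ 2 ≤ T := by
    have := ten_mul_log_sq_le hT
    rw [← hK] at this
    exact_mod_cast this
  have h1 : ((T * (T + 1) + T * (T + 1) * (K * K) + K * K : ℕ) : ℝ) ≤ T ^ 3 / 2 := by
    push_cast
    have h2 : (T : ℝ) * (T + 1) ≤ 2 * T ^ 2 := by nlinarith
    have h3 : (1 : ℝ) ≤ K * K := by nlinarith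
    have h4 : (T : ℝ) * (T + 1) * (K * K) ≤ 2 * T ^ 2 * (K * K) := by gcongr
    have h5 : (1 : ℝ) ≤ T ^ 2 := by nlinarith
    have h6 : (T : ℝ) ^ 2 * (10 * (K : ℝ) ^ 2) ≤ T ^ 2 * T := by gcongr
    have h7 : (T : ℝ) ^ 2 * 1 ≤ T ^ 2 * (K * K) := by gcongr
    have h8 : (1 : ℝ) * (K * K) ≤ T ^ 2 * (K * K) := by gcongr
    linarith
  rw [e]
  calc _ ≤ (T : ℝ) ^ 3 / 2 * (δ / T) ^ 4 := by gcongr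
    _ = δ ^ 4 / (2 * T) := by field_simp
    _ ≤ δ / (2 * T) := by
        gcongr
        calc δ ^ 4 ≤ δ ^ 1 := pow_le_pow_of_le_one hδ.le hδ1.le (by norm_num)
          _ = δ := pow_one δ

namespace MasterState

variable {S U Pol O Z : Type*} [MeasurableSpace S] [MeasurableSpace U] [MeasurableSpace Pol]
  [MeasurableSpace O] [MeasurableSpace Z] {A : Learner S U Pol O} {env : ℕ → Pol → Z → O}
  {rew : O → ℝ} {T : ℕ} {δ : ℝ} {νZ : Measure Z} [IsProbabilityMeasure νZ]
  {νU : Measure U} [IsProbabilityMeasure νU] {Δ ρ₀ : ℕ → ℝ} {L : ℕ} {c₁ c₂ p : ℝ}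

/-- The regret bound for a division of the rounds into nearly stationary pieces. -/
theorem regret_bound (h1 : 0 < c₁) (h2 : 0 < c₂) (hp : 1 / 2 ≤ p) (hp1 : p < 1)
    (hT : 2 ^ 14 ≤ T) (hδ : 0 < δ) (hδ1 : δ < 1)
    (he : IsEnvironment env rew) (hA : A.IsMeasurable) (hns : IsNonstationarity νZ env rew T Δ)
    (hb : BaseGuarantee νZ νU env rew A T δ Δ ρ₀)
    (hρ₀ : ∀ t ∈ Set.Icc 1 T, (t : ℝ) * ρ₀ t = c₁ * (t : ℝ) ^ p + c₂)
    {lab : ℕ → ℕ} (hlab : Monotone lab) (hL : ∀ t < T, lab t < L) {θ : ℝ}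
    (hθ : ∀ s t, s ≤ t → t < T → lab s = lab t → drift Δ s t ≤ θ ∧ θ ≤ ρ₀ (t + 1 - s)) :
    1 - δ ≤ (interactionLaw νZ (masterSeed νU)).real {ω |
      dynamicRegret νZ env rew (master A rew (cappedRate c₁ c₂ p) T δ) T ω
        ≤ 70000 * (Real.logb 2 T + 1) ^ 4 * Real.log (T / δ) ^ 2
          * piecesBound c₁ c₂ p T ((L + 1 : ℕ) : ℝ)} := by
  classical
  have : Nonempty Pol := by
    have : Nonempty U := νU.nonempty_of_neZero
    exact ⟨A.policy A.init (Classical.arbitrary U)⟩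
  have hT1 : 1 ≤ T := by omega
  set ρ := cappedRate c₁ c₂ p with hρdef
  have hρ : ∀ m, 0 < ρ (2 ^ m) := fun m => cappedRate_pos h1 h2 Nat.one_le_two_pow
  have hρ₀pos : ∀ j : ℕ, 1 ≤ j → j ≤ T → (j : ℝ) * ρ j = min (j * ρ₀ j) j := fun j hj hjT => by
    rw [hρdef, mul_cappedRate hj, hρ₀ j ⟨hj, hjT⟩]
  have hmin : ∀ j : ℕ, 1 ≤ j → j ≤ T → ρ j = min (ρ₀ j) 1 := fun j hj hjT => by
    have hj0 : (0 : ℝ) < j := by exact_mod_cast hj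
    refine mul_left_cancel₀ hj0.ne' ?_
    rw [hρ₀pos j hj hjT, mul_min_of_nonneg _ _ hj0.le, mul_one]
  have H : IsRate ρ (rhoHat ρ T δ) T (Real.logb 2 T + 1) (Real.log (T / δ)) := by
    refine isRate_cappedRate h1 h2 hp hp1 hT hδ hδ1 fun t ht htT => ?_
    have ht0 : (0 : ℝ) < t := by exact_mod_cast ht
    rw [← hρ₀ t ⟨ht, htT⟩]
    have h3 := mul_le_mul_of_nonneg_left (hb.lower t ⟨ht, htT⟩) ht0.le
    rwa [mul_one_div, Real.div_sqrt] at h3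
  -- The division is refined at the middle of the horizon so that no piece exceeds `3T / 4` rounds.
  set lab' : ℕ → ℕ := fun t => lab t + if T ≤ 2 * t then 1 else 0 with hlab'
  have hmono' : Monotone lab' := by
    intro s t hst
    have := hlab hst
    simp only [hlab']
    split_ifs <;> omega
  have hof : ∀ s t, s ≤ t → lab' s = lab' t → lab s = lab t := by
    intro s t hst h
    have := hlab hst
    simp only [hlab'] at h
    split_ifs at h <;> omega
  have hΔ0 : ∀ u, u + 1 < T → 0 ≤ Δ u := fun u hu => hns.nonneg hu
  let N : NearStationary (optReward νZ env rew) ρ T (L + 1) :=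
    { lab := lab'
      -- Capped like the rate; optimal rewards lie in `[0, 1]`, so they never vary by more than `1`.
      d := fun _ => min θ 1
      mono := hmono'
      lab_lt := fun t ht => by
        have := hL t ht
        simp only [hlab']
        split_ifs <;> omega
      sub_le := fun s t hs ht h => by
        have h3 := optReward_le_one (νZ := νZ) he s
        have h4 := optReward_nonneg (νZ := νZ) he t
        refine le_min ?_ (by linarith)
        rcases le_total s t with hst | hst
        · exact (le_abs_self _).trans ((abs_optReward_sub_le he hns hst ht).trans
            (hθ s t hst ht (hof s t hst h)).1)
        · rw [← neg_sub]
          exact (neg_le_abs _).trans ((abs_optReward_sub_le he hns hst hs).trans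
            (hθ t s hst hs (hof t s hst h.symm)).1)
      d_le := fun s t hst ht h => by
        rw [hmin (t + 1 - s) (by omega) (by omega)]
        exact min_le_min_right _ (hθ s t hst ht (hof s t hst h)).2 }
  -- Below the cap, the drift is at most the rate and doubles it at worst; above the cap, the
  -- trivial bound `j` applies.
  have hB : ∀ j : ℕ, 1 ≤ j → j ≤ T → ∀ x ≤ ρ₀ j, min (j : ℝ) (j * (ρ₀ j + x)) ≤ 2 * (j * ρ j) := by
    intro j hj hjT x hx
    have hj0 : (0 : ℝ) ≤ j := Nat.cast_nonneg j
    rw [hρ₀pos j hj hjT]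
    rcases le_total ((j : ℝ) * ρ₀ j) j with h | h
    · rw [min_eq_left h]
      refine (min_le_right _ _).trans ?_
      nlinarith
    · rw [min_eq_right h]
      exact (min_le_left _ _).trans (by linarith)
  have htyp : interactionLaw νZ (masterSeed νU) {ω | ¬ (toRun A env rew ρ T δ hρ ω).Typical N
      (Real.log (T / δ))} ≤ ENNReal.ofReal (δ / (2 * T)) := by
    refine (measure_not_typical_le νZ νU hA he hρ N H (K := Nat.log 2 T + 1) fun n hn => ?_).trans ?_
    · rw [Nat.lt_succ_iff, Nat.le_log_iff_pow_le (by norm_num) (by omega)]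
      exact hn
    · rw [← ENNReal.ofReal_natCast, ← ENNReal.ofReal_mul (Nat.cast_nonneg _)]
      exact ENNReal.ofReal_le_ofReal (card_mul_exp_le hT hδ hδ1 rfl)
  have hmain := measure_not_typical_or_viol_le hδ hδ1 hb he hA hΔ0 hρ N H hT1
    (fun s t hst ht h => by
      have h3 := hθ s t hst ht (hof s t hst h)
      refine ⟨?_, h3.1.trans h3.2⟩
      rcases le_total θ 1 with h4 | h4
      · exact Or.inl (h3.1.trans (min_eq_left h4).ge)
      · exact Or.inr (min_eq_right h4).ge) hB
    (card_filter_add_ite_le hlab (by omega)) htyp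
  set G : Set (ℕ → Z × (U × (ℕ → unitInterval))) := {ω |
      dynamicRegret νZ env rew (master A rew ρ T δ) T ω
        ≤ 70000 * (Real.logb 2 T + 1) ^ 4 * Real.log (T / δ) ^ 2
          * piecesBound c₁ c₂ p T ((L + 1 : ℕ) : ℝ)} with hG
  have hcompl : interactionLaw νZ (masterSeed νU) Gᶜ ≤ ENNReal.ofReal δ := by
    refine (measure_mono fun ω hω => ?_).trans hmain
    rw [Set.mem_ofPred_eq]
    rintro ⟨hX, hV⟩
    exact hω ((toRun A env rew ρ T δ hρ ω).regret_le_piecesBound h1 h2 hp hp1 H hT1 hX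
      (fun u => hb.est_mem _ _) (fun u => he.rew_mem _) (fun u => optReward_le_one he u) hV)
  have h3 : (interactionLaw νZ (masterSeed νU)).real Gᶜ ≤ δ :=
    ENNReal.toReal_le_of_le_ofReal hδ.le hcompl
  have h4 : (interactionLaw νZ (masterSeed νU)).real Set.univ
      ≤ (interactionLaw νZ (masterSeed νU)).real G
        + (interactionLaw νZ (masterSeed νU)).real Gᶜ := by
    rw [← Set.union_compl_self G]
    exact measureReal_union_le _ _
  rw [probReal_univ] at h4
  linarith

end MasterState

/-! ### Divisions by stationarity and by drift. -/

section Partitions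

variable {T : ℕ} {Δ ρ₀ : ℕ → ℝ} {c₁ c₂ p : ℝ}

open Classical in
/-- The division into stationary pieces. -/
theorem exists_lab_pieces (hρ₀ : ∀ j, 1 ≤ j → j ≤ T → 0 ≤ ρ₀ j) :
    ∃ lab : ℕ → ℕ, Monotone lab ∧ (∀ t < T, lab t < pieces Δ T) ∧
      ∀ s t, s ≤ t → t < T → lab s = lab t → drift Δ s t ≤ 0 ∧ 0 ≤ ρ₀ (t + 1 - s) := by
  refine ⟨fun t => ((Finset.range t).filter fun u => Δ u ≠ 0).card, fun s t h => ?_,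
    fun t ht => ?_, fun s t hst ht h => ⟨?_, hρ₀ _ (by omega) (by omega)⟩⟩
  · exact Finset.card_le_card (Finset.filter_subset_filter _ (Finset.range_subset_range.2 h))
  · have h1 : ((Finset.range t).filter fun u => Δ u ≠ 0).card
        ≤ ((Finset.range (T - 1)).filter fun u => Δ u ≠ 0).card :=
      Finset.card_le_card (Finset.filter_subset_filter _ (Finset.range_subset_range.2 (by omega)))
    rw [pieces]
    simp only
    omega
  · have hsub : (Finset.range s).filter (fun u => Δ u ≠ 0)
        ⊆ (Finset.range t).filter fun u => Δ u ≠ 0 :=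
      Finset.filter_subset_filter _ (Finset.range_subset_range.2 hst)
    have heq := Finset.eq_of_subset_of_card_le hsub h.ge
    refine (Finset.sum_eq_zero fun u hu => ?_).le
    rw [Finset.mem_Ico] at hu
    by_contra hne
    have : u ∈ (Finset.range t).filter fun u => Δ u ≠ 0 :=
      Finset.mem_filter.2 ⟨Finset.mem_range.2 hu.2, hne⟩
    rw [← heq, Finset.mem_filter, Finset.mem_range] at this
    omega

/-- The number of nearly stationary pieces for a total drift `D`. -/
noncomputable def driftPieces (c₁ p T D : ℝ) : ℝ := (T ^ (1 - p) * D / c₁) ^ (1 / (2 - p))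

/-- A division into nearly stationary pieces. -/
theorem exists_lab_drift (h1 : 0 < c₁) (hp : 1 / 2 ≤ p) (hp1 : p < 1) (hT : 1 ≤ T)
    (hΔ : ∀ u, u + 1 < T → 0 ≤ Δ u)
    (hρ₀ : ∀ j : ℕ, 1 ≤ j → j ≤ T → c₁ * (j : ℝ) ^ (p - 1) ≤ ρ₀ j) :
    ∃ (lab : ℕ → ℕ) (L : ℕ) (θ : ℝ), Monotone lab ∧ (∀ t < T, lab t < L) ∧
      (∀ s t, s ≤ t → t < T → lab s = lab t → drift Δ s t ≤ θ ∧ θ ≤ ρ₀ (t + 1 - s)) ∧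
      (L : ℝ) ≤ 1 + 3 * driftPieces c₁ p T (drift Δ 0 (T - 1)) := by
  have hpos : ∀ j : ℕ, 1 ≤ j → j ≤ T → 0 ≤ ρ₀ j := fun j hj hjT =>
    le_trans (by positivity) (hρ₀ j hj hjT)
  have hT0 : (0 : ℝ) < T := by exact_mod_cast hT
  set D := drift Δ 0 (T - 1) with hD
  have hdD : ∀ s t, s ≤ t → t < T → drift Δ s t ≤ D := fun s t _ ht =>
    drift_mono hΔ (Nat.zero_le s) (by omega) (by omega)
  have hd0 : ∀ s t, t < T → 0 ≤ drift Δ s t := fun s t ht => Finset.sum_nonneg fun u hu => by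
    rw [Finset.mem_Ico] at hu
    exact hΔ u (by omega)
  have hD0 : 0 ≤ D := hd0 _ _ (by omega)
  have hY0 : 0 ≤ driftPieces c₁ p T D := by rw [driftPieces]; positivity
  rcases hD0.eq_or_lt with hDz | hDp
  · refine ⟨fun _ => 0, 1, 0, monotone_const, fun _ _ => Nat.one_pos,
      fun s t hst ht _ => ⟨(hdD s t hst ht).trans hDz.ge, hpos _ (by omega) (by omega)⟩, ?_⟩
    push_cast
    linarith
  set Y := driftPieces c₁ p T D with hY
  have h2p : 0 < 2 - p := by linarith
  have hYp : 0 < Y := by rw [hY, driftPieces]; positivity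
  have hYpow : Y ^ (2 - p) = (T : ℝ) ^ (1 - p) * D / c₁ := by
    rw [hY, driftPieces, ← Real.rpow_mul (by positivity), one_div_mul_cancel h2p.ne',
      Real.rpow_one]
  set w := T / Y with hw
  have hw0 : 0 < w := by positivity
  have hTw : T / w = Y := by rw [hw]; field_simp
  -- If `w < 1`, then `T ≤ Y` and single rounds, which have no internal drift, are few enough.
  rcases lt_or_ge w 1 with hw1 | hw1
  · refine ⟨id, T, 0, monotone_id, fun t ht => ht, fun s t hst ht h => ?_, ?_⟩
    · simp only [id] at h
      subst h
      exact ⟨by simp [drift], hpos _ (by omega) (by omega)⟩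
    · have : (T : ℝ) ≤ Y := by
        rw [← hTw, le_div_iff₀ hw0]
        nlinarith
      linarith
  -- A window inside a piece has fewer than `w + 1 ≤ 2 * w` rounds, so `θ` is at most its rate. The
  -- exponent in `driftPieces` balances the number `T / w = Y` of time slices against `D / θ ≤ 2 *
  -- Y`.
  set θ := c₁ * (2 * w) ^ (p - 1) with hθ
  have hθ0 : 0 < θ := by positivity
  have hDθ : D / θ ≤ 2 * Y := by
    have e1 : D = c₁ * Y ^ (2 - p) * (T : ℝ) ^ (p - 1) := by
      rw [hYpow]
      have : (T : ℝ) ^ (1 - p) * (T : ℝ) ^ (p - 1) = 1 := by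
        rw [← Real.rpow_add hT0]; norm_num
      calc D = D * ((T : ℝ) ^ (1 - p) * (T : ℝ) ^ (p - 1)) := by rw [this, mul_one]
        _ = _ := by field_simp
    have e2 : θ = c₁ * (2 ^ (p - 1) * ((T : ℝ) ^ (p - 1) / Y ^ (p - 1))) := by
      rw [hθ, Real.mul_rpow (by norm_num) hw0.le, hw, Real.div_rpow hT0.le hYp.le]
    have e3 : Y ^ (2 - p) * Y ^ (p - 1) = Y := by
      rw [← Real.rpow_add hYp]; norm_num
    have e4 : (1 / 2 : ℝ) ≤ 2 ^ (p - 1) := by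
      calc (1 / 2 : ℝ) = 2 ^ (-1 : ℝ) := by rw [Real.rpow_neg_one]; norm_num
        _ ≤ 2 ^ (p - 1) := Real.rpow_le_rpow_of_exponent_le (by norm_num) (by linarith)
    rw [div_le_iff₀ hθ0, e2]
    have hYq : 0 < Y ^ (p - 1) := by positivity
    have e5 : D = c₁ * (T : ℝ) ^ (p - 1) * (Y / Y ^ (p - 1)) := by
      have e7 : Y / Y ^ (p - 1) = Y ^ (2 - p) := by rw [div_eq_iff hYq.ne', e3]
      rw [e1, e7]; ring
    have e6 : 2 * Y * (c₁ * (2 ^ (p - 1) * ((T : ℝ) ^ (p - 1) / Y ^ (p - 1))))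
        = (2 * 2 ^ (p - 1)) * (c₁ * (T : ℝ) ^ (p - 1) * (Y / Y ^ (p - 1))) := by field_simp
    rw [e6, ← e5]
    nlinarith
  -- Truncated because `Δ` has no known sign outside the horizon, while the labels have to be
  -- monotone on all of `ℕ`.
  set dr : ℕ → ℝ := fun t => drift Δ 0 (min t (T - 1)) with hdr
  have hdrm : Monotone dr := fun s t hst =>
    drift_mono hΔ le_rfl (min_le_min_right _ hst) (by omega)
  have hdr0 : ∀ t, 0 ≤ dr t := fun t => hd0 _ _ (by omega)
  have hm1 : Monotone fun t : ℕ => ⌊(t : ℝ) / w⌋₊ := fun s t hst =>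
    Nat.floor_mono (div_le_div_of_nonneg_right (Nat.cast_le.2 hst) hw0.le)
  have hm2 : Monotone fun t : ℕ => ⌊dr t / θ⌋₊ := fun s t hst =>
    Nat.floor_mono (div_le_div_of_nonneg_right (hdrm hst) hθ0.le)
  have hlt : ∀ {x y z : ℝ}, 0 ≤ x → 0 < z → ⌊x / z⌋₊ = ⌊y / z⌋₊ → y - x < z := by
    intro x y z hx hz h
    have i3 := Nat.lt_floor_add_one (y / z)
    have i4 := Nat.floor_le (div_nonneg hx hz.le)
    rw [← h] at i3
    have : y / z < x / z + 1 := by linarith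
    rw [div_add_one hz.ne', div_lt_div_iff_of_pos_right hz] at this
    linarith
  refine ⟨fun t => ⌊(t : ℝ) / w⌋₊ + ⌊dr t / θ⌋₊, ⌊(T : ℝ) / w⌋₊ + ⌊D / θ⌋₊ + 1, θ,
    fun s t hst => Nat.add_le_add (hm1 hst) (hm2 hst), fun t ht => ?_, fun s t hst ht h => ?_, ?_⟩
  · have i1 := hm1 ht.le
    have i2 : ⌊dr t / θ⌋₊ ≤ ⌊D / θ⌋₊ := Nat.floor_mono
      (div_le_div_of_nonneg_right (hdD _ _ (Nat.zero_le _) (by omega)) hθ0.le)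
    simp only at i1 ⊢
    omega
  · have i1 := hm1 hst
    have i2 := hm2 hst
    simp only at i1 i2 h
    -- Both summands of the label are monotone, so equal sums force equal time slices and equal
    -- drift slices.
    have i3 := hlt (Nat.cast_nonneg s) hw0 (show ⌊(s : ℝ) / w⌋₊ = ⌊(t : ℝ) / w⌋₊ by omega)
    have i4 := hlt (hdr0 s) hθ0 (show ⌊dr s / θ⌋₊ = ⌊dr t / θ⌋₊ by omega)
    constructor
    · have i5 : dr s + drift Δ s t = dr t := by
        simp only [hdr, drift]
        rw [min_eq_left (by omega), min_eq_left (by omega)]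
        exact Finset.sum_Ico_consecutive _ (Nat.zero_le _) hst
      linarith
    · refine le_trans ?_ (hρ₀ (t + 1 - s) (by omega) (by omega))
      rw [hθ]
      refine mul_le_mul_of_nonneg_left ?_ h1.le
      have hpos' : (0 : ℝ) < ((t + 1 - s : ℕ) : ℝ) := by
        have : 0 < t + 1 - s := by omega
        exact_mod_cast this
      refine Real.rpow_le_rpow_of_nonpos hpos' ?_ (by linarith)
      rw [Nat.cast_sub (by omega)]
      push_cast
      linarith
  · push_cast
    have i1 := Nat.floor_le (a := (T : ℝ) / w) (by positivity)
    have i2 := Nat.floor_le (a := D / θ) (by positivity)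
    linarith

end Partitions

/-! ### Closed forms of the bounds and the conclusion. -/

section Bounds

variable {c₁ c₂ p : ℝ}

theorem piecesBound_half {T N : ℝ} (hN : 0 ≤ N) :
    piecesBound c₁ c₂ (1 / 2) T N = (c₁ + c₂ / c₁) * √(N * T) := by
  rw [piecesBound, show (1 : ℝ) - 1 / 2 = 1 / 2 by norm_num, Real.sqrt_mul hN,
    Real.sqrt_eq_rpow, Real.sqrt_eq_rpow]
  ring

/-- Exponent arithmetic: inserting the balanced number of pieces produces the two drift terms. -/
theorem piecesBound_driftPieces (h1 : 0 < c₁) (hp1 : p < 1) {T D : ℝ} (hT : 0 < T) (hD : 0 ≤ D) :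
    piecesBound c₁ c₂ p T (driftPieces c₁ p T D) = (c₁ * D ^ (1 - p) * T) ^ (1 / (2 - p))
      + c₂ / c₁ * (c₁ ^ (-p) * D ^ p * T ^ (2 - 2 * p)) ^ (1 / (2 - p)) := by
  have h2p : 2 - p ≠ 0 := by linarith
  have hpow : ∀ q : ℝ, driftPieces c₁ p T D ^ q = T ^ ((1 - p) * (q / (2 - p)))
      * D ^ (q / (2 - p)) * c₁ ^ (-(q / (2 - p))) := by
    intro q
    rw [driftPieces, ← Real.rpow_mul (by positivity), div_eq_mul_inv,
      Real.mul_rpow (by positivity) (by positivity), Real.mul_rpow (by positivity) hD,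
      ← Real.rpow_mul hT.le, Real.inv_rpow h1.le, ← Real.rpow_neg h1.le, one_div_mul_eq_div]
  have e1 : c₁ * driftPieces c₁ p T D ^ (1 - p) * T ^ p = (c₁ * D ^ (1 - p) * T) ^ (1 / (2 - p)) := by
    rw [hpow, Real.mul_rpow (by positivity) hT.le, Real.mul_rpow h1.le (by positivity),
      ← Real.rpow_mul hD, mul_one_div]
    have i1 : c₁ * c₁ ^ (-((1 - p) / (2 - p))) = c₁ ^ (1 / (2 - p)) := by
      rw [mul_comm, ← Real.rpow_add_one h1.ne']
      congr 1
      field_simp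
      ring
    have i2 : T ^ ((1 - p) * ((1 - p) / (2 - p))) * T ^ p = T ^ (1 / (2 - p)) := by
      rw [← Real.rpow_add hT]
      congr 1
      field_simp
      ring
    rw [← i1, ← i2]
    ring
  have e2 : driftPieces c₁ p T D ^ p * T ^ (1 - p)
      = (c₁ ^ (-p) * D ^ p * T ^ (2 - 2 * p)) ^ (1 / (2 - p)) := by
    rw [hpow, Real.mul_rpow (by positivity) (by positivity),
      Real.mul_rpow (by positivity) (by positivity), ← Real.rpow_mul hD, ← Real.rpow_mul h1.le,
      ← Real.rpow_mul hT.le, mul_one_div, mul_one_div, mul_one_div, neg_div]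
    have i2 : T ^ ((1 - p) * (p / (2 - p))) * T ^ (1 - p) = T ^ ((2 - 2 * p) / (2 - p)) := by
      rw [← Real.rpow_add hT]
      congr 1
      field_simp
      ring
    rw [← i2]
    ring
  rw [piecesBound, e1, mul_assoc (c₂ / c₁), e2]

variable (h1 : 0 < c₁) (h2 : 0 < c₂)
include h1 h2

/-- Either `c₁ ≥ 1 / 2`, or `c₂ ≥ 1 / 2 ≥ c₁` and the quotient is at least `1`. For small horizons
this makes the claimed bound exceed `T`. -/
theorem half_le_piecesBound_one (hp : 1 / 2 ≤ p) (hp1 : p < 1) (h : 1 ≤ c₁ + c₂) {T : ℝ}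
    (hT : 1 ≤ T) : 1 / 2 ≤ piecesBound c₁ c₂ p T 1 := by
  have i1 : 1 ≤ T ^ p := Real.one_le_rpow hT (by linarith)
  have i2 : 1 ≤ T ^ (1 - p) := Real.one_le_rpow hT (by linarith)
  have i3 : 0 < c₂ / c₁ := by positivity
  rw [piecesBound, Real.one_rpow, Real.one_rpow, mul_one, mul_one]
  suffices h3 : 1 / 2 ≤ c₁ + c₂ / c₁ by nlinarith
  rcases le_total (1 / 2) c₁ with h4 | h4
  · linarith
  · have : 1 ≤ c₂ / c₁ := by rw [le_div_iff₀ h1]; linarith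
    linarith

end Bounds

theorem logb_add_one_le {T : ℕ} {δ : ℝ} (hT : 1 ≤ T) (hδ : 0 < δ) (hδ1 : δ < 1) :
    Real.logb 2 T + 1 ≤ 2 * (1 + Real.log (T / δ)) ∧ 0 ≤ Real.logb 2 T ∧
      0 ≤ Real.log (T / δ) := by
  have hT1 : (1 : ℝ) ≤ T := by exact_mod_cast hT
  have h1 : 0 ≤ Real.log T := Real.log_nonneg hT1
  have h2 : Real.log T ≤ Real.log (T / δ) := by
    refine Real.log_le_log (by linarith) ?_
    rw [le_div_iff₀ hδ]
    nlinarith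
  have h3 := Real.log_two_gt_d9
  refine ⟨?_, ?_, h1.trans h2⟩
  · have h4 : Real.logb 2 T ≤ 2 * Real.log T := by
      rw [Real.logb, div_le_iff₀ (by linarith)]
      nlinarith
    linarith
  · exact div_nonneg h1 (by linarith)

namespace MasterState

variable {S U Pol O Z : Type*} [MeasurableSpace S] [MeasurableSpace U] [MeasurableSpace Pol]
  [MeasurableSpace O] [MeasurableSpace Z] {A : Learner S U Pol O} {env : ℕ → Pol → Z → O}
  {rew : O → ℝ} {T : ℕ} {δ : ℝ} {νZ : Measure Z} [IsProbabilityMeasure νZ]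
  {νU : Measure U} [IsProbabilityMeasure νU] {Δ ρ₀ : ℕ → ℝ} {c₁ c₂ p : ℝ}

/-- The regret bounds in terms of the number of pieces and of the total drift. -/
theorem regret_bound_pieces_and_drift (h1 : 0 < c₁) (h2 : 0 < c₂) (hp : 1 / 2 ≤ p) (hp1 : p < 1)
    (hT : 1 ≤ T) (hδ : 0 < δ) (hδ1 : δ < 1)
    (he : IsEnvironment env rew) (hA : A.IsMeasurable) (hns : IsNonstationarity νZ env rew T Δ)
    (hb : BaseGuarantee νZ νU env rew A T δ Δ ρ₀)
    (hρ₀ : ∀ t ∈ Set.Icc 1 T, (t : ℝ) * ρ₀ t = c₁ * (t : ℝ) ^ p + c₂) :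
    1 - δ ≤ (interactionLaw νZ (masterSeed νU)).real {ω |
      dynamicRegret νZ env rew (master A rew (cappedRate c₁ c₂ p) T δ) T ω
        ≤ 3360000 * (1 + Real.log (T / δ)) ^ 6 * min (piecesBound c₁ c₂ p T (pieces Δ T))
          (piecesBound c₁ c₂ p T (driftPieces c₁ p T (drift Δ 0 (T - 1)))
            + piecesBound c₁ c₂ p T 1)} := by
  have hne : Nonempty Pol := by
    have : Nonempty U := νU.nonempty_of_neZero
    exact ⟨A.policy A.init (Classical.arbitrary U)⟩
  have hΔ0 : ∀ u, u + 1 < T → 0 ≤ Δ u := fun u hu => hns.nonneg hu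
  have hT1 : (1 : ℝ) ≤ T := by exact_mod_cast hT
  have hT0 : (0 : ℝ) ≤ T := by linarith
  obtain ⟨hh, hlog0, hl0⟩ := logb_add_one_le hT hδ hδ1
  set l := Real.log (T / δ) with hl
  have hL1 : (1 : ℝ) ≤ pieces Δ T := by
    have : 1 ≤ pieces Δ T := by rw [pieces]; omega
    exact_mod_cast this
  have hD0 : 0 ≤ drift Δ 0 (T - 1) := Finset.sum_nonneg fun u hu => by
    rw [Finset.mem_Ico] at hu
    exact hΔ0 u (by omega)
  have hY0 : 0 ≤ driftPieces c₁ p T (drift Δ 0 (T - 1)) := by rw [driftPieces]; positivity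
  have hG1 : 0 ≤ piecesBound c₁ c₂ p T 1 := piecesBound_nonneg h1 h2 hT0 zero_le_one
  have hGY : 0 ≤ piecesBound c₁ c₂ p T (driftPieces c₁ p T (drift Δ 0 (T - 1))) :=
    piecesBound_nonneg h1 h2 hT0 hY0
  have hG1L : piecesBound c₁ c₂ p T 1 ≤ piecesBound c₁ c₂ p T (pieces Δ T) :=
    piecesBound_mono h1 h2 hp hp1 hT0 zero_le_one hL1
  have hone : ρ₀ 1 = c₁ + c₂ := by simpa using hρ₀ 1 ⟨le_rfl, hT⟩
  -- The lower bound `1 / √t` on the rate at `t = 1`.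
  have hc : 1 ≤ c₁ + c₂ := by
    rw [← hone]
    simpa using hb.lower 1 ⟨le_rfl, hT⟩
  rcases lt_or_ge T (2 ^ 14) with hTs | hTl
  -- For `T < 2 ^ 14` the regret is at most `2 ^ 14`, below half of the leading constant.
  · have huniv : {ω : ℕ → Z × (U × (ℕ → unitInterval)) |
      dynamicRegret νZ env rew (master A rew (cappedRate c₁ c₂ p) T δ) T ω
        ≤ 3360000 * (1 + l) ^ 6 * min (piecesBound c₁ c₂ p T (pieces Δ T))
          (piecesBound c₁ c₂ p T (driftPieces c₁ p T (drift Δ 0 (T - 1)))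
            + piecesBound c₁ c₂ p T 1)} = Set.univ := by
      refine Set.eq_univ_of_forall fun ω => ?_
      rw [Set.mem_ofPred_eq]
      have i1 : dynamicRegret νZ env rew (master A rew (cappedRate c₁ c₂ p) T δ) T ω ≤ T := by
        refine (Finset.sum_le_card_nsmul _ _ 1 fun t _ => ?_).trans (by simp)
        have i2 := optReward_le_one (νZ := νZ) he t
        have i3 := (he.rew_mem
          ((master A rew (cappedRate c₁ c₂ p) T δ).feedback env ω t)).1
        linarith
      have i4 : (T : ℝ) ≤ 2 ^ 14 := by exact_mod_cast hTs.le
      have i5 := half_le_piecesBound_one h1 h2 hp hp1 hc hT1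
      have i6 : 1 / 2 ≤ min (piecesBound c₁ c₂ p T (pieces Δ T))
          (piecesBound c₁ c₂ p T (driftPieces c₁ p T (drift Δ 0 (T - 1)))
            + piecesBound c₁ c₂ p T 1) := le_min (by linarith) (by linarith)
      have i7 : 1 ≤ (1 + l) ^ 6 := one_le_pow₀ (by linarith)
      have i8 : (1 : ℝ) * (1 / 2) ≤ (1 + l) ^ 6 * min (piecesBound c₁ c₂ p T (pieces Δ T))
          (piecesBound c₁ c₂ p T (driftPieces c₁ p T (drift Δ 0 (T - 1)))
            + piecesBound c₁ c₂ p T 1) := mul_le_mul i7 i6 (by norm_num) (by linarith)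
      linarith
    rw [huniv, probReal_univ]
    linarith
  -- The constant is `70000 * 2 ^ 4`. The cut at the middle adds one piece; it and the constants in
  -- the number of pieces cost a further factor `2` for stationary pieces and `3` for drift pieces,
  -- hence `3360000`.
  have hcoef : 70000 * (Real.logb 2 T + 1) ^ 4 * l ^ 2 ≤ 1120000 * (1 + l) ^ 6 := by
    have i1 : (Real.logb 2 T + 1) ^ 4 ≤ (2 * (1 + l)) ^ 4 :=
      pow_le_pow_left₀ (by linarith) hh 4
    have i2 : l ^ 2 ≤ (1 + l) ^ 2 := pow_le_pow_left₀ hl0 (by linarith) 2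
    calc _ ≤ 70000 * (2 * (1 + l)) ^ 4 * (1 + l) ^ 2 := by gcongr
      _ = _ := by ring
  have hρlow : ∀ j : ℕ, 1 ≤ j → j ≤ T → c₁ * (j : ℝ) ^ (p - 1) ≤ ρ₀ j := by
    intro j hj hjT
    have hj0 : (0 : ℝ) < j := by exact_mod_cast hj
    refine le_of_mul_le_mul_left ?_ hj0
    rw [hρ₀ j ⟨hj, hjT⟩]
    have : (j : ℝ) ^ p = j ^ (p - 1) * j := by
      rw [← Real.rpow_add_one hj0.ne']; congr 1; ring
    rw [this]
    linarith
  have hmono : ∀ {B B' : ℝ}, B ≤ B' → 1 - δ ≤ (interactionLaw νZ (masterSeed νU)).real {ω |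
      dynamicRegret νZ env rew (master A rew (cappedRate c₁ c₂ p) T δ) T ω ≤ B} →
      1 - δ ≤ (interactionLaw νZ (masterSeed νU)).real {ω |
      dynamicRegret νZ env rew (master A rew (cappedRate c₁ c₂ p) T δ) T ω ≤ B'} :=
    fun hBB h => h.trans (measureReal_mono fun ω hω => le_trans (show _ ≤ _ from hω) hBB)
  have hc0 : 0 ≤ 1120000 * (1 + l) ^ 6 := by positivity
  rcases le_total (piecesBound c₁ c₂ p T (pieces Δ T))
      (piecesBound c₁ c₂ p T (driftPieces c₁ p T (drift Δ 0 (T - 1)))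
            + piecesBound c₁ c₂ p T 1) with hcase | hcase
  · rw [min_eq_left hcase]
    obtain ⟨lab, hm, hL, hd⟩ := exists_lab_pieces (T := T) (Δ := Δ) (ρ₀ := ρ₀)
      fun j hj hjT => le_trans (by positivity) (hρlow j hj hjT)
    refine hmono ?_ (regret_bound h1 h2 hp hp1 hTl hδ hδ1 he hA hns hb hρ₀ hm hL hd)
    have i1 : piecesBound c₁ c₂ p T ((pieces Δ T + 1 : ℕ) : ℝ)
        ≤ 2 * piecesBound c₁ c₂ p T (pieces Δ T) := by
      refine (piecesBound_mono h1 h2 hp hp1 hT0 (Nat.cast_nonneg _) ?_).trans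
        (piecesBound_mul_le h1 h2 hp hp1 hT0 one_le_two (by linarith))
      push_cast
      linarith
    calc _ ≤ 1120000 * (1 + l) ^ 6 * (2 * piecesBound c₁ c₂ p T (pieces Δ T)) :=
          mul_le_mul hcoef i1 (piecesBound_nonneg h1 h2 hT0 (Nat.cast_nonneg _)) hc0
      _ ≤ _ := by
          have : 0 ≤ (1 + l) ^ 6 * piecesBound c₁ c₂ p T (pieces Δ T) :=
            mul_nonneg (by positivity) (hG1.trans hG1L)
          linarith
  · rw [min_eq_right hcase]
    obtain ⟨lab, L, θ, hm, hL, hd, hcount⟩ := exists_lab_drift h1 hp hp1 hT hΔ0 hρlow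
    refine hmono ?_ (regret_bound h1 h2 hp hp1 hTl hδ hδ1 he hA hns hb hρ₀ hm hL hd)
    set Y := driftPieces c₁ p T (drift Δ 0 (T - 1))
    have i1 : piecesBound c₁ c₂ p T ((L + 1 : ℕ) : ℝ)
        ≤ 3 * (piecesBound c₁ c₂ p T Y + piecesBound c₁ c₂ p T 1) := by
      refine (piecesBound_mono h1 h2 hp hp1 hT0 (Nat.cast_nonneg _)
        (y := 3 * (Y + 1)) ?_).trans ((piecesBound_mul_le h1 h2 hp hp1 hT0 (by norm_num)
          (by linarith)).trans ?_)
      · push_cast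
        linarith
      · have := piecesBound_add_le h1 h2 hp hp1 hT0 hY0 zero_le_one
        linarith
    calc _ ≤ 1120000 * (1 + l) ^ 6 * (3 * (piecesBound c₁ c₂ p T Y + piecesBound c₁ c₂ p T 1)) :=
          mul_le_mul hcoef i1 (piecesBound_nonneg h1 h2 hT0 (Nat.cast_nonneg _)) hc0
      _ = _ := by ring

end MasterState

theorem theorem1 :
    ∃ (K : ℝ) (k : ℕ), 0 < K ∧
      ∀ (Pol O Z S U : Type*) [MeasurableSpace Pol] [MeasurableSpace O] [MeasurableSpace Z]
        [MeasurableSpace S] [MeasurableSpace U]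
        (νZ : MeasureTheory.Measure Z) [MeasureTheory.IsProbabilityMeasure νZ]
        (νU : MeasureTheory.Measure U) [MeasureTheory.IsProbabilityMeasure νU]
        (env : ℕ → Pol → Z → O) (rew : O → ℝ) (A : Learner S U Pol O)
        (T : ℕ) (δ : ℝ) (Δ ρ : ℕ → ℝ) (p c₁ c₂ : ℝ),
        1 ≤ T → 0 < δ → δ < 1 → 1 / 2 ≤ p → p < 1 → 0 < c₁ → 0 < c₂ →
        IsEnvironment env rew → A.IsMeasurable →
        IsNonstationarity νZ env rew T Δ →
        BaseGuarantee νZ νU env rew A T δ Δ ρ →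
        (∀ t ∈ Set.Icc 1 T, (t : ℝ) * ρ t = c₁ * (t : ℝ) ^ p + c₂) →
        let L : ℝ := pieces Δ T
        let D : ℝ := drift Δ 0 (T - 1)
        let M := master A rew (fun t => min (c₁ * (t : ℝ) ^ p + c₂) t / t) T δ
        let Prob := interactionLaw νZ (masterSeed νU)
        (p = 1 / 2 →
          1 - δ ≤ Prob.real {ω | dynamicRegret νZ env rew M T ω ≤
            K * (1 + Real.log (T / δ)) ^ k *
              min ((c₁ + c₂ / c₁) * Real.sqrt (L * T))
                ((c₁ ^ (2 / 3 : ℝ) + c₂ * c₁ ^ (-(4 / 3) : ℝ)) *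
                    D ^ (1 / 3 : ℝ) * (T : ℝ) ^ (2 / 3 : ℝ)
                  + (c₁ + c₂ / c₁) * Real.sqrt T)}) ∧
        (1 / 2 < p →
          1 - δ ≤ Prob.real {ω | dynamicRegret νZ env rew M T ω ≤
            K * (1 + Real.log (T / δ)) ^ k *
              min (c₁ * L ^ (1 - p) * (T : ℝ) ^ p
                  + (c₂ / c₁) * L ^ p * (T : ℝ) ^ (1 - p))
                ((c₁ * D ^ (1 - p) * T) ^ (1 / (2 - p)) + c₁ * (T : ℝ) ^ p
                  + (c₂ / c₁) * ((c₁ ^ (-p) * D ^ p * (T : ℝ) ^ (2 - 2 * p)) ^ (1 / (2 - p))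
                    + (T : ℝ) ^ (1 - p)))}) := by
  refine ⟨3360000, 6, by norm_num, ?_⟩
  intro Pol O Z S U _ _ _ _ _ νZ _ νU _ env rew A T δ Δ ρ p c₁ c₂ hT hδ hδ1 hp hp1 h1 h2 he hA
    hns hb hρ L D M Prob
  have hne : Nonempty Pol := by
    have : Nonempty U := νU.nonempty_of_neZero
    exact ⟨A.policy A.init (Classical.arbitrary U)⟩
  have hT0 : (0 : ℝ) < T := by exact_mod_cast hT
  have hD0 : 0 ≤ D := Finset.sum_nonneg fun u hu => by
    rw [Finset.mem_Ico] at hu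
    exact hns.nonneg (by omega)
  have hmain := MasterState.regret_bound_pieces_and_drift h1 h2 hp hp1 hT hδ hδ1 he hA hns hb hρ
  rw [piecesBound_driftPieces h1 hp1 hT0 hD0] at hmain
  constructor
  · rintro rfl
    rw [piecesBound_half (Nat.cast_nonneg _), piecesBound_half zero_le_one,
      one_mul] at hmain
    -- At `p = 1 / 2` both drift terms have the same powers of `D` and `T`, so they merge into one.
    have e : (c₁ * D ^ (1 - 1 / 2 : ℝ) * T) ^ (1 / (2 - 1 / 2) : ℝ)
        + c₂ / c₁ * (c₁ ^ (-(1 / 2) : ℝ) * D ^ (1 / 2 : ℝ) * (T : ℝ) ^ (2 - 2 * (1 / 2) : ℝ))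
          ^ (1 / (2 - 1 / 2) : ℝ)
        = (c₁ ^ (2 / 3 : ℝ) + c₂ * c₁ ^ (-(4 / 3) : ℝ)) * D ^ (1 / 3 : ℝ) * (T : ℝ) ^ (2 / 3 : ℝ) := by
      norm_num only
      rw [Real.mul_rpow (by positivity) hT0.le, Real.mul_rpow h1.le (by positivity),
        ← Real.rpow_mul hD0, Real.rpow_one, Real.mul_rpow (by positivity) hT0.le,
        Real.mul_rpow (by positivity) (by positivity), ← Real.rpow_mul hD0, ← Real.rpow_mul h1.le]
      norm_num only
      have i : c₁ ^ (-(4 / 3) : ℝ) = c₁ ^ (-(1 / 3) : ℝ) / c₁ := by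
        rw [eq_div_iff h1.ne', ← Real.rpow_add_one h1.ne']
        norm_num
      rw [i]
      ring
    rw [e] at hmain
    exact hmain
  · intro _
    have e : piecesBound c₁ c₂ p T 1 = c₁ * (T : ℝ) ^ p + c₂ / c₁ * (T : ℝ) ^ (1 - p) := by
      rw [piecesBound, Real.one_rpow, Real.one_rpow, mul_one, mul_one]
    have e2 : (c₁ * D ^ (1 - p) * T) ^ (1 / (2 - p)) + c₁ * (T : ℝ) ^ p
          + (c₂ / c₁) * ((c₁ ^ (-p) * D ^ p * (T : ℝ) ^ (2 - 2 * p)) ^ (1 / (2 - p))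
            + (T : ℝ) ^ (1 - p))
        = (c₁ * D ^ (1 - p) * T) ^ (1 / (2 - p))
          + c₂ / c₁ * (c₁ ^ (-p) * D ^ p * (T : ℝ) ^ (2 - 2 * p)) ^ (1 / (2 - p))
          + piecesBound c₁ c₂ p T 1 := by
      rw [e]; ring
    rw [e2]
    exact hmain
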